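/- **Setting.** Let $d,m,q\ge 1$ be integers, $n=mq$, $N=n^d$, $M=m^d$, $Q=q^d$. Let $\Lambda_N=(\frac1n\mathbb Z)^d\cap[0,1)^d$ and $\bar\Lambda_M=(\frac1m\mathbb Z)^d\cap[0,1)^d$ with periodic boundary conditions, $|x-y|$ being the Euclidean distance on the torus $(\mathbb R/\mathbb Z)^d$. Let $V:[0,\infty)\to\mathbb R$ be $C^1$ with $V(r)=0$ for $r\ge1$, let $L>0$, $\beta>0$, $h\in\mathbb R$, and put $J(x-y)=L^{-d}V(\frac nL|x-y|)$, $$H_N(\sigma)=-\tfrac12\sum_{x}\sum_{y\ne x}J(x-y)\sigma(x)\sigma(y)+h\sum_x\sigma(x),\qquad \sigma\in\{\pm1\}^{\Lambda_N}.$$ Let $P_N$ be the uniform (symmetric Bernoulli product) measure on $\{\pm1\}^{\Lambda_N}$ and $\mu_{N}=Z_N^{-1}e^{-\beta H_N}P_N$. For $k\in\bar\Lambda_M$ let $C_k=k+[0,\frac1m)^d$ (it contains $Q$ points of $\Lambda_N$), let $F(\sigma)=\eta$ with $\eta(k)=\sum_{x\in C_k}\sigma(x)$, so that $\eta\in\{-Q,-Q+2,\dots,Q\}^{\bar\Lambda_M}$,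 let $\bar P_M=P_N\circ F^{-1}$, and let $\mathbb E[\,\cdot\,|\eta]$ be the expectation under $P_N(\,\cdot\,|F=\eta)$. The exact coarse-grained Hamiltonian $\bar H_M$ is defined by $e^{-\beta\bar H_M(\eta)}=\mathbb E[e^{-\beta H_N}|\eta]$. A finite-range translation-invariant many-body potential of range $R$ is a family of functions $\Phi(X,\eta)$, $X\subset\bar\Lambda_M$, with $\Phi(\emptyset,\cdot)=0$, such that $\Phi(X,\eta)$ depends only on $(\eta(k))_{k\in X}$, is invariant under simultaneous translation of $X$ and $\eta$ on the discrete torus, and vanishes if $X$ contains two points at torus distance more than $R/m$; its Hamiltonian is $\sum_X\Phi(X,\eta)$. Let $$\epsilon=\beta\,\frac qL\,\|\nabla V\|_\infty,\qquad \|\nabla V\|_\infty=\sup_{r\ge0}|V'(r)| .$$ **First terms.** For $k,l\in\bar\Lambda_M$ let $\bar J(k,l)=Q^{-2}\sum_{x\in C_k,y\in C_l}J(x-y)$ if $k\neq l$ and $\bar J(k,k)=\frac1{Q(Q-1)}\sum_{x,y\in C_k,\,x\ne y}J(x-y)$; let $E_{kl}(x-y)=J(x-y)-\bar J(k,l)$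 for $x\in C_k$, $y\in C_l$, and $$j^1_{kl}=\sum_{\substack{x\in C_k\\y\in C_l}}E_{kl}(x-y)^2,\quad j^2_{kl}=\sum_{\substack{x\in C_k\\y,y'\in C_l}}E_{kl}(x-y)E_{kl}(x-y'),\quad j^2_{k_1k_2k_3}=\sum_{\substack{x\in C_{k_1},\,y\in C_{k_2}\\z\in C_{k_3}}}E_{k_1k_2}(x-y)E_{k_2k_3}(y-z),$$ where terms in which the two arguments of some $E$ coincide are omitted. With $\alpha(k)=\frac{\eta(k)+Q}2$, $a=\alpha(k)$ and $\omega=Q-a$, let $E_i(k)=E_i(\alpha(k))$ be the mean of the product of $i$ distinct spins of a cell with $a$ spins $+1$ and $\omega$ spins $-1$: $$E_1=\tfrac{2a-Q}{Q},\qquad E_2=\tfrac{a(a-1)-2a\omega+\omega(\omega-1)}{Q(Q-1)},\qquad E_3=\tfrac{a(a-1)(a-2)-3a(a-1)\omega+3a\omega(\omega-1)-\omega(\omega-1)(\omega-2)}{Q(Q-1)(Q-2)},$$ $$E_4=\tfrac{a(a-1)(a-2)(a-3)-4a(a-1)(a-2)\omega+6a(a-1)\omega(\omega-1)-4a\omega(\omega-1)(\omega-2)+\omega(\omega-1)(\omega-2)(\omega-3)}{Q(Q-1)(Q-2)(Q-3)}$$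 (fractions with denominator $0$ are read as $0$). Fix any total order $<$ on $\bar\Lambda_M$ and set $\bar H^{(0)}_M(\eta)=\mathbb E[H_N|\eta]$, $$\begin{aligned}-\bar H^{(1)}_M(\eta)={}&\tfrac\beta8\sum_k\big\{4j^2_{kk}[E_2(k)-E_4(k)]+2j^1_{kk}[E_4(k)+1-2E_2(k)]\big\}\\&+\tfrac\beta2\sum_{k<l}\big\{j^1_{kl}[E_2(k)E_2(l)-E_2(k)-E_2(l)+1]+j^2_{kl}[E_2(k)+E_2(l)-2E_2(k)E_2(l)]\big\}\\&+\tfrac\beta2\sum_{k}\sum_{l\ne k}j^2_{kkl}[2E_1(k)E_1(l)-E_3(k)E_1(l)-E_3(l)E_1(k)],\end{aligned}$$ $$-\bar H^{(2)}_M(\eta)=\beta\sum_{k_1<k_2<k_3}\ \sum_{(a,b,c)}j^2_{abc}\,\big[E_1(a)E_1(c)-E_1(a)E_2(b)E_1(c)\big],$$ the inner sum running over $(a,b,c)\in\{(k_1,k_2,k_3),(k_2,k_3,k_1),(k_3,k_1,k_2)\}$. **Theorem.** For every $d\ge1$ there are $\delta_0>0$ and constants $C_p$, $p=0,1,2,\dots$,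 depending only on $d$ and $p$, such that for all $q,L,V,\beta,h$ as above with $\delta=Q\epsilon<\delta_0$ there are numbers $R_p$ $(p\ge 0)$ such that for every $m\ge1$ there are Hamiltonians $\bar H^{(p)}_M$, $p\ge0$, where $\bar H^{(0)}_M,\bar H^{(1)}_M,\bar H^{(2)}_M$ are the ones given above, with the following properties. 1. Each $\bar H^{(p)}_M$ is the Hamiltonian of a translation-invariant many-body potential of finite range $R_p$ (independent of $N$), and for every $\eta$ the series $\sum_{p\ge0}\bar H^{(p)}_M(\eta)$ converges to $\bar H_M(\eta)$. 2. For all $p\ge0$ and all $\eta$, $\ \big|\frac\beta N\big(\bar H_M(\eta)-\sum_{i=0}^p\bar H^{(i)}_M(\eta)\big)\big|\le C_p\,\epsilon^{p+1}$. 3. Let $\bar\mu^{(p)}_{M}$ be the probability measure proportional to $e^{-\beta(\bar H^{(0)}_M+\dots+\bar H^{(p)}_M)}\bar P_M$ and let $\mathcal R(\cdot|\cdot)$ be the relative entropy (Kullback–Leibler divergence). Then $$\tfrac1N\mathcal R(\bar\mu^{(0)}_{M}\,|\,\mu_{N}\circ F^{-1})\le C_0\,\epsilon^2,\qquad \tfrac1N\mathcal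 R(\bar\mu^{(p)}_{M}\,|\,\mu_{N}\circ F^{-1})\le C_p\,\epsilon^{p+1}\quad(p\ge0).$$ -/

import Mathlib

open MeasureTheory
open scoped ENNReal

noncomputable section

namespace Kadanoff

/-! ## Lattices on the torus -/

/-- The lattice `((1/n)ℤ)^d ∩ [0,1)^d`; the index vector `x` stands for the point `x / n`. -/
abbrev Site (d n : ℕ) : Type := Fin d → Fin n

/-- Euclidean distance on the torus `(ℝ/ℤ)^d` between the lattice points `x / n` and `y / n`. -/
def torusDist {d n : ℕ} (x y : Site d n) : ℝ :=
  Real.sqrt (∑ i, ‖((((x i : ℕ) : ℝ) / n - ((y i : ℕ) : ℝ) / n : ℝ) : UnitAddCircle)‖ ^ 2)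

/-! ## The microscopic model -/

/-- Spin configurations `σ : Λ_N → {+1, -1}`. -/
abbrev MicroConfig (d n : ℕ) : Type := Site d n → ℤˣ

/-- The real value `±1` of the spin at `x`. -/
def spin {d n : ℕ} (σ : MicroConfig d n) (x : Site d n) : ℝ := (((σ x : ℤˣ) : ℤ) : ℝ)

/-- The pair potential `J(x - y) = L^{-d} V((n/L)|x - y|)`. -/
def pairJ (L : ℝ) (V : ℝ → ℝ) {d n : ℕ} (x y : Site d n) : ℝ :=
  V ((n : ℝ) / L * torusDist x y) / L ^ d

/-- The microscopic Hamiltonian, with a constant external field `h`. -/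
def microH (L : ℝ) (V : ℝ → ℝ) (h : ℝ) {d n : ℕ} (σ : MicroConfig d n) : ℝ :=
  -(1 / 2) * ∑ x, ∑ y ∈ Finset.univ.erase x, pairJ L V x y * spin σ x * spin σ y
    + h * ∑ x, spin σ x

instance : MeasurableSingletonClass ℤˣ :=
  ⟨fun u => ⟨{(u : ℤ)}, MeasurableSet.singleton _, by
    ext v
    simp [Units.ext_iff]⟩⟩

/-- The symmetric Bernoulli distribution of a single spin. -/
def spinPrior : Measure ℤˣ :=
  (1 / 2 : ℝ≥0∞) • Measure.dirac 1 + (1 / 2 : ℝ≥0∞) • Measure.dirac (-1)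

/-- The product prior `P_N`. -/
def prior (d n : ℕ) : Measure (MicroConfig d n) := Measure.pi fun _ => spinPrior

/-- The Gibbs measure `Z_N⁻¹ exp(-β H_N) P_N`. -/
def microGibbs (L : ℝ) (V : ℝ → ℝ) (β h : ℝ) (d n : ℕ) : Measure (MicroConfig d n) :=
  (prior d n).tilted fun σ => -β * microH L V h σ

/-! ## Coarse graining of configurations -/

/-- The coarse cell `C_k` that contains `x`; cells are indexed by the coarse lattice. -/
def cellOf {d m q : ℕ} (x : Site d (m * q)) : Site d m := fun i => (x i).divNat

/-- The microscopic sites of the cell `C_k`. -/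
def cell {d m : ℕ} (q : ℕ) (k : Site d m) : Finset (Site d (m * q)) :=
  Finset.univ.filter fun x => cellOf x = k

theorem card_cell {d m q : ℕ} (k : Site d m) : (cell q k).card = q ^ d := by
  classical
  let e : (Fin d → Fin q) → Site d (m * q) := fun r i => finProdFinEquiv (k i, r i)
  have he : Function.Injective e := by
    intro r s h
    funext i
    have := congrFun h i
    simp only [e, EmbeddingLike.apply_eq_iff_eq, Prod.mk.injEq, true_and] at this
    exact this
  have : cell q k = Finset.univ.image e := by
    ext x
    simp only [cell, Finset.mem_filter, Finset.mem_univ, true_and, Finset.mem_image]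
    constructor
    · intro h
      refine ⟨fun i => (x i).modNat, ?_⟩
      funext i
      have h1 : (x i).divNat = k i := congrFun h i
      have h2 := finProdFinEquiv.apply_symm_apply (x i)
      rw [finProdFinEquiv_symm_apply, h1] at h2
      exact h2
    · rintro ⟨r, rfl⟩
      funext i
      have h2 := finProdFinEquiv.symm_apply_apply (k i, r i)
      rw [finProdFinEquiv_symm_apply] at h2
      exact congrArg Prod.fst h2
  rw [this, Finset.card_image_of_injective _ he]
  simp

/-- The set `{-Q, -Q+2, …, Q}` of values of a coarse spin. -/
abbrev CoarseSpin (Q : ℕ) : Type :=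
  ↥((Finset.range (Q + 1)).image fun j : ℕ => 2 * (j : ℤ) - (Q : ℤ))

/-- Coarse configurations `η`, with `Q = q^d` microscopic sites per cell. -/
abbrev CoarseConfig (d m q : ℕ) : Type := Site d m → CoarseSpin (q ^ d)

theorem sum_units_mem {ι : Type*} (s : Finset ι) (f : ι → ℤˣ) :
    ∑ x ∈ s, ((f x : ℤˣ) : ℤ) ∈
      (Finset.range (s.card + 1)).image fun j : ℕ => 2 * (j : ℤ) - (s.card : ℤ) := by
  classical
  refine Finset.mem_image.2 ⟨(s.filter fun x => f x = 1).card, ?_, ?_⟩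
  · exact Finset.mem_range.2 (Nat.lt_succ_of_le (Finset.card_filter_le _ _))
  · have h : ∀ x ∈ s, ((f x : ℤˣ) : ℤ) = 2 * (if f x = 1 then 1 else 0) - 1 := by
      intro x _
      rcases Int.units_eq_one_or (f x) with hx | hx <;> simp [hx]
    rw [Finset.sum_congr rfl h, Finset.sum_sub_distrib, ← Finset.mul_sum]
    simp

/-- The block-spin map `F`, `η(k) = ∑_{x ∈ C_k} σ(x)`. -/
def blockSpin {d m q : ℕ} (σ : MicroConfig d (m * q)) : CoarseConfig d m q := fun k =>
  ⟨∑ x ∈ cell q k, ((σ x : ℤˣ) : ℤ), by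
    have h := sum_units_mem (cell q k) σ
    rwa [card_cell] at h⟩

/-- The conditional expectation `E[f | η] = ∫ f(σ) P_N(dσ | F(σ) = η)`. -/
def condE {d m q : ℕ} (f : MicroConfig d (m * q) → ℝ) (η : CoarseConfig d m q) : ℝ :=
  ∫ σ, f σ ∂(ProbabilityTheory.cond (prior d (m * q)) (blockSpin ⁻¹' {η}))

/-- The coarse prior `P_N ∘ F⁻¹`. -/
def coarsePrior (d m q : ℕ) : Measure (CoarseConfig d m q) :=
  (prior d (m * q)).map blockSpin

/-- The coarse Gibbs measure `Z⁻¹ exp(-β K) P_N ∘ F⁻¹` of a coarse Hamiltonian `K`. -/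
def coarseGibbs (β : ℝ) {d m q : ℕ} (K : CoarseConfig d m q → ℝ) :
    Measure (CoarseConfig d m q) :=
  (coarsePrior d m q).tilted fun η => -β * K η

/-- The exact coarse-grained Hamiltonian, `exp(-β H̄(η)) = E[exp(-β H_N) | η]`. -/
def exactH (L : ℝ) (V : ℝ → ℝ) (β h : ℝ) {d m q : ℕ} (η : CoarseConfig d m q) : ℝ :=
  -(1 / β) * Real.log (condE (fun σ => Real.exp (-β * microH L V h σ)) η)

/-- The first approximation `E[H_N | η]`. -/
def coarseH0 (L : ℝ) (V : ℝ → ℝ) (h : ℝ) {d m q : ℕ} (η : CoarseConfig d m q) : ℝ :=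
  condE (fun σ => microH L V h σ) η

/-! ## Small parameter -/

/-- `‖∇V‖_∞` for a profile `V` on `[0, ∞)`. -/
def gradSup (V : ℝ → ℝ) : ℝ :=
  ⨆ r : Set.Ici (0 : ℝ), |derivWithin V (Set.Ici 0) (r : ℝ)|

/-- `ε = β (q/L) ‖∇V‖_∞`. -/
def smallEps (L : ℝ) (V : ℝ → ℝ) (β : ℝ) (q : ℕ) : ℝ := β * ((q : ℝ) / L) * gradSup V

/-! ## Many-body potentials on the coarse lattice -/

/-- The Hamiltonian `∑_X Φ(X, η)` of a many-body potential. -/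
def potentialH {d m q : ℕ} (Φ : Finset (Site d m) → CoarseConfig d m q → ℝ)
    (η : CoarseConfig d m q) : ℝ :=
  ∑ X : Finset (Site d m), Φ X η

/-- `Φ` is a translation-invariant many-body potential of range at most `R`, distances being
measured in units of the coarse lattice spacing `1/m`. Translations are those of the discrete
torus (addition in `Fin m` is modulo `m`). -/
structure IsFiniteRangePotential {d m q : ℕ} (R : ℝ)
    (Φ : Finset (Site d m) → CoarseConfig d m q → ℝ) : Prop where
  empty : ∀ η, Φ ∅ η = 0
  local_dep : ∀ X η η', (∀ k ∈ X, η k = η' k) → Φ X η = Φ X η'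
  translation : ∀ (a : Site d m) X η,
    Φ (X.image fun k => k + a) (fun k => η (k - a)) = Φ X η
  range : ∀ X, (∃ k ∈ X, ∃ l ∈ X, R < (m : ℝ) * torusDist k l) → ∀ η, Φ X η = 0

/-! ## The explicit first corrections -/

/-- The cell average `J̄(k,l)` of the pair potential. -/
def avgJ (L : ℝ) (V : ℝ → ℝ) {d m : ℕ} (q : ℕ) (k l : Site d m) : ℝ :=
  if k = l then
    (∑ x ∈ cell q k, ∑ y ∈ (cell q k).erase x, pairJ L V x y)
      / (((q : ℝ) ^ d) * ((q : ℝ) ^ d - 1))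
  else (∑ x ∈ cell q k, ∑ y ∈ cell q l, pairJ L V x y) / ((q : ℝ) ^ d) ^ 2

/-- The fluctuation `E_{kl}(x - y) = J(x - y) - J̄(k,l)` for `x ∈ C_k`, `y ∈ C_l`. -/
def devJ (L : ℝ) (V : ℝ → ℝ) {d m q : ℕ} (x y : Site d (m * q)) : ℝ :=
  pairJ L V x y - avgJ L V q (cellOf x) (cellOf y)

/-- `j¹_{kl}`, the sum of `E_{kl}(x-y)²` over `x ∈ C_k`, `y ∈ C_l`, `y ≠ x`. -/
def jOne (L : ℝ) (V : ℝ → ℝ) {d m : ℕ} (q : ℕ) (k l : Site d m) : ℝ :=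
  ∑ x ∈ cell q k, ∑ y ∈ (cell q l).erase x, devJ L V x y ^ 2

/-- `j²_{kl}`, the sum of `E_{kl}(x-y) E_{kl}(x-y')` over `x ∈ C_k`, `y, y' ∈ C_l`,
`y ≠ x`, `y' ≠ x`. -/
def jTwo (L : ℝ) (V : ℝ → ℝ) {d m : ℕ} (q : ℕ) (k l : Site d m) : ℝ :=
  ∑ x ∈ cell q k, ∑ y ∈ (cell q l).erase x, ∑ y' ∈ (cell q l).erase x,
    devJ L V x y * devJ L V x y'

/-- `j²_{k₁k₂k₃}`, the sum of `E_{k₁k₂}(x-y) E_{k₂k₃}(y-z)` over `x ∈ C_{k₁}`, `y ∈ C_{k₂}`,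
`z ∈ C_{k₃}`, `x ≠ y`, `z ≠ y`. -/
def jThree (L : ℝ) (V : ℝ → ℝ) {d m : ℕ} (q : ℕ) (k₁ k₂ k₃ : Site d m) : ℝ :=
  ∑ y ∈ cell q k₂, ∑ x ∈ (cell q k₁).erase y, ∑ z ∈ (cell q k₃).erase y,
    devJ L V x y * devJ L V y z

/-- The moments `E_i` of `i` distinct spins in a cell of `Q` sites of which `a` carry `+1`
and `w = Q - a` carry `-1`. (They are `0` where the denominator vanishes; for `Q < i` they multiply
sums that are `0`.) -/
def mom1 (Q a : ℝ) : ℝ := (2 * a - Q) / Q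

/-- See `mom1`. -/
def mom2 (Q a : ℝ) : ℝ :=
  let w := Q - a
  (a * (a - 1) - 2 * a * w + w * (w - 1)) / (Q * (Q - 1))

/-- See `mom1`. -/
def mom3 (Q a : ℝ) : ℝ :=
  let w := Q - a
  (a * (a - 1) * (a - 2) - 3 * a * (a - 1) * w + 3 * a * (w - 1) * w
    - (w - 2) * (w - 1) * w) / (Q * (Q - 1) * (Q - 2))

/-- See `mom1`. -/
def mom4 (Q a : ℝ) : ℝ :=
  let w := Q - a
  (a * (a - 1) * (a - 2) * (a - 3) - 4 * a * (a - 1) * (a - 2) * w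
    + 6 * a * (a - 1) * (w - 1) * w - 4 * a * (w - 2) * (w - 1) * w
    + w * (w - 1) * (w - 2) * (w - 3)) / (Q * (Q - 1) * (Q - 2) * (Q - 3))

/-- `α(k) = (η(k) + Q)/2`, the number of `+1` spins in `C_k`. -/
def alpha {d m q : ℕ} (η : CoarseConfig d m q) (k : Site d m) : ℝ :=
  ((((η k : CoarseSpin (q ^ d)) : ℤ) : ℝ) + (q : ℝ) ^ d) / 2

/-- The one- and two-cell part of the second-order correction. Sums over unordered pairs of
cells are written as half the sum over ordered pairs. -/
def coarseH1 (L : ℝ) (V : ℝ → ℝ) (β : ℝ) {d m q : ℕ} (η : CoarseConfig d m q) : ℝ :=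
  let E₁ := fun k => mom1 ((q : ℝ) ^ d) (alpha η k)
  let E₂ := fun k => mom2 ((q : ℝ) ^ d) (alpha η k)
  let E₃ := fun k => mom3 ((q : ℝ) ^ d) (alpha η k)
  let E₄ := fun k => mom4 ((q : ℝ) ^ d) (alpha η k);
  -(β / 8 * ∑ k, (4 * jTwo L V q k k * (-E₄ k + E₂ k)
        + 2 * jOne L V q k k * (E₄ k + 1 - 2 * E₂ k))
    + β / 2 * (1 / 2 * ∑ k, ∑ l ∈ Finset.univ.erase k,
        (jOne L V q k l * (E₂ k * E₂ l - E₂ l - E₂ k + 1)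
          + jTwo L V q k l * (-2 * E₂ k * E₂ l + E₂ k + E₂ l)))
    + β / 2 * ∑ k, ∑ l ∈ Finset.univ.erase k,
        jThree L V q k k l * (-E₃ k * E₁ l + 2 * E₁ k * E₁ l - E₃ l * E₁ k))

/-- The three-cell part of the second-order correction. The sum over a middle cell `k₂` and an
unordered pair of further cells is written as half the sum over ordered triples. -/
def coarseH2 (L : ℝ) (V : ℝ → ℝ) (β : ℝ) {d m q : ℕ} (η : CoarseConfig d m q) : ℝ :=
  let E₁ := fun k => mom1 ((q : ℝ) ^ d) (alpha η k)
  let E₂ := fun k => mom2 ((q : ℝ) ^ d) (alpha η k);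
  -(β * (1 / 2 * ∑ k₂, ∑ k₁ ∈ Finset.univ.erase k₂, ∑ k₃ ∈ (Finset.univ.erase k₂).erase k₁,
      jThree L V q k₁ k₂ k₃ * (-E₁ k₁ * E₂ k₂ * E₁ k₃ + E₁ k₁ * E₁ k₃)))

end Kadanoff

end

/-!
On the configurations with prescribed block spins `η` the microscopic energy is a constant, the
energy of the cell-averaged interaction, plus the energy of the pair fluctuations
`E(x,y) = J(x-y) - J̄(k,l)` (`microH_eq`). With `W` the fluctuation energy multiplied by `-β`, this
gives `-β (H̄ - H̄⁽⁰⁾)(η) = log 𝔼[exp W | η]` (`exactH_eq`), and everything is read off from the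
cumulants of `W` under the uniform measure on the configurations with block spins `η`.

*Analyticity.* By the regularity of `V`, every row sum of `β |E|` is at most `ρ = κ ε` with `κ`
depending on `d` only (`sum_abs_devJ_le`). For complex `z` with `|z| ρ ≤ 1/40` the partition
function `∑ exp (z W)` has no zero and its normalized two-point functions are bounded
(`pairZ_pinned`). No cluster expansion is needed for this. One releases the spins site by site,
and in each step compares the one-site marginals of two sites `z`, `w` of one cell: exchanging
their values keeps the block spin and changes the weight only by couplings in the rows of `z` and
`w`, hence by a factor close to `1`. As the block spin fixes the sum of the marginals over the free
sites of the cell, none of them can be much larger than the average. So the logarithm of the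
partition function is analytic in a disc of radius `1/(40 ρ)` with derivative of order `N ρ`, and
Cauchy's estimates bound the `j`-th cumulant by `N (80 ρ)^j`, up to a factor (`cumulant_slice`).
The cumulant series therefore converges geometrically, with the remainders claimed.

*Explicit terms.* The first cumulant vanishes because the fluctuations add up to zero over each
pair of cells; this makes the zeroth-order error quadratic in `ε`. The second cumulant is computed
exactly from the independence of the cells and the moments of distinct spins in a cell: it equals
`-β (H̄⁽¹⁾ + H̄⁽²⁾)` (`cumulant_two_eq`). The terms of index `p ≥ 3` are the cumulants,
multiplied by `-1/β`. The error after the term `p = 1` is the one after `p = 2` plus `H̄⁽²⁾`, which is itself of order `ε²`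
(`abs_coarseH2_le`).

*Finite range.* The potential of the `p`-th cumulant is the Möbius transform of the set function
that sends `X` to the `p`-th cumulant of the fluctuation energy inside the cells of `X`. Cells are
independent given `η`, so this function is additive over sets of cells beyond the interaction
range, and it involves at most `2p` cells at a time; a set containing two cells at distance more
than `2p` ranges then has a gap and carries no potential (`mobius_eq_zero_of_far`,
`isFiniteRangePotential_cumulantPotential`).

*Relative entropy.* The image of the Gibbs measure under the block spins is the Gibbs measure of
the exact coarse-grained Hamiltonian (`map_microGibbs`), and the relative entropy of two Gibbs
measures is at most twice the supremum of the difference of their energies (`klDiv_tilted_le`).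
-/

set_option linter.unusedSectionVars false

noncomputable section

namespace Kadanoff

/-! ### Zero-free partition functions on slices -/

section Slice

variable {ι κ : Type*} [Fintype ι] [DecidableEq ι] [Fintype κ] [DecidableEq κ]

/-- The configurations on `ι` whose total spin in each cell (fibre of `c`) is prescribed by `η`. -/
def slice (c : ι → κ) (η : κ → ℤ) : Finset (ι → ℤˣ) :=
  Finset.univ.filter fun σ => ∀ k, ∑ x ∈ Finset.univ.filter (fun x => c x = k), ((σ x : ℤˣ) : ℤ) = η k

/-- The configurations of the slice that agree with `τ` at all sites outside `F`. -/
def pinned (c : ι → κ) (η : κ → ℤ) (F : Finset ι) (τ : ι → ℤˣ) : Finset (ι → ℤˣ) :=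
  (slice c η).filter fun σ => ∀ x, x ∉ F → σ x = τ x

/-- The logarithmic weight of a complex pair interaction, the sum running over ordered pairs. -/
def pairEnergy (a : ι → ι → ℂ) (σ : ι → ℤˣ) : ℂ :=
  ∑ x, ∑ y, a x y * (((σ x : ℤ) : ℂ) * ((σ y : ℤ) : ℂ))

/-- The partition function of the pair interaction `a` over a set `S` of configurations. -/
def pairZ (a : ι → ι → ℂ) (S : Finset (ι → ℤˣ)) : ℂ := ∑ σ ∈ S, Complex.exp (pairEnergy a σ)

/-- All row and column sums of the interaction are at most `1/40`. Exchanging two sites then alters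
couplings of total size at most `1/10`, which is small enough for `norm_pairZ_swap_sub_le`. -/
def IsWeak (a : ι → ι → ℂ) : Prop := ∀ x, ∑ y, (‖a x y‖ + ‖a y x‖) ≤ 1 / 40

theorem IsWeak.convex {a b : ι → ι → ℂ} (ha : IsWeak a) (hb : IsWeak b) {t : ℝ} (h0 : 0 ≤ t)
    (h1 : t ≤ 1) : IsWeak fun x y => a x y + t * (b x y - a x y) := by
  intro x
  have key : ∀ u v : ι, ‖a u v + t * (b u v - a u v)‖ ≤ (1 - t) * ‖a u v‖ + t * ‖b u v‖ := by
    intro u v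
    have : a u v + t * (b u v - a u v) = ((1 - t : ℝ) : ℂ) * a u v + (t : ℂ) * b u v := by
      push_cast; ring
    rw [this]
    refine (norm_add_le _ _).trans ?_
    rw [norm_mul, norm_mul, Complex.norm_real, Complex.norm_real, Real.norm_eq_abs,
      Real.norm_eq_abs, abs_of_nonneg h0, abs_of_nonneg (sub_nonneg.2 h1)]
  calc ∑ y, (‖a x y + t * (b x y - a x y)‖ + ‖a y x + t * (b y x - a y x)‖)
      ≤ ∑ y, ((1 - t) * (‖a x y‖ + ‖a y x‖) + t * (‖b x y‖ + ‖b y x‖)) := by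
        refine Finset.sum_le_sum fun y _ => ?_
        have h1 := key x y
        have h2 := key y x
        linarith
    _ = (1 - t) * ∑ y, (‖a x y‖ + ‖a y x‖) + t * ∑ y, (‖b x y‖ + ‖b y x‖) := by
        rw [Finset.sum_add_distrib, ← Finset.mul_sum, ← Finset.mul_sum]
    _ ≤ (1 - t) * (1 / 40) + t * (1 / 40) :=
        add_le_add (mul_le_mul_of_nonneg_left (ha x) (sub_nonneg.2 h1))
          (mul_le_mul_of_nonneg_left (hb x) h0)
    _ = 1 / 40 := by ring

theorem IsWeak.comp_equiv {a : ι → ι → ℂ} (ha : IsWeak a) (e : Equiv.Perm ι) :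
    IsWeak fun x y => a (e x) (e y) := fun x =>
  (Equiv.sum_comp e fun y => ‖a (e x) y‖ + ‖a y (e x)‖).le.trans (ha (e x))

theorem pairEnergy_comp_equiv (a : ι → ι → ℂ) (e : Equiv.Perm ι) (σ : ι → ℤˣ) :
    pairEnergy (fun x y => a (e x) (e y)) (fun x => σ (e x)) = pairEnergy a σ := by
  unfold pairEnergy
  rw [← Equiv.sum_comp e fun x => ∑ y, a x y * (((σ x : ℤ) : ℂ) * ((σ y : ℤ) : ℂ))]
  refine Finset.sum_congr rfl fun x _ => ?_
  exact Equiv.sum_comp e fun y => a (e x) y * (((σ (e x) : ℤ) : ℂ) * ((σ y : ℤ) : ℂ))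

theorem slice_swap {c : ι → κ} {η : κ → ℤ} {σ : ι → ℤˣ} (hσ : σ ∈ slice c η) {x y : ι}
    (hxy : c x = c y) : (fun z => σ (Equiv.swap x y z)) ∈ slice c η := by
  simp only [slice, Finset.mem_filter, Finset.mem_univ, true_and] at hσ ⊢
  intro k
  rw [← hσ k]
  refine Finset.sum_equiv (Equiv.swap x y) (fun z => ?_) (fun z _ => rfl)
  simp only [Finset.mem_filter, Finset.mem_univ, true_and]
  by_cases h1 : z = x
  · subst h1; simp [hxy]
  · by_cases h2 : z = y
    · subst h2; simp [hxy]
    · rw [Equiv.swap_apply_of_ne_of_ne h1 h2]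

theorem norm_unit (u : ℤˣ) : ‖((u : ℤ) : ℂ)‖ = 1 := by
  rcases Int.units_eq_one_or u with h | h <;> simp [h]

theorem sum_spin_mul (S : Finset (ι → ℤˣ)) (w : (ι → ℤˣ) → ℂ) (x : ι) :
    ∑ σ ∈ S, ((σ x : ℤ) : ℂ) * w σ = ∑ s : ℤˣ, ((s : ℤ) : ℂ) * ∑ σ ∈ S.filter (fun σ => σ x = s), w σ := by
  rw [← Finset.sum_fiberwise S (fun σ => σ x)]
  refine Finset.sum_congr rfl fun s _ => ?_
  rw [Finset.mul_sum]
  refine Finset.sum_congr rfl fun σ hσ => ?_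
  rw [(Finset.mem_filter.1 hσ).2]

theorem norm_sum_spin_mul_le (S : Finset (ι → ℤˣ)) (w : (ι → ℤˣ) → ℂ) (x : ι) :
    ‖∑ σ ∈ S, ((σ x : ℤ) : ℂ) * w σ‖ ≤ ∑ s : ℤˣ, ‖∑ σ ∈ S.filter (fun σ => σ x = s), w σ‖ := by
  rw [sum_spin_mul]
  refine (norm_sum_le _ _).trans (Finset.sum_le_sum fun s _ => ?_)
  rw [norm_mul, norm_unit, one_mul]

theorem exp_fifth_sub_one_le : Real.exp (1 / 5) - 1 ≤ 1 / 4 := by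
  have h1 : Real.exp (1 / 5) ^ 5 ≤ (5 / 4) ^ 5 := by
    rw [← Real.exp_nat_mul]
    have := Real.exp_one_lt_d9
    norm_num at this ⊢
    linarith
  have := le_of_pow_le_pow_left₀ (by norm_num : (5 : ℕ) ≠ 0) (by norm_num) h1
  linarith

/-- Sums of spin pairs of which one spin is frozen are controlled by one-site marginals. -/
theorem norm_sum_spin_pair_le_of_frozen {a : ι → ι → ℂ} {S : Finset (ι → ℤˣ)}
    (hB : ∀ z, ∑ s : ℤˣ, ‖pairZ a (S.filter fun σ => σ z = s)‖ ≤ 2 * ‖pairZ a S‖)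
    {x : ι} {s : ℤˣ} (hx : ∀ σ ∈ S, σ x = s) (v : ι) :
    ‖∑ σ ∈ S, (((σ x : ℤ) : ℂ) * ((σ v : ℤ) : ℂ)) * Complex.exp (pairEnergy a σ)‖
      ≤ 2 * ‖pairZ a S‖ := by
  have : ∑ σ ∈ S, (((σ x : ℤ) : ℂ) * ((σ v : ℤ) : ℂ)) * Complex.exp (pairEnergy a σ)
      = ((s : ℤ) : ℂ) * ∑ σ ∈ S, ((σ v : ℤ) : ℂ) * Complex.exp (pairEnergy a σ) := by
    rw [Finset.mul_sum]
    refine Finset.sum_congr rfl fun σ hσ => ?_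
    rw [hx σ hσ, mul_assoc]
  rw [this, norm_mul, norm_unit, one_mul]
  exact (norm_sum_spin_mul_le S _ v).trans (hB v)

theorem pairEnergy_line (a b : ι → ι → ℂ) (t : ℝ) (σ : ι → ℤˣ) :
    pairEnergy (fun x y => a x y + t * (b x y - a x y)) σ
      = pairEnergy a σ + t * (pairEnergy b σ - pairEnergy a σ) := by
  simp only [pairEnergy, ← Finset.sum_sub_distrib, Finset.mul_sum, ← Finset.sum_add_distrib]
  refine Finset.sum_congr rfl fun x _ => Finset.sum_congr rfl fun y _ => ?_
  ring

/-- If the one-site marginals are under control for all weak interactions, then exchanging the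
couplings of two frozen sites changes the partition function by a factor close to `1`. Along the
segment between the two interactions the derivative of the partition function is bounded by a fifth
of its modulus, since it only involves pairs with a frozen spin; Grönwall's inequality does the
rest. -/
theorem norm_pairZ_swap_sub_le {S : Finset (ι → ℤˣ)}
    (hB : ∀ a : ι → ι → ℂ, IsWeak a → ∀ z, ∑ s : ℤˣ, ‖pairZ a (S.filter fun σ => σ z = s)‖
      ≤ 2 * ‖pairZ a S‖)
    {x y : ι} {s s' : ℤˣ} (hx : ∀ σ ∈ S, σ x = s) (hy : ∀ σ ∈ S, σ y = s')
    {a : ι → ι → ℂ} (ha : IsWeak a) :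
    ‖pairZ (fun u v => a (Equiv.swap x y u) (Equiv.swap x y v)) S - pairZ a S‖
      ≤ 1 / 4 * ‖pairZ a S‖ := by
  set b : ι → ι → ℂ := fun u v => a (Equiv.swap x y u) (Equiv.swap x y v) with hb
  have hbw : IsWeak b := ha.comp_equiv _
  let at' : ℝ → ι → ι → ℂ := fun t u v => a u v + t * (b u v - a u v)
  let g : ℝ → ℂ := fun t => pairZ (at' t) S
  let g' : ℝ → ℂ := fun t => ∑ σ ∈ S, Complex.exp (pairEnergy (at' t) σ)
    * (pairEnergy b σ - pairEnergy a σ)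
  have hg : ∀ t, HasDerivAt g (g' t) t := by
    intro t
    have : g = fun t : ℝ => ∑ σ ∈ S, Complex.exp (pairEnergy a σ
        + t * (pairEnergy b σ - pairEnergy a σ)) := by
      funext t
      exact Finset.sum_congr rfl fun σ _ => by rw [pairEnergy_line]
    rw [this]
    refine HasDerivAt.fun_sum fun σ _ => ?_
    have h1 : HasDerivAt (fun t : ℝ => pairEnergy a σ + (t : ℂ) * (pairEnergy b σ - pairEnergy a σ))
        (pairEnergy b σ - pairEnergy a σ) t := by
      simpa using ((Complex.ofRealCLM.hasDerivAt (x := t)).mul_const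
        (pairEnergy b σ - pairEnergy a σ)).const_add (pairEnergy a σ)
    have h2 := h1.cexp
    rwa [← pairEnergy_line] at h2
  -- Only couplings in the rows and columns of `x` and `y` differ.
  have hsum : ∑ u, ∑ v, ‖b u v - a u v‖ ≤ 1 / 10 := by
    have hpt : ∀ u v, ‖b u v - a u v‖ ≤ (if u = x then ‖b u v‖ + ‖a u v‖ else 0)
        + (if u = y then ‖b u v‖ + ‖a u v‖ else 0) + (if v = x then ‖b u v‖ + ‖a u v‖ else 0)
        + (if v = y then ‖b u v‖ + ‖a u v‖ else 0) := by
      intro u v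
      have hn : ‖b u v - a u v‖ ≤ ‖b u v‖ + ‖a u v‖ := norm_sub_le _ _
      have h0 : 0 ≤ ‖b u v‖ + ‖a u v‖ := by positivity
      by_cases h1 : u = x
      · rw [if_pos h1]; split_ifs <;> linarith
      by_cases h2 : u = y
      · rw [if_pos h2]; split_ifs <;> linarith
      by_cases h3 : v = x
      · rw [if_pos h3]; split_ifs <;> linarith
      by_cases h4 : v = y
      · rw [if_pos h4]; split_ifs <;> linarith
      have : b u v = a u v := by
        simp only [hb]
        rw [Equiv.swap_apply_of_ne_of_ne h1 h2, Equiv.swap_apply_of_ne_of_ne h3 h4]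
      simp [this, h1, h2, h3, h4]
    refine (Finset.sum_le_sum fun u _ => Finset.sum_le_sum fun v _ => hpt u v).trans ?_
    simp only [Finset.sum_add_distrib]
    have e1 : ∀ z : ι, (∑ u, ∑ v, if u = z then ‖b u v‖ + ‖a u v‖ else 0)
        = ∑ v, (‖b z v‖ + ‖a z v‖) := by
      intro z
      rw [Finset.sum_eq_single z]
      · simp
      · intro u _ hu; simp [hu]
      · simp
    have e2 : ∀ z : ι, (∑ u, ∑ v, if v = z then ‖b u v‖ + ‖a u v‖ else 0)
        = ∑ u, (‖b u z‖ + ‖a u z‖) := by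
      intro z
      refine Finset.sum_congr rfl fun u _ => ?_
      simp
    rw [e1, e1, e2, e2]
    have a1 := ha x
    have a2 := ha y
    have b1 := hbw x
    have b2 := hbw y
    simp only [Finset.sum_add_distrib] at a1 a2 b1 b2 ⊢
    linarith
  have hbound : ∀ t ∈ Set.Ico (0 : ℝ) 1, ‖g' t‖ ≤ 1 / 5 * ‖g t‖ := by
    intro t ht
    have hw : IsWeak (at' t) := ha.convex hbw ht.1 ht.2.le
    have hBt := hB _ hw
    have e1 : g' t = ∑ u, ∑ v, (b u v - a u v) * ∑ σ ∈ S,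
        (((σ u : ℤ) : ℂ) * ((σ v : ℤ) : ℂ)) * Complex.exp (pairEnergy (at' t) σ) := by
      simp only [g', pairEnergy, ← Finset.sum_sub_distrib, Finset.mul_sum]
      rw [Finset.sum_comm]
      refine Finset.sum_congr rfl fun u _ => ?_
      rw [Finset.sum_comm]
      refine Finset.sum_congr rfl fun v _ => Finset.sum_congr rfl fun σ _ => ?_
      ring
    rw [e1]
    have hterm : ∀ u v, ‖(b u v - a u v) * ∑ σ ∈ S,
        (((σ u : ℤ) : ℂ) * ((σ v : ℤ) : ℂ)) * Complex.exp (pairEnergy (at' t) σ)‖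
        ≤ ‖b u v - a u v‖ * (2 * ‖g t‖) := by
      intro u v
      rw [norm_mul]
      have hcomm : ∑ σ ∈ S, (((σ u : ℤ) : ℂ) * ((σ v : ℤ) : ℂ)) * Complex.exp (pairEnergy (at' t) σ)
          = ∑ σ ∈ S, (((σ v : ℤ) : ℂ) * ((σ u : ℤ) : ℂ)) * Complex.exp (pairEnergy (at' t) σ) :=
        Finset.sum_congr rfl fun σ _ => by rw [mul_comm ((σ u : ℤ) : ℂ)]
      by_cases h1 : u = x
      · subst h1
        exact mul_le_mul_of_nonneg_left (norm_sum_spin_pair_le_of_frozen hBt hx v) (norm_nonneg _)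
      by_cases h2 : u = y
      · subst h2
        exact mul_le_mul_of_nonneg_left (norm_sum_spin_pair_le_of_frozen hBt hy v) (norm_nonneg _)
      by_cases h3 : v = x
      · subst h3
        rw [hcomm]
        exact mul_le_mul_of_nonneg_left (norm_sum_spin_pair_le_of_frozen hBt hx u) (norm_nonneg _)
      by_cases h4 : v = y
      · subst h4
        rw [hcomm]
        exact mul_le_mul_of_nonneg_left (norm_sum_spin_pair_le_of_frozen hBt hy u) (norm_nonneg _)
      have : b u v = a u v := by
        simp only [hb]
        rw [Equiv.swap_apply_of_ne_of_ne h1 h2, Equiv.swap_apply_of_ne_of_ne h3 h4]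
      simp [this]
    calc _ ≤ ∑ u, ∑ v, ‖b u v - a u v‖ * (2 * ‖g t‖) :=
          (norm_sum_le _ _).trans (Finset.sum_le_sum fun u _ => (norm_sum_le _ _).trans
            (Finset.sum_le_sum fun v _ => hterm u v))
      _ = (∑ u, ∑ v, ‖b u v - a u v‖) * (2 * ‖g t‖) := by simp only [Finset.sum_mul]
      _ ≤ 1 / 10 * (2 * ‖g t‖) := mul_le_mul_of_nonneg_right hsum (by positivity)
      _ = 1 / 5 * ‖g t‖ := by ring
  have hgr := norm_le_gronwallBound_of_norm_deriv_right_le (f := fun t => g t - g 0) (f' := g')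
    (δ := 0) (K := 1 / 5) (ε := 1 / 5 * ‖g 0‖) (a := 0) (b := 1)
    (fun t _ => ((hg t).sub_const _).continuousAt.continuousWithinAt)
    (fun t _ => ((hg t).sub_const _).hasDerivWithinAt) (by simp)
    (fun t ht => by
      refine (hbound t ht).trans ?_
      have : ‖g t‖ ≤ ‖g t - g 0‖ + ‖g 0‖ := by
        simpa using norm_add_le (g t - g 0) (g 0)
      linarith) 1 (by simp)
  have e0 : g 0 = pairZ a S := by simp [g, at']
  have e1 : g 1 = pairZ b S := by simp [g, at']
  rw [gronwallBound_of_K_ne_0 (by norm_num)] at hgr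
  rw [e0, e1] at hgr
  refine hgr.trans ?_
  have h3 := exp_fifth_sub_one_le
  have h4 : 1 / 5 * ‖pairZ a S‖ / (1 / 5) = ‖pairZ a S‖ := by ring
  simp only [sub_zero, mul_one, zero_mul, zero_add, h4]
  nlinarith [norm_nonneg (pairZ a S)]

theorem mem_pinned {c : ι → κ} {η : κ → ℤ} {F : Finset ι} {τ σ : ι → ℤˣ} :
    σ ∈ pinned c η F τ ↔ σ ∈ slice c η ∧ ∀ x, x ∉ F → σ x = τ x := by
  simp [pinned]

theorem pinned_filter {c : ι → κ} {η : κ → ℤ} {F : Finset ι} {τ σ : ι → ℤˣ} {x : ι} {s : ℤˣ}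
    (hσ : σ ∈ pinned c η F τ) (hs : σ x = s) :
    (pinned c η F τ).filter (fun σ => σ x = s) = pinned c η (F.erase x) σ := by
  subst hs
  have h := mem_pinned.1 hσ
  ext ρ
  simp only [Finset.mem_filter, mem_pinned, Finset.mem_erase, not_and_or, not_not]
  constructor
  · rintro ⟨⟨h1, h2⟩, h3⟩
    refine ⟨h1, ?_⟩
    rintro y (rfl | hy)
    · exact h3
    · rw [h2 y hy, h.2 y hy]
  · rintro ⟨h1, h2⟩
    exact ⟨⟨h1, fun y hy => (h2 y (Or.inr hy)).trans (h.2 y hy)⟩, h2 x (Or.inl rfl)⟩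

theorem pinned_self {c : ι → κ} {η : κ → ℤ} {τ : ι → ℤˣ} (hτ : τ ∈ slice c η) :
    pinned c η ∅ τ = {τ} := by
  ext σ
  simp only [mem_pinned, Finset.notMem_empty, not_false_eq_true, forall_const,
    Finset.mem_singleton]
  exact ⟨fun h => funext h.2, by rintro rfl; exact ⟨hτ, fun _ => rfl⟩⟩

/-- Exchanging the values at two free sites `z`, `w` of one cell transports one partially pinned
slice to the other. -/
theorem pairZ_pinned_exchange {c : ι → κ} {η : κ → ℤ} {F : Finset ι} {τ : ι → ℤˣ}
    (a : ι → ι → ℂ) {z w : ι} (hz : z ∈ F) (hw : w ∈ F) (hzw : c z = c w) (s s' : ℤˣ) :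
    pairZ a (((pinned c η F τ).filter fun σ => σ z = s').filter fun σ => σ w = s)
      = pairZ (fun u v => a (Equiv.swap z w u) (Equiv.swap z w v))
        (((pinned c η F τ).filter fun σ => σ w = s').filter fun σ => σ z = s) := by
  unfold pairZ
  refine Finset.sum_nbij' (fun σ u => σ (Equiv.swap z w u)) (fun σ u => σ (Equiv.swap z w u))
    ?_ ?_ ?_ ?_ ?_
  · intro σ hσ
    simp only [Finset.mem_filter, mem_pinned] at hσ ⊢
    refine ⟨⟨⟨slice_swap hσ.1.1.1 hzw, fun u hu => ?_⟩, by simp [hσ.1.2]⟩, by simp [hσ.2]⟩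
    rw [Equiv.swap_apply_of_ne_of_ne (by rintro rfl; exact hu hz) (by rintro rfl; exact hu hw)]
    exact hσ.1.1.2 u hu
  · intro σ hσ
    simp only [Finset.mem_filter, mem_pinned] at hσ ⊢
    refine ⟨⟨⟨slice_swap hσ.1.1.1 hzw, fun u hu => ?_⟩, by simp [hσ.1.2]⟩, by simp [hσ.2]⟩
    rw [Equiv.swap_apply_of_ne_of_ne (by rintro rfl; exact hu hz) (by rintro rfl; exact hu hw)]
    exact hσ.1.1.2 u hu
  · intro σ _; funext u; simp
  · intro σ _; funext u; simp
  · intro σ _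
    rw [pairEnergy_comp_equiv]

/-- The number of free sites of a cell that carry the spin `s` is the same for all configurations
of a pinned slice. -/
theorem card_filter_eq_of_mem_pinned {c : ι → κ} {η : κ → ℤ} {F : Finset ι} {τ σ : ι → ℤˣ}
    (hτ : τ ∈ slice c η) (hσ : σ ∈ pinned c η F τ) (k : κ) (s : ℤˣ) :
    ((F.filter fun z => c z = k).filter fun z => σ z = s).card
      = ((F.filter fun z => c z = k).filter fun z => τ z = s).card := by
  have h := mem_pinned.1 hσ
  simp only [slice, Finset.mem_filter, Finset.mem_univ, true_and] at hτ h
  have key : ∀ ρ : ι → ℤˣ, (((F.filter fun z => c z = k).filter fun z => ρ z = s).card : ℤ) * 2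
      = (F.filter fun z => c z = k).card + (s : ℤ) * ∑ z ∈ F.filter (fun z => c z = k), (ρ z : ℤ) := by
    intro ρ
    rw [Finset.card_filter, Finset.mul_sum, Finset.card_eq_sum_ones]
    push_cast
    rw [Finset.sum_mul, ← Finset.sum_add_distrib]
    refine Finset.sum_congr rfl fun z _ => ?_
    rcases Int.units_eq_one_or (ρ z) with h1 | h1 <;> rcases Int.units_eq_one_or s with h2 | h2 <;>
      rw [h1, h2] <;> decide
  have hsum : ∑ z ∈ F.filter (fun z => c z = k), (σ z : ℤ)
      = ∑ z ∈ F.filter (fun z => c z = k), (τ z : ℤ) := by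
    have h1 := (h.1 k).trans (hτ k).symm
    have hsub : F.filter (fun z => c z = k) ⊆ Finset.univ.filter fun z => c z = k :=
      Finset.filter_subset_filter _ (Finset.subset_univ F)
    rw [← Finset.sum_sdiff hsub, ← Finset.sum_sdiff hsub] at h1
    have h2 : ∑ z ∈ (Finset.univ.filter fun z => c z = k) \ F.filter (fun z => c z = k), (σ z : ℤ)
        = ∑ z ∈ (Finset.univ.filter fun z => c z = k) \ F.filter (fun z => c z = k), (τ z : ℤ) := by
      refine Finset.sum_congr rfl fun z hz => ?_
      rw [h.2 z]
      intro hzF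
      simp only [Finset.mem_sdiff, Finset.mem_filter, Finset.mem_univ, true_and] at hz
      exact hz.2 ⟨hzF, hz.1⟩
    linarith
  have h1 := key σ
  have h2 := key τ
  rw [hsum] at h1
  have : (((F.filter fun z => c z = k).filter fun z => σ z = s).card : ℤ)
      = ((F.filter fun z => c z = k).filter fun z => τ z = s).card := by linarith
  exact_mod_cast this

/-- Partition functions of weak complex interactions do not vanish on pinned slices, and their
one-site marginals are complex measures of total variation at most `2`. The proof is by induction
on the set of free sites, for all interactions at once because the exchange of two sites changes
the interaction. -/
theorem pairZ_pinned (c : ι → κ) (η : κ → ℤ) (F : Finset ι) :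
    ∀ (a : ι → ι → ℂ), IsWeak a → ∀ τ ∈ slice c η, pairZ a (pinned c η F τ) ≠ 0 ∧
      ∀ x, ∑ s : ℤˣ, ‖pairZ a ((pinned c η F τ).filter fun σ => σ x = s)‖
        ≤ 2 * ‖pairZ a (pinned c η F τ)‖ := by
  induction F using Finset.strongInduction with
  | H F ih =>
  intro a ha τ hτ
  set S := pinned c η F τ with hS
  have hτS : τ ∈ S := mem_pinned.2 ⟨hτ, fun _ _ => rfl⟩
  have hempty : ∀ (p : (ι → ℤˣ) → Prop) [DecidablePred p], (∀ σ ∈ S, ¬ p σ) →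
      pairZ a (S.filter p) = 0 := by
    intro p _ h
    rw [Finset.filter_eq_empty_iff.2 (fun σ hσ => h σ hσ)]
    simp [pairZ]
  -- Pinning one free site, or two free sites of one cell, leads to a smaller set of free sites.
  -- Pinned values that are incompatible with the slice give an empty sum.
  have hmarg : ∀ w ∈ F, ∀ s, ∀ z, ∑ s' : ℤˣ,
      ‖pairZ a ((S.filter fun σ => σ w = s).filter fun σ => σ z = s')‖
        ≤ 2 * ‖pairZ a (S.filter fun σ => σ w = s)‖ := by
    intro w hw s z
    by_cases hex : ∃ σ ∈ S, σ w = s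
    · obtain ⟨σ, hσ, hs⟩ := hex
      rw [pinned_filter hσ hs]
      exact (ih _ (Finset.erase_ssubset hw) a ha σ (mem_pinned.1 hσ).1).2 z
    · push Not at hex
      rw [Finset.filter_eq_empty_iff.2 (fun σ hσ => hex σ hσ)]
      simp [pairZ]
  have hswap : ∀ z ∈ F, ∀ w ∈ F, z ≠ w → c z = c w → ∀ s s' : ℤˣ,
      ‖pairZ a ((S.filter fun σ => σ z = s).filter fun σ => σ w = s')
        - pairZ a ((S.filter fun σ => σ w = s).filter fun σ => σ z = s')‖
      ≤ 1 / 4 * ‖pairZ a ((S.filter fun σ => σ w = s).filter fun σ => σ z = s')‖ := by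
    intro z hz w hw hne hc s s'
    rw [pairZ_pinned_exchange a hz hw hc s' s]
    by_cases hex : ∃ σ ∈ S.filter (fun σ => σ w = s), σ z = s'
    · obtain ⟨σ, hσ, hs'⟩ := hex
      obtain ⟨hσS, hs⟩ := Finset.mem_filter.1 hσ
      have e : (S.filter fun σ => σ w = s).filter (fun σ => σ z = s')
          = pinned c η ((F.erase w).erase z) σ := by
        have := pinned_filter hσS hs
        rw [← hS] at this
        rw [this] at hσ ⊢
        exact pinned_filter hσ hs'
      have hss : (F.erase w).erase z ⊂ F :=
        (Finset.erase_subset _ _).trans_ssubset (Finset.erase_ssubset hw)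
      refine norm_pairZ_swap_sub_le ?_ (s := s') (s' := s) ?_ ?_ ha
      · rw [e]
        exact fun b hb => (ih _ hss b hb σ (mem_pinned.1 hσS).1).2
      · exact fun ρ hρ => (Finset.mem_filter.1 hρ).2
      · exact fun ρ hρ => (Finset.mem_filter.1 (Finset.mem_filter.1 hρ).1).2
    · push Not at hex
      rw [Finset.filter_eq_empty_iff.2 (fun σ hσ => hex σ hσ)]
      simp [pairZ]
  -- Hence the marginals of sites of one cell are comparable: the configurations with equal spins at
  -- `z` and `w` cancel in the difference, and for the others the two sites are exchanged.
  have hcomp : ∀ z ∈ F, ∀ w ∈ F, c z = c w → ∀ s,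
      ‖pairZ a (S.filter fun σ => σ z = s) - pairZ a (S.filter fun σ => σ w = s)‖
      ≤ 1 / 2 * ‖pairZ a (S.filter fun σ => σ w = s)‖ := by
    intro z hz w hw hc s
    by_cases hne : z = w
    · subst hne; simp
    have split : ∀ u v : ι, pairZ a (S.filter fun σ => σ u = s)
        = pairZ a ((S.filter fun σ => σ u = s).filter fun σ => σ v = s)
        + pairZ a ((S.filter fun σ => σ u = s).filter fun σ => σ v = -s) := by
      intro u v
      unfold pairZ
      rw [← Finset.sum_filter_add_sum_filter_not (S.filter fun σ => σ u = s) (fun σ => σ v = s)]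
      congr 2
      refine Finset.filter_congr fun σ _ => ?_
      constructor
      · intro h
        rcases Int.units_eq_one_or (σ v) with h1 | h1 <;> rcases Int.units_eq_one_or s with h2 | h2 <;>
          simp_all
      · intro h
        rw [h]
        rcases Int.units_eq_one_or s with h2 | h2 <;> rw [h2] <;> decide
    have hsame : (S.filter fun σ => σ z = s).filter (fun σ => σ w = s)
        = (S.filter fun σ => σ w = s).filter (fun σ => σ z = s) := by
      rw [Finset.filter_filter, Finset.filter_filter]
      exact Finset.filter_congr fun σ _ => and_comm
    have e : pairZ a (S.filter fun σ => σ z = s) - pairZ a (S.filter fun σ => σ w = s)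
        = pairZ a ((S.filter fun σ => σ z = s).filter fun σ => σ w = -s)
          - pairZ a ((S.filter fun σ => σ w = s).filter fun σ => σ z = -s) := by
      rw [split z w, split w z, hsame]; ring
    rw [e]
    refine (hswap z hz w hw hne hc s (-s)).trans ?_
    have h1 : ‖pairZ a ((S.filter fun σ => σ w = s).filter fun σ => σ z = -s)‖
        ≤ 2 * ‖pairZ a (S.filter fun σ => σ w = s)‖ :=
      (Finset.single_le_sum (f := fun s' : ℤˣ =>
        ‖pairZ a ((S.filter fun σ => σ w = s).filter fun σ => σ z = s')‖)
        (fun _ _ => norm_nonneg _) (Finset.mem_univ (-s))).trans (hmarg w hw s z)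
    linarith
  -- Sum over the free sites `z` of the cell of `w`: the number of those with `σ z = s` is the same
  -- for all `σ`, so the marginals at these sites add up to a multiple of the partition function.
  have hcount : ∀ w ∈ F, ∀ s, ((F.filter fun z => c z = c w).card : ℝ)
      * ‖pairZ a (S.filter fun σ => σ w = s)‖
      ≤ 2 * (((F.filter fun z => c z = c w).filter fun z => τ z = s).card : ℝ) * ‖pairZ a S‖ := by
    intro w hw s
    set D := F.filter fun z => c z = c w with hD
    have e1 : ∑ z ∈ D, pairZ a (S.filter fun σ => σ z = s)
        = ((D.filter fun z => τ z = s).card : ℂ) * pairZ a S := by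
      unfold pairZ
      simp only [Finset.sum_filter (s := S)]
      rw [Finset.sum_comm, Finset.mul_sum]
      refine Finset.sum_congr rfl fun σ hσ => ?_
      rw [← Finset.sum_filter, Finset.sum_const, nsmul_eq_mul,
        card_filter_eq_of_mem_pinned hτ hσ (c w) s]
    have e2 : ‖∑ z ∈ D, pairZ a (S.filter fun σ => σ z = s)
        - (D.card : ℂ) * pairZ a (S.filter fun σ => σ w = s)‖
        ≤ (D.card : ℝ) * (1 / 2 * ‖pairZ a (S.filter fun σ => σ w = s)‖) := by
      have : ∑ z ∈ D, pairZ a (S.filter fun σ => σ z = s)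
          - (D.card : ℂ) * pairZ a (S.filter fun σ => σ w = s)
          = ∑ z ∈ D, (pairZ a (S.filter fun σ => σ z = s)
            - pairZ a (S.filter fun σ => σ w = s)) := by
        rw [Finset.sum_sub_distrib, Finset.sum_const, nsmul_eq_mul]
      rw [this, ← nsmul_eq_mul]
      refine (norm_sum_le _ _).trans (Finset.sum_le_card_nsmul _ _ _ fun z hz => ?_)
      exact hcomp z (Finset.mem_filter.1 hz).1 w hw (Finset.mem_filter.1 hz).2 s
    rw [e1] at e2
    have e3 : ‖(D.card : ℂ) * pairZ a (S.filter fun σ => σ w = s)‖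
        ≤ ‖((D.filter fun z => τ z = s).card : ℂ) * pairZ a S‖
          + ‖((D.filter fun z => τ z = s).card : ℂ) * pairZ a S
            - (D.card : ℂ) * pairZ a (S.filter fun σ => σ w = s)‖ := norm_le_norm_add_norm_sub _ _
    rw [norm_mul, norm_mul, Complex.norm_natCast, Complex.norm_natCast] at e3
    linarith
  constructor
  · rcases F.eq_empty_or_nonempty with rfl | ⟨w, hw⟩
    · rw [hS, pinned_self hτ]
      simp [pairZ]
    · intro h0
      have h1 := hcount w hw (τ w)
      rw [h0, norm_zero, mul_zero] at h1
      have hpos : (0 : ℝ) < (F.filter fun z => c z = c w).card := by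
        exact_mod_cast Finset.card_pos.2 ⟨w, by simp [hw]⟩
      have h2 : ‖pairZ a (S.filter fun σ => σ w = τ w)‖ = 0 :=
        le_antisymm (by nlinarith) (norm_nonneg _)
      rw [pinned_filter hτS rfl] at h2
      exact (ih _ (Finset.erase_ssubset hw) a ha τ hτ).1 (norm_eq_zero.1 h2)
  · intro x
    by_cases hx : x ∈ F
    · have hpos : (0 : ℝ) < (F.filter fun z => c z = c x).card := by
        exact_mod_cast Finset.card_pos.2 ⟨x, by simp [hx]⟩
      have hc : ∑ s : ℤˣ, (((F.filter fun z => c z = c x).filter fun z => τ z = s).card : ℝ)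
          = (F.filter fun z => c z = c x).card := by
        exact_mod_cast (Finset.card_eq_sum_card_fiberwise (t := Finset.univ)
          (f := τ) fun _ _ => Finset.mem_coe.2 (Finset.mem_univ _)).symm
      refine le_of_mul_le_mul_left ?_ hpos
      calc _ = ∑ s : ℤˣ, ((F.filter fun z => c z = c x).card : ℝ)
              * ‖pairZ a (S.filter fun σ => σ x = s)‖ := Finset.mul_sum _ _ _
        _ ≤ ∑ s : ℤˣ, 2 * (((F.filter fun z => c z = c x).filter fun z => τ z = s).card : ℝ)
              * ‖pairZ a S‖ := Finset.sum_le_sum fun s _ => hcount x hx s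
        _ = _ := by rw [← Finset.sum_mul, ← Finset.mul_sum, hc]; ring
    · have h1 : ∀ σ ∈ S, σ x = τ x := fun σ hσ => (mem_pinned.1 hσ).2 x hx
      have h2 : S.filter (fun σ => σ x = τ x) = S := Finset.filter_true_of_mem h1
      rw [Finset.sum_eq_single (τ x)]
      · rw [h2]; linarith [norm_nonneg (pairZ a S)]
      · intro s _ hs
        rw [hempty _ fun σ hσ h => hs ((h1 σ hσ).symm.trans h).symm, norm_zero]
      · exact fun h => absurd (Finset.mem_univ _) h

theorem pinned_univ {c : ι → κ} {η : κ → ℤ} (τ : ι → ℤˣ) :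
    pinned c η Finset.univ τ = slice c η := by
  ext; simp [mem_pinned]

theorem pairZ_slice_ne_zero {c : ι → κ} {η : κ → ℤ} {a : ι → ι → ℂ} (ha : IsWeak a)
    (hne : (slice c η).Nonempty) : pairZ a (slice c η) ≠ 0 := by
  obtain ⟨τ, hτ⟩ := hne
  simpa [pinned_univ] using (pairZ_pinned c η Finset.univ a ha τ hτ).1

/-- Two-point functions of weak complex interactions on slices are bounded by `4`. -/
theorem norm_sum_spin_pair_le {c : ι → κ} {η : κ → ℤ} {a : ι → ι → ℂ} (ha : IsWeak a)
    (hne : (slice c η).Nonempty) (x y : ι) :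
    ‖∑ σ ∈ slice c η, (((σ x : ℤ) : ℂ) * ((σ y : ℤ) : ℂ)) * Complex.exp (pairEnergy a σ)‖
      ≤ 4 * ‖pairZ a (slice c η)‖ := by
  obtain ⟨τ, hτ⟩ := hne
  have h0 := (pairZ_pinned c η Finset.univ a ha τ hτ).2 x
  rw [pinned_univ] at h0
  have h1 : ∀ s : ℤˣ, ‖∑ σ ∈ (slice c η).filter (fun σ => σ x = s),
      ((σ y : ℤ) : ℂ) * Complex.exp (pairEnergy a σ)‖
      ≤ 2 * ‖pairZ a ((slice c η).filter fun σ => σ x = s)‖ := by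
    intro s
    refine (norm_sum_spin_mul_le _ _ y).trans ?_
    by_cases hex : ∃ σ ∈ slice c η, σ x = s
    · obtain ⟨σ, hσ, hs⟩ := hex
      have hσ' : σ ∈ pinned c η Finset.univ τ := by rwa [pinned_univ]
      have e := pinned_filter hσ' hs
      rw [pinned_univ] at e
      rw [e]
      exact (pairZ_pinned c η _ a ha σ hσ).2 y
    · push Not at hex
      rw [Finset.filter_eq_empty_iff.2 (fun σ hσ => hex σ hσ)]
      simp [pairZ]
  simp only [mul_assoc]
  rw [sum_spin_mul]
  calc _ ≤ ∑ s : ℤˣ, 2 * ‖pairZ a ((slice c η).filter fun σ => σ x = s)‖ := by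
        refine (norm_sum_le _ _).trans (Finset.sum_le_sum fun s _ => ?_)
        rw [norm_mul, norm_unit, one_mul]
        exact h1 s
    _ ≤ 2 * (2 * ‖pairZ a (slice c η)‖) := by
        rw [← Finset.mul_sum]; exact mul_le_mul_of_nonneg_left h0 (by norm_num)
    _ = _ := by ring

end Slice

/-! ### Cumulants and their analytic bounds -/

section Cumulant

/-- The series of normalized moments `∑ₙ E[Wⁿ] tⁿ / n!` under the uniform measure on `Ω`. -/
def momentSeries {α : Type*} (Ω : Finset α) (W : α → ℝ) : PowerSeries ℝ :=
  PowerSeries.mk fun n => (∑ σ ∈ Ω, W σ ^ n) / (Ω.card * n.factorial)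

/-- The coefficient of `tʲ` in the logarithm of a power series with constant coefficient `1`,
computed from the logarithmic derivative. It is `0` for `j = 0`, by division by zero. -/
def logCoeff (M : PowerSeries ℝ) (j : ℕ) : ℝ :=
  PowerSeries.coeff (j - 1) (PowerSeries.derivative ℝ M * M⁻¹) / j

/-- The `j`-th cumulant of `W` under the uniform measure on `Ω`, divided by `j!`. -/
def cumulant {α : Type*} (Ω : Finset α) (W : α → ℝ) (j : ℕ) : ℝ := logCoeff (momentSeries Ω W) j

/-- The Taylor series at `0`, as a formal power series. -/
def taylorPS (f : ℂ → ℂ) : PowerSeries ℂ :=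
  PowerSeries.mk fun n => iteratedDeriv n f 0 / n.factorial

theorem taylorPS_mul {f g : ℂ → ℂ} (hf : ∀ n : ℕ, ContDiffAt ℂ n f 0)
    (hg : ∀ n : ℕ, ContDiffAt ℂ n g 0) :
    taylorPS (f * g) = taylorPS f * taylorPS g := by
  ext n
  rw [PowerSeries.coeff_mul, taylorPS, PowerSeries.coeff_mk, iteratedDeriv_mul (hf n) (hg n),
    Finset.Nat.sum_antidiagonal_eq_sum_range_succ_mk, Finset.sum_div]
  refine Finset.sum_congr rfl fun i hi => ?_
  have hi' : i ≤ n := Nat.lt_succ_iff.1 (Finset.mem_range.1 hi)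
  simp only [taylorPS, PowerSeries.coeff_mk]
  rw [Nat.cast_choose ℂ hi']
  have h1 : (n.factorial : ℂ) ≠ 0 := by exact_mod_cast n.factorial_ne_zero
  have h2 : (i.factorial : ℂ) ≠ 0 := by exact_mod_cast i.factorial_ne_zero
  have h3 : ((n - i).factorial : ℂ) ≠ 0 := by exact_mod_cast (n - i).factorial_ne_zero
  field_simp

theorem taylorPS_deriv (f : ℂ → ℂ) : taylorPS (deriv f) = PowerSeries.derivative ℂ (taylorPS f) := by
  ext n
  rw [PowerSeries.coeff_derivative]
  simp only [taylorPS, PowerSeries.coeff_mk]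
  rw [iteratedDeriv_succ', Nat.factorial_succ]
  have h1 : (n.factorial : ℂ) ≠ 0 := by exact_mod_cast n.factorial_ne_zero
  have h2 : ((n : ℂ) + 1) ≠ 0 := by exact_mod_cast n.succ_ne_zero
  push_cast
  field_simp

theorem constantCoeff_momentSeries {α : Type*} {Ω : Finset α} (hΩ : Ω.Nonempty) (W : α → ℝ) :
    PowerSeries.constantCoeff (momentSeries Ω W) = 1 := by
  have : (Ω.card : ℝ) ≠ 0 := by exact_mod_cast hΩ.card_pos.ne'
  rw [← PowerSeries.coeff_zero_eq_constantCoeff_apply]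
  simp [momentSeries, this]

/-- If the complexified partition function `Z(z) = ∑ exp(z W)` has no zeros in a disc and its
logarithmic derivative is bounded by `B` there, then the cumulants of `W` obey Cauchy estimates,
and they sum to `log (Z(1) / Z(0))` if the disc contains `1`. -/
theorem cumulant_bound_and_hasSum {α : Type*} {Ω : Finset α} (hΩ : Ω.Nonempty) (W : α → ℝ)
    {r B : ℝ} (hr : 0 < r)
    (hZ : ∀ z : ℂ, ‖z‖ < r → ∑ σ ∈ Ω, Complex.exp (z * W σ) ≠ 0)
    (hB : ∀ z : ℂ, ‖z‖ < r → ‖∑ σ ∈ Ω, (W σ : ℂ) * Complex.exp (z * W σ)‖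
      ≤ B * ‖∑ σ ∈ Ω, Complex.exp (z * W σ)‖) :
    (∀ s, 0 < s → s < r → ∀ j, |cumulant Ω W j| ≤ B * s / s ^ j) ∧
    (1 < r → HasSum (cumulant Ω W) (Real.log ((∑ σ ∈ Ω, Real.exp (W σ)) / Ω.card))) := by
  have hcard : (Ω.card : ℝ) ≠ 0 := by exact_mod_cast hΩ.card_pos.ne'
  have hcardC : (Ω.card : ℂ) ≠ 0 := by exact_mod_cast hΩ.card_pos.ne'
  have hB0 : 0 ≤ B := by
    by_contra hneg
    have h1 := hB 0 (by simpa using hr)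
    have h2 := norm_pos_iff.2 (hZ 0 (by simpa using hr))
    have h3 := norm_nonneg (∑ σ ∈ Ω, (W σ : ℂ) * Complex.exp (0 * W σ))
    nlinarith
  let Z : ℂ → ℂ := fun z => ∑ σ ∈ Ω, Complex.exp (z * W σ)
  let Z' : ℂ → ℂ := fun z => ∑ σ ∈ Ω, (W σ : ℂ) * Complex.exp (z * W σ)
  have hZd : ∀ z, HasDerivAt Z (Z' z) z := by
    intro z
    refine HasDerivAt.fun_sum fun σ _ => ?_
    have := ((hasDerivAt_id z).mul_const (W σ : ℂ)).cexp
    simpa [mul_comm] using this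
  have hZdiff : Differentiable ℂ Z := fun z => (hZd z).differentiableAt
  have hZ'eq : deriv Z = Z' := funext fun z => (hZd z).deriv
  have hZ'diff : Differentiable ℂ Z' := by
    intro z
    refine DifferentiableAt.fun_sum fun σ _ => ?_
    fun_prop
  let U := Metric.ball (0 : ℂ) r
  have hU : ∀ z ∈ U, ‖z‖ < r := fun z hz => by simpa [U] using hz
  have h0U : (0 : ℂ) ∈ U := by simpa [U] using hr
  let ψ : ℂ → ℂ := fun z => Z' z / Z z
  have hψ : DifferentiableOn ℂ ψ U := fun z hz =>
    ((hZ'diff z).div (hZdiff z) (hZ z (hU z hz))).differentiableWithinAt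
  obtain ⟨Φ, hΦ0, hΦ⟩ := hψ.isExactOn_ball.with_val_at 0 0
  have hΦdiff : DifferentiableOn ℂ Φ U := fun z hz =>
    (hΦ z hz).differentiableAt.differentiableWithinAt
  have hψB : ∀ z ∈ U, ‖ψ z‖ ≤ B := by
    intro z hz
    simp only [ψ, norm_div]
    rw [div_le_iff₀ (norm_pos_iff.2 (hZ z (hU z hz)))]
    exact hB z (hU z hz)
  have hΦB : ∀ z ∈ U, ‖Φ z‖ ≤ B * ‖z‖ := by
    intro z hz
    have := Convex.norm_image_sub_le_of_norm_hasDerivWithin_le (f := Φ) (f' := ψ) (s := U)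
      (fun x hx => (hΦ x hx).hasDerivWithinAt) hψB (convex_ball _ _) h0U hz
    simpa [hΦ0] using this
  -- `Φ` is a logarithm of `Z / Z(0)`.
  have hexp : ∀ z ∈ U, Z z = Ω.card * Complex.exp (Φ z) := by
    intro z hz
    have hd : ∀ w ∈ U, HasDerivAt (fun w => Z w * Complex.exp (-Φ w)) 0 w := by
      intro w hw
      have h1 := (hZd w).mul ((hΦ w hw).neg.cexp)
      convert! h1 using 1
      have : Z w ≠ 0 := hZ w (hU w hw)
      simp only [ψ]
      field_simp
      ring
    have hc := Convex.norm_image_sub_le_of_norm_hasDerivWithin_le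
      (f := fun w => Z w * Complex.exp (-Φ w)) (f' := fun _ => 0) (C := 0) (s := U)
      (fun x hx => (hd x hx).hasDerivWithinAt) (by simp) (convex_ball _ _) h0U hz
    have h2 : Z z * Complex.exp (-Φ z) = Ω.card := by
      have h3 : Z 0 * Complex.exp (-Φ 0) = Ω.card := by simp [Z, hΦ0]
      rw [← h3]
      simpa [sub_eq_zero] using hc
    rw [← h2, mul_assoc, ← Complex.exp_add]
    simp
  have hUnhds : U ∈ nhds (0 : ℂ) := Metric.ball_mem_nhds _ hr
  have hcd : ∀ f : ℂ → ℂ, DifferentiableOn ℂ f U → ∀ n : ℕ, ContDiffAt ℂ n f 0 := fun f hf n =>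
    ((hf.analyticAt hUnhds).contDiffAt)
  -- The Taylor coefficients of `Φ` are the cumulants.
  have hcoeff : ∀ j, iteratedDeriv j Φ 0 / (j.factorial : ℂ) = (cumulant Ω W j : ℂ) := by
    have hZps : taylorPS Z = (Ω.card : ℂ) • PowerSeries.map Complex.ofRealHom (momentSeries Ω W) := by
      ext n
      simp only [taylorPS, PowerSeries.coeff_mk, momentSeries, PowerSeries.coeff_map,
        PowerSeries.coeff_smul, smul_eq_mul]
      have hZn : ∀ n, iteratedDeriv n Z = fun z => ∑ σ ∈ Ω, (W σ : ℂ) ^ n * Complex.exp (z * W σ) := by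
        intro n
        induction n with
        | zero => simp [Z]
        | succ n ih =>
          rw [iteratedDeriv_succ, ih]
          funext z
          refine HasDerivAt.deriv (HasDerivAt.fun_sum fun σ _ => ?_)
          have := (((hasDerivAt_id z).mul_const (W σ : ℂ)).cexp).const_mul ((W σ : ℂ) ^ n)
          convert! this using 1
          simp only [id, one_mul]
          ring
      rw [hZn]
      have h1 : (n.factorial : ℂ) ≠ 0 := by exact_mod_cast n.factorial_ne_zero
      simp only [zero_mul, Complex.exp_zero, mul_one, Complex.ofRealHom_eq_coe]
      push_cast
      field_simp
    have hmul : PowerSeries.map Complex.ofRealHom (momentSeries Ω W) * taylorPS ψ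
        = PowerSeries.derivative ℂ (PowerSeries.map Complex.ofRealHom (momentSeries Ω W)) := by
      have h1 : taylorPS (Z * ψ) = taylorPS (deriv Z) := by
        have : (Z * ψ) =ᶠ[nhds 0] deriv Z := by
          filter_upwards [hUnhds] with z hz
          rw [hZ'eq]
          have : Z z ≠ 0 := hZ z (hU z hz)
          simp only [Pi.mul_apply, ψ]
          field_simp
        ext n
        simp only [taylorPS, PowerSeries.coeff_mk]
        rw [this.iteratedDeriv_eq]
      rw [taylorPS_mul (hcd Z hZdiff.differentiableOn) (hcd ψ hψ), taylorPS_deriv, hZps,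
        Derivation.map_smul, smul_mul_assoc] at h1
      exact smul_right_injective _ hcardC h1
    have hder : PowerSeries.derivative ℂ (PowerSeries.map Complex.ofRealHom (momentSeries Ω W))
        = PowerSeries.map Complex.ofRealHom (PowerSeries.derivative ℝ (momentSeries Ω W)) := by
      ext n
      simp [PowerSeries.coeff_derivative]
    have hM1 := constantCoeff_momentSeries hΩ W
    have hψps : taylorPS ψ = PowerSeries.map Complex.ofRealHom
        (PowerSeries.derivative ℝ (momentSeries Ω W) * (momentSeries Ω W)⁻¹) := by
      have hinv : PowerSeries.map Complex.ofRealHom (momentSeries Ω W)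
          * PowerSeries.map Complex.ofRealHom (momentSeries Ω W)⁻¹ = 1 := by
        rw [← map_mul, PowerSeries.mul_inv_cancel _ (by rw [hM1]; exact one_ne_zero), map_one]
      rw [map_mul, ← hder, ← hmul]
      calc taylorPS ψ = taylorPS ψ * 1 := (mul_one _).symm
        _ = _ := by rw [← hinv]; ring
    intro j
    rcases j with _ | j
    · simp [hΦ0, cumulant, logCoeff]
    · have h1 : iteratedDeriv (j + 1) Φ 0 = iteratedDeriv j ψ 0 := by
        rw [iteratedDeriv_succ']
        refine Filter.EventuallyEq.iteratedDeriv_eq j ?_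
        filter_upwards [hUnhds] with z hz
        exact (hΦ z hz).deriv
      have h2 := congrArg (PowerSeries.coeff j) hψps
      rw [PowerSeries.coeff_map, taylorPS, PowerSeries.coeff_mk] at h2
      rw [h1, cumulant, logCoeff, Nat.factorial_succ]
      simp only [add_tsub_cancel_right]
      rw [Complex.ofReal_div]
      have h3 : ((PowerSeries.coeff j (PowerSeries.derivative ℝ (momentSeries Ω W)
        * (momentSeries Ω W)⁻¹) : ℝ) : ℂ) = iteratedDeriv j ψ 0 / j.factorial := h2.symm
      rw [h3]
      push_cast
      rw [div_div, mul_comm]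
  constructor
  · intro s hs hsr j
    have hsub : Metric.closedBall (0 : ℂ) s ⊆ U := Metric.closedBall_subset_ball hsr
    have hdc : DiffContOnCl ℂ Φ (Metric.ball 0 s) := by
      refine DifferentiableOn.diffContOnCl ?_
      rw [closure_ball _ hs.ne']
      exact hΦdiff.mono hsub
    have h1 := Complex.norm_iteratedDeriv_le_of_forall_mem_sphere_norm_le (C := B * s) j hs hdc
      (fun z hz => by
        have hz' : ‖z‖ = s := by simpa using hz
        have := hΦB z (hsub (Metric.sphere_subset_closedBall hz))
        rwa [hz'] at this)
    have h2 : |cumulant Ω W j| = ‖iteratedDeriv j Φ 0‖ / j.factorial := by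
      rw [← Real.norm_eq_abs, ← Complex.norm_real, ← hcoeff j, norm_div, Complex.norm_natCast]
    have h3 : (0 : ℝ) < j.factorial := by exact_mod_cast j.factorial_pos
    rw [h2, div_le_iff₀ h3]
    refine h1.trans (le_of_eq ?_)
    ring
  · intro h1r
    have h1U : (1 : ℂ) ∈ U := by simpa [U] using h1r
    have hs := Complex.hasSum_taylorSeries_on_ball hΦdiff h1U
    have hs' : HasSum (fun j => (cumulant Ω W j : ℂ)) (Φ 1) := by
      convert! hs using 2 with j
      rw [← hcoeff j]
      simp [div_eq_inv_mul]
    have hre := Complex.hasSum_re hs'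
    simp only [Complex.ofReal_re] at hre
    convert! hre using 1
    have h2 := hexp 1 h1U
    have h3 : Z 1 = ((∑ σ ∈ Ω, Real.exp (W σ) : ℝ) : ℂ) := by
      simp only [Z, one_mul]
      push_cast
      rfl
    have h4 := congrArg (fun z => ‖z‖) h2
    simp only [h3, norm_mul, Complex.norm_natCast, Complex.norm_exp, Complex.norm_real,
      Real.norm_eq_abs] at h4
    rw [abs_of_nonneg (Finset.sum_nonneg fun _ _ => (Real.exp_pos _).le)] at h4
    rw [h4, mul_div_cancel_left₀ _ hcard, Real.log_exp]

end Cumulant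

section SliceCumulant

variable {ι κ : Type*} [Fintype ι] [DecidableEq ι] [Fintype κ] [DecidableEq κ]

/-- The pair interaction `½ ∑ A(x,y) σ(x) σ(y)`, the sum running over ordered pairs. -/
def pairW (A : ι → ι → ℝ) (σ : ι → ℤˣ) : ℝ :=
  1 / 2 * ∑ x, ∑ y, A x y * (((σ x : ℤ) : ℝ) * ((σ y : ℤ) : ℝ))

theorem pairEnergy_smul (A : ι → ι → ℝ) (z : ℂ) (σ : ι → ℤˣ) :
    pairEnergy (fun x y => z / 2 * A x y) σ = z * pairW A σ := by
  simp only [pairEnergy, pairW]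
  push_cast
  simp only [Finset.mul_sum]
  refine Finset.sum_congr rfl fun x _ => Finset.sum_congr rfl fun y _ => ?_
  ring

/-- Cumulant bounds for a real pair interaction on a slice whose symmetrized row sums are at most
`2ρ`: they are of order `ρ^j` per site, uniformly in the cells. -/
theorem cumulant_slice {c : ι → κ} {η : κ → ℤ} (hne : (slice c η).Nonempty) (A : ι → ι → ℝ)
    {ρ : ℝ} (hA : ∀ x, ∑ y, (|A x y| + |A y x|) ≤ 2 * ρ) (hρ0 : 0 ≤ ρ) (hρ : 160 * ρ ≤ 1) :
    (∀ j, 1 ≤ j → |cumulant (slice c η) (pairW A) j|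
      ≤ 4 * Fintype.card ι * ρ * (80 * ρ) ^ (j - 1)) ∧
    HasSum (cumulant (slice c η) (pairW A))
      (Real.log ((∑ σ ∈ slice c η, Real.exp (pairW A σ)) / (slice c η).card)) := by
  have hweak : ∀ z : ℂ, ‖z‖ * (40 * ρ) ≤ 1 → IsWeak fun x y => z / 2 * A x y := by
    intro z hz x
    simp only [norm_mul, norm_div, Complex.norm_real, Real.norm_eq_abs, Complex.norm_ofNat,
      ← mul_add, ← Finset.mul_sum]
    have h1 := hA x
    have h2 : ‖z‖ / 2 * ∑ y, (|A x y| + |A y x|) ≤ ‖z‖ / 2 * (2 * ρ) :=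
      mul_le_mul_of_nonneg_left h1 (by positivity)
    linarith
  have htot : ∑ x, ∑ y, |A x y| ≤ Fintype.card ι * (2 * ρ) := by
    rw [← nsmul_eq_mul, ← Finset.card_univ]
    refine Finset.sum_le_card_nsmul _ _ _ fun x _ => ?_
    refine le_trans (Finset.sum_le_sum fun y _ => ?_) (hA x)
    linarith [abs_nonneg (A y x)]
  -- `z W` comes from a weak interaction for `‖z‖ ≤ 1 / (40 ρ)`, and each of the pair terms in the
  -- derivative of its partition function is bounded by `4`.
  have main : ∀ r, 0 < r → r * (40 * ρ) ≤ 1 → _ := fun r hr hr' =>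
    cumulant_bound_and_hasSum hne (pairW A) (r := r) (B := 4 * Fintype.card ι * ρ) hr
      (fun z hz => by
        have hw := hweak z ((mul_le_mul_of_nonneg_right hz.le (by positivity)).trans hr')
        have := pairZ_slice_ne_zero (c := c) (η := η) hw hne
        simpa only [pairZ, pairEnergy_smul] using this)
      (fun z hz => by
        have hw := hweak z ((mul_le_mul_of_nonneg_right hz.le (by positivity)).trans hr')
        have h2 := norm_sum_spin_pair_le (c := c) (η := η) hw hne
        simp only [pairZ, pairEnergy_smul] at h2
        have e : ∑ σ ∈ slice c η, (pairW A σ : ℂ) * Complex.exp (z * pairW A σ)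
            = 1 / 2 * ∑ x, ∑ y, (A x y : ℂ) * ∑ σ ∈ slice c η,
              (((σ x : ℤ) : ℂ) * ((σ y : ℤ) : ℂ)) * Complex.exp (z * pairW A σ) := by
          have : ∀ σ : ι → ℤˣ, (pairW A σ : ℂ)
              = 1 / 2 * ∑ x, ∑ y, (A x y : ℂ) * (((σ x : ℤ) : ℂ) * ((σ y : ℤ) : ℂ)) := by
            intro σ
            simp only [pairW]
            push_cast
            rfl
          simp only [Finset.mul_sum]
          calc _ = ∑ σ ∈ slice c η, ∑ x, ∑ y, 1 / 2 * ((A x y : ℂ) *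
                ((((σ x : ℤ) : ℂ) * ((σ y : ℤ) : ℂ)) * Complex.exp (z * pairW A σ))) := by
                refine Finset.sum_congr rfl fun σ _ => ?_
                nth_rewrite 1 [this σ]
                simp only [Finset.mul_sum, Finset.sum_mul]
                refine Finset.sum_congr rfl fun x _ => Finset.sum_congr rfl fun y _ => ?_
                ring
            _ = _ := by
                rw [Finset.sum_comm]
                refine Finset.sum_congr rfl fun x _ => ?_
                rw [Finset.sum_comm]
        rw [e, norm_mul]
        set G := ‖∑ σ ∈ slice c η, Complex.exp (z * pairW A σ)‖ with hG
        calc _ ≤ ‖(1 / 2 : ℂ)‖ * ∑ x, ∑ y, |A x y| * (4 * G) := by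
              refine mul_le_mul_of_nonneg_left ?_ (norm_nonneg _)
              refine (norm_sum_le _ _).trans (Finset.sum_le_sum fun x _ => (norm_sum_le _ _).trans
                (Finset.sum_le_sum fun y _ => ?_))
              rw [norm_mul, Complex.norm_real, Real.norm_eq_abs]
              exact mul_le_mul_of_nonneg_left (h2 x y) (abs_nonneg _)
          _ = 1 / 2 * (∑ x, ∑ y, |A x y|) * (4 * G) := by
              simp only [← Finset.sum_mul]
              norm_num
              ring
          _ ≤ 1 / 2 * (Fintype.card ι * (2 * ρ)) * (4 * G) := by gcongr
          _ = _ := by ring)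
  constructor
  · intro j hj
    obtain ⟨i, rfl⟩ := Nat.exists_eq_add_of_le' hj
    rcases hρ0.eq_or_lt with h0 | hpos
    · -- There is no radius `1 / (40 ρ)` for `ρ = 0`, but then `B = 0` and any disc will do.
      subst h0
      have := (main 2 (by norm_num) (by norm_num)).1 1 (by norm_num) (by norm_num) (i + 1)
      simpa using this
    · -- Cauchy's estimate on the circle of half the radius of analyticity.
      have h1 : 1 / (40 * ρ) * (40 * ρ) ≤ 1 := by
        rw [one_div, inv_mul_cancel₀ (by positivity)]
      have h2 : 1 / (80 * ρ) < 1 / (40 * ρ) := by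
        apply one_div_lt_one_div_of_lt <;> linarith
      have := (main (1 / (40 * ρ)) (by positivity) h1).1 (1 / (80 * ρ)) (by positivity) h2 (i + 1)
      refine this.trans (le_of_eq ?_)
      simp only [add_tsub_cancel_right]
      rw [pow_succ, one_div_pow]
      field_simp
  · exact (main 2 (by norm_num) (by linarith)).2 (by norm_num)

end SliceCumulant

/-! ### Set functions, Möbius inversion and range -/

section Mobius

variable {κ : Type*} [DecidableEq κ]

/-- The Möbius transform of a set function, characterized by `∑_{Y ⊆ X} mobius f Y = f X`. -/
def mobius (f : Finset κ → ℝ) (X : Finset κ) : ℝ :=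
  f X - ∑ Y ∈ X.ssubsets.attach, mobius f Y.1
termination_by X.card
decreasing_by exact Finset.card_lt_card (Finset.mem_ssubsets.1 Y.2)

theorem mobius_eq (f : Finset κ → ℝ) (X : Finset κ) :
    mobius f X = f X - ∑ Y ∈ X.ssubsets, mobius f Y := by
  rw [mobius, Finset.sum_attach X.ssubsets (fun Y => mobius f Y)]

theorem sum_powerset_eq_add_ssubsets (g : Finset κ → ℝ) (X : Finset κ) :
    ∑ Y ∈ X.powerset, g Y = g X + ∑ Y ∈ X.ssubsets, g Y := by
  rw [Finset.ssubsets, Finset.add_sum_erase _ _ (Finset.mem_powerset_self X)]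

theorem sum_powerset_mobius (f : Finset κ → ℝ) (X : Finset κ) :
    ∑ Y ∈ X.powerset, mobius f Y = f X := by
  rw [sum_powerset_eq_add_ssubsets, mobius_eq]
  ring

theorem mobius_unique {f g : Finset κ → ℝ} (X : Finset κ)
    (h : ∀ Y ⊆ X, f Y = ∑ Z ∈ Y.powerset, g Z) : mobius f X = g X := by
  induction X using Finset.strongInduction with
  | H X ih =>
  rw [mobius_eq, h X (Finset.Subset.refl X), sum_powerset_eq_add_ssubsets]
  rw [Finset.sum_congr rfl fun Y hY => ih Y (Finset.mem_ssubsets.1 hY) fun Z hZ =>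
    h Z (hZ.trans (Finset.mem_ssubsets.1 hY).subset)]
  ring

theorem mobius_congr {f g : Finset κ → ℝ} (X : Finset κ) (h : ∀ Y ⊆ X, f Y = g Y) :
    mobius f X = mobius g X :=
  mobius_unique X fun Y hY => by rw [h Y hY, sum_powerset_mobius]

theorem mobius_image {f g : Finset κ → ℝ} (e : Equiv.Perm κ)
    (h : ∀ Y, f (Y.image e) = g Y) (X : Finset κ) : mobius f (X.image e) = mobius g X := by
  symm
  refine mobius_unique (g := fun Y => mobius f (Y.image e)) X fun Y _ => ?_
  rw [← h, ← sum_powerset_mobius f, Finset.powerset_image,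
    Finset.sum_image fun A _ B _ hAB => Finset.image_injective e.injective hAB]

/-- The Möbius transform of an additive set function vanishes on decomposable sets. -/
theorem mobius_eq_zero_of_separated {f : Finset κ → ℝ} {sep : κ → κ → Prop} (h0 : f ∅ = 0)
    (hadd : ∀ X₁ X₂ : Finset κ, Disjoint X₁ X₂ → (∀ k ∈ X₁, ∀ l ∈ X₂, sep k l) →
      f (X₁ ∪ X₂) = f X₁ + f X₂) (X : Finset κ) :
    ∀ X₁ X₂ : Finset κ, X = X₁ ∪ X₂ → Disjoint X₁ X₂ → (∀ k ∈ X₁, ∀ l ∈ X₂, sep k l) →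
      X₁.Nonempty → X₂.Nonempty → mobius f X = 0 := by
  induction X using Finset.strongInduction with
  | H X ih =>
  rintro X₁ X₂ rfl hd hs h1 h2
  have hm0 : mobius f ∅ = 0 := by
    have := sum_powerset_mobius f ∅
    simpa [h0] using this
  have hf := hadd X₁ X₂ hd hs
  rw [← sum_powerset_mobius f (X₁ ∪ X₂), ← sum_powerset_mobius f X₁,
    ← sum_powerset_mobius f X₂] at hf
  -- All subsets other than the whole set contribute equally to both sides.
  have hsplit : ∑ Y ∈ (X₁ ∪ X₂).powerset, mobius f Y
      = mobius f (X₁ ∪ X₂) + (∑ Y ∈ X₁.powerset, mobius f Y + ∑ Y ∈ X₂.powerset, mobius f Y) := by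
    have hne : X₁ ∪ X₂ ∉ X₁.powerset ∪ X₂.powerset := by
      simp only [Finset.mem_union, Finset.mem_powerset, not_or]
      constructor
      · intro h
        obtain ⟨y, hy⟩ := h2
        exact Finset.disjoint_left.1 hd (h (Finset.mem_union_right _ hy)) hy
      · intro h
        obtain ⟨y, hy⟩ := h1
        exact Finset.disjoint_left.1 hd hy (h (Finset.mem_union_left _ hy))
    have hinter : X₁.powerset ∩ X₂.powerset = {∅} := by
      ext Y
      simp only [Finset.mem_inter, Finset.mem_powerset, Finset.mem_singleton]
      constructor
      · rintro ⟨a, b⟩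
        exact Finset.disjoint_self_iff_empty Y |>.1 (hd.mono a b)
      · rintro rfl; simp
    have hun : ∑ Y ∈ X₁.powerset ∪ X₂.powerset, mobius f Y
        = ∑ Y ∈ X₁.powerset, mobius f Y + ∑ Y ∈ X₂.powerset, mobius f Y := by
      have := Finset.sum_union_inter (s₁ := X₁.powerset) (s₂ := X₂.powerset) (f := mobius f)
      rw [hinter, Finset.sum_singleton, hm0, add_zero] at this
      exact this
    rw [← hun, ← Finset.sum_insert hne]
    symm
    refine Finset.sum_subset ?_ ?_
    · intro Y hY
      rw [Finset.mem_insert, Finset.mem_union, Finset.mem_powerset, Finset.mem_powerset] at hY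
      rw [Finset.mem_powerset]
      rcases hY with rfl | h | h
      · exact Finset.Subset.refl _
      · exact h.trans Finset.subset_union_left
      · exact h.trans Finset.subset_union_right
    · intro Y hY hY'
      rw [Finset.mem_insert, Finset.mem_union, Finset.mem_powerset, Finset.mem_powerset,
        not_or, not_or] at hY'
      rw [Finset.mem_powerset] at hY
      refine ih Y (lt_of_le_of_ne hY hY'.1) (Y ∩ X₁) (Y ∩ X₂) ?_ ?_ ?_ ?_ ?_
      · rw [← Finset.inter_union_distrib_left, Finset.inter_eq_left.2 hY]
      · exact hd.mono Finset.inter_subset_right Finset.inter_subset_right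
      · exact fun k hk l hl => hs k (Finset.mem_inter.1 hk).2 l (Finset.mem_inter.1 hl).2
      · obtain ⟨y, hy, hy2⟩ := Finset.not_subset.1 hY'.2.2
        exact ⟨y, Finset.mem_inter.2 ⟨hy, (Finset.mem_union.1 (hY hy)).resolve_right hy2⟩⟩
      · obtain ⟨y, hy, hy2⟩ := Finset.not_subset.1 hY'.2.1
        exact ⟨y, Finset.mem_inter.2 ⟨hy, (Finset.mem_union.1 (hY hy)).resolve_left hy2⟩⟩
  linarith

/-- A set function has degree at most `D` if its Möbius transform lives on sets with at most `D`
elements. -/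
def HasDegreeLE (D : ℕ) (f : Finset κ → ℝ) : Prop :=
  ∃ g : Finset κ → ℝ, (∀ Y, D < Y.card → g Y = 0) ∧ ∀ X, f X = ∑ Y ∈ X.powerset, g Y

theorem HasDegreeLE.mono {D D' : ℕ} {f : Finset κ → ℝ} (h : HasDegreeLE D f) (hD : D ≤ D') :
    HasDegreeLE D' f := by
  obtain ⟨g, h1, h2⟩ := h
  exact ⟨g, fun Y hY => h1 Y (hD.trans_lt hY), h2⟩

theorem HasDegreeLE.mobius_eq_zero {D : ℕ} {f : Finset κ → ℝ} (h : HasDegreeLE D f)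
    {X : Finset κ} (hX : D < X.card) : mobius f X = 0 := by
  obtain ⟨g, h1, h2⟩ := h
  rw [mobius_unique X fun Y _ => h2 Y, h1 X hX]

theorem HasDegreeLE.add {D : ℕ} {f f' : Finset κ → ℝ} (h : HasDegreeLE D f)
    (h' : HasDegreeLE D f') : HasDegreeLE D fun X => f X + f' X := by
  obtain ⟨g, h1, h2⟩ := h
  obtain ⟨g', h1', h2'⟩ := h'
  refine ⟨fun Y => g Y + g' Y, fun Y hY => by simp only [h1 Y hY, h1' Y hY, add_zero], fun X => ?_⟩
  simp only [h2, h2', Finset.sum_add_distrib]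

theorem HasDegreeLE.const_mul {D : ℕ} {f : Finset κ → ℝ} (h : HasDegreeLE D f) (b : ℝ) :
    HasDegreeLE D fun X => b * f X := by
  obtain ⟨g, h1, h2⟩ := h
  refine ⟨fun Y => b * g Y, fun Y hY => by simp only [h1 Y hY, mul_zero], fun X => ?_⟩
  simp only [h2, Finset.mul_sum]

theorem HasDegreeLE.sub {D : ℕ} {f f' : Finset κ → ℝ} (h : HasDegreeLE D f)
    (h' : HasDegreeLE D f') : HasDegreeLE D fun X => f X - f' X := by
  simpa [sub_eq_add_neg] using h.add (h'.const_mul (-1))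

theorem hasDegreeLE_sum {α : Type*} {D : ℕ} (s : Finset α) {f : α → Finset κ → ℝ}
    (h : ∀ i ∈ s, HasDegreeLE D (f i)) : HasDegreeLE D fun X => ∑ i ∈ s, f i X := by
  classical
  induction s using Finset.induction_on with
  | empty => exact ⟨fun _ => 0, fun _ _ => rfl, fun X => by simp⟩
  | insert i s hi ih =>
    simp only [Finset.sum_insert hi]
    exact (h i (Finset.mem_insert_self _ _)).add
      (ih fun j hj => h j (Finset.mem_insert_of_mem hj))

theorem HasDegreeLE.mul {D D' : ℕ} {f f' : Finset κ → ℝ} (h : HasDegreeLE D f)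
    (h' : HasDegreeLE D' f') : HasDegreeLE (D + D') fun X => f X * f' X := by
  obtain ⟨g, h1, h2⟩ := h
  obtain ⟨g', h1', h2'⟩ := h'
  refine ⟨fun Y => ∑ P ∈ (Y.powerset ×ˢ Y.powerset).filter (fun P => P.1 ∪ P.2 = Y),
    g P.1 * g' P.2, fun Y hY => ?_, fun X => ?_⟩
  · refine Finset.sum_eq_zero fun P hP => ?_
    have hP' := (Finset.mem_filter.1 hP).2
    have hc := Finset.card_union_le P.1 P.2
    rw [hP'] at hc
    by_cases hD : D < P.1.card
    · rw [h1 _ hD, zero_mul]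
    · rw [h1' _ (by omega), mul_zero]
  · simp only [h2, h2']
    rw [Finset.sum_mul_sum, ← Finset.sum_product',
      ← Finset.sum_fiberwise_of_maps_to (t := X.powerset) (g := fun P => P.1 ∪ P.2)]
    · refine Finset.sum_congr rfl fun Y hY => Finset.sum_congr ?_ fun _ _ => rfl
      ext P
      simp only [Finset.mem_filter, Finset.mem_product, Finset.mem_powerset] at hY ⊢
      constructor
      · rintro ⟨_, rfl⟩
        exact ⟨⟨Finset.subset_union_left, Finset.subset_union_right⟩, rfl⟩
      · rintro ⟨⟨a, b⟩, e⟩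
        exact ⟨⟨a.trans hY, b.trans hY⟩, e⟩
    · intro P hP
      simp only [Finset.mem_product, Finset.mem_powerset] at hP ⊢
      exact Finset.union_subset hP.1 hP.2

theorem hasDegreeLE_ite_subset (S : Finset κ) (w : ℝ) :
    HasDegreeLE S.card fun X => if S ⊆ X then w else 0 := by
  refine ⟨fun Y => if Y = S then w else 0, fun Y hY => ?_, fun X => ?_⟩
  · exact if_neg (by rintro rfl; exact lt_irrefl _ hY)
  · simp only [Finset.sum_ite_eq', Finset.mem_powerset]

theorem HasDegreeLE.pow {D : ℕ} {f : Finset κ → ℝ} (h : HasDegreeLE D f) (n : ℕ) :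
    HasDegreeLE (D * n) fun X => f X ^ n := by
  induction n with
  | zero =>
    simp only [pow_zero]
    have := hasDegreeLE_ite_subset (∅ : Finset κ) 1
    simpa using this
  | succ n ih =>
    simp only [pow_succ, Nat.mul_succ]
    exact ih.mul h

/-- If `f` has degree at most `D` and is additive over sets at distance more than `r`, then its
Möbius transform has range at most `D r`: among fewer than `D` further points, one of the `D`
annuli of width `r` around a point of the set is empty. -/
theorem mobius_eq_zero_of_far {f : Finset κ → ℝ} {u : κ → κ → ℝ} {D : ℕ} {r : ℝ} (hr : 0 ≤ r)
    (hself : ∀ k, u k k = 0) (htri : ∀ k l j, u k j ≤ u k l + u l j)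
    (h0 : f ∅ = 0) (hdeg : HasDegreeLE D f)
    (hadd : ∀ X₁ X₂ : Finset κ, Disjoint X₁ X₂ → (∀ k ∈ X₁, ∀ l ∈ X₂, r < u k l) →
      f (X₁ ∪ X₂) = f X₁ + f X₂)
    {X : Finset κ} {k l : κ} (hk : k ∈ X) (hl : l ∈ X) (hkl : D * r < u k l) :
    mobius f X = 0 := by
  by_cases hX : D < X.card
  · exact hdeg.mobius_eq_zero hX
  by_cases hgap : ∃ i < D, ∀ y ∈ X, ¬ ((i : ℝ) * r < u k y ∧ u k y ≤ (i + 1) * r)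
  · obtain ⟨i, hi, hgap⟩ := hgap
    refine mobius_eq_zero_of_separated (sep := fun k l => r < u k l) h0 hadd X
      (X.filter fun y => u k y ≤ i * r) (X.filter fun y => ¬ u k y ≤ i * r)
      (Finset.filter_union_filter_not_eq _ X).symm (Finset.disjoint_filter_filter_not _ _ _)
      ?_ ⟨k, ?_⟩ ⟨l, ?_⟩
    · intro a ha b hb
      rw [Finset.mem_filter] at ha hb
      have h1 := hgap b hb.1
      have h2 := htri k a b
      have h3 : ((i : ℝ) + 1) * r < u k b := by
        by_contra h
        exact h1 ⟨not_le.1 hb.2, not_lt.1 h⟩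
      have h4 := ha.2
      nlinarith
    · rw [Finset.mem_filter, hself]
      exact ⟨hk, by positivity⟩
    · rw [Finset.mem_filter, not_le]
      refine ⟨hl, lt_of_le_of_lt ?_ hkl⟩
      have : (i : ℝ) ≤ D := by exact_mod_cast hi.le
      exact mul_le_mul_of_nonneg_right this hr
  · exfalso
    push Not at hgap
    have : Nonempty κ := ⟨k⟩
    choose! y hy using hgap
    have hinj : Set.InjOn y (Finset.range D : Finset ℕ) := by
      intro i hi j hj hij
      have h1 := hy i (Finset.mem_range.1 hi)
      have h2 := hy j (Finset.mem_range.1 hj)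
      rw [← hij] at h2
      have key : ∀ a b : ℕ, (a : ℝ) * r < u k (y i) → u k (y i) ≤ (b + 1) * r → a ≤ b := by
        intro a b ha hb
        by_contra hab
        have : (b : ℝ) + 1 ≤ a := by exact_mod_cast not_le.1 hab
        have := mul_le_mul_of_nonneg_right this hr
        linarith
      exact le_antisymm (key i j h1.2.1 h2.2.2) (key j i h2.2.1 h1.2.2)
    have hmaps : (Finset.range D).image y ⊆ X.erase k := by
      intro z hz
      obtain ⟨i, hi, rfl⟩ := Finset.mem_image.1 hz
      have h1 := hy i (Finset.mem_range.1 hi)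
      refine Finset.mem_erase.2 ⟨?_, h1.1⟩
      intro h
      rw [h, hself] at h1
      have : 0 ≤ (i : ℝ) * r := by positivity
      linarith [h1.2.1]
    have h1 := Finset.card_le_card hmaps
    rw [Finset.card_image_of_injOn hinj, Finset.card_range, Finset.card_erase_of_mem hk] at h1
    have h2 : 0 < X.card := Finset.card_pos.2 ⟨k, hk⟩
    omega

end Mobius

/-! ### Independence of cells and locality of cumulants -/

section Independence

variable {ι κ : Type*} [Fintype ι] [DecidableEq ι] [Fintype κ] [DecidableEq κ]

/-- `f` depends only on the spins of the cells in `X`. -/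
def DependsOnCells (c : ι → κ) (X : Finset κ) (f : (ι → ℤˣ) → ℝ) : Prop :=
  ∀ σ τ : ι → ℤˣ, (∀ x, c x ∈ X → σ x = τ x) → f σ = f τ

theorem mem_slice {c : ι → κ} {η : κ → ℤ} {σ : ι → ℤˣ} : σ ∈ slice c η ↔
    ∀ k, ∑ x ∈ Finset.univ.filter (fun x => c x = k), ((σ x : ℤˣ) : ℤ) = η k := by
  simp [slice]

theorem mix_mem_slice {c : ι → κ} {η η' : κ → ℤ} {X : Finset κ} (h : ∀ k ∈ X, η k = η' k)
    {σ τ : ι → ℤˣ} (hσ : σ ∈ slice c η) (hτ : τ ∈ slice c η') :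
    (fun x => if c x ∈ X then σ x else τ x) ∈ slice c η' := by
  rw [mem_slice] at hσ hτ ⊢
  intro k
  by_cases hk : k ∈ X
  · rw [← h k hk, ← hσ k]
    refine Finset.sum_congr rfl fun x hx => ?_
    rw [(Finset.mem_filter.1 hx).2, if_pos hk]
  · rw [← hτ k]
    refine Finset.sum_congr rfl fun x hx => ?_
    rw [(Finset.mem_filter.1 hx).2, if_neg hk]

/-- The uniform measure on a slice is a product over cells. The proof exchanges the contents of
the cells in `X` between two independent configurations. -/
theorem sum_slice_mul_sum_slice {c : ι → κ} {η η' : κ → ℤ} {X : Finset κ}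
    (h : ∀ k ∈ X, η k = η' k) {f g : (ι → ℤˣ) → ℝ} (hf : DependsOnCells c X f)
    (hg : DependsOnCells c Xᶜ g) :
    (∑ σ ∈ slice c η, f σ) * ∑ τ ∈ slice c η', g τ
      = (slice c η).card * ∑ τ ∈ slice c η', f τ * g τ := by
  rw [Finset.sum_mul_sum, ← Finset.sum_product', ← nsmul_eq_mul, ← Finset.sum_const,
    ← Finset.sum_product']
  refine Finset.sum_nbij'
    (fun P => (fun x => if c x ∈ X then P.2 x else P.1 x, fun x => if c x ∈ X then P.1 x else P.2 x))
    (fun P => (fun x => if c x ∈ X then P.2 x else P.1 x, fun x => if c x ∈ X then P.1 x else P.2 x))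
    ?_ ?_ ?_ ?_ ?_
  · intro P hP
    rw [Finset.mem_product] at hP ⊢
    exact ⟨mix_mem_slice (fun k hk => (h k hk).symm) hP.2 hP.1, mix_mem_slice h hP.1 hP.2⟩
  · intro P hP
    rw [Finset.mem_product] at hP ⊢
    exact ⟨mix_mem_slice (fun k hk => (h k hk).symm) hP.2 hP.1, mix_mem_slice h hP.1 hP.2⟩
  · intro P _
    ext x <;> by_cases hx : c x ∈ X <;> simp [hx]
  · intro P _
    ext x <;> by_cases hx : c x ∈ X <;> simp [hx]
  · intro P _
    congr 1
    · exact hf _ _ fun x hx => by simp [hx]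
    · exact hg _ _ fun x hx => by simp [Finset.mem_compl.1 hx]

/-- The mean of `f` over a slice. -/
def sliceMean (c : ι → κ) (η : κ → ℤ) (f : (ι → ℤˣ) → ℝ) : ℝ :=
  (∑ σ ∈ slice c η, f σ) / (slice c η).card

theorem sliceMean_mul {c : ι → κ} {η : κ → ℤ} (hne : (slice c η).Nonempty) {X : Finset κ}
    {f g : (ι → ℤˣ) → ℝ} (hf : DependsOnCells c X f) (hg : DependsOnCells c Xᶜ g) :
    sliceMean c η (fun σ => f σ * g σ) = sliceMean c η f * sliceMean c η g := by
  have hc : ((slice c η).card : ℝ) ≠ 0 := by exact_mod_cast hne.card_pos.ne'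
  have := sum_slice_mul_sum_slice (c := c) (η := η) (η' := η) (fun _ _ => rfl) hf hg
  unfold sliceMean
  rw [div_mul_div_comm, this]
  field_simp

theorem sliceMean_congr {c : ι → κ} {η η' : κ → ℤ} (hne : (slice c η).Nonempty)
    (hne' : (slice c η').Nonempty) {X : Finset κ} (h : ∀ k ∈ X, η k = η' k)
    {f : (ι → ℤˣ) → ℝ} (hf : DependsOnCells c X f) : sliceMean c η f = sliceMean c η' f := by
  have hc : ((slice c η).card : ℝ) ≠ 0 := by exact_mod_cast hne.card_pos.ne'
  have hc' : ((slice c η').card : ℝ) ≠ 0 := by exact_mod_cast hne'.card_pos.ne'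
  have := sum_slice_mul_sum_slice (c := c) h hf (g := fun _ => 1) (fun _ _ _ => rfl)
  simp only [Finset.sum_const, nsmul_eq_mul, mul_one] at this
  unfold sliceMean
  rw [div_eq_div_iff hc hc', this]
  ring

theorem sliceMean_const {c : ι → κ} {η : κ → ℤ} (hne : (slice c η).Nonempty) (b : ℝ) :
    sliceMean c η (fun _ => b) = b := by
  have hc : ((slice c η).card : ℝ) ≠ 0 := by exact_mod_cast hne.card_pos.ne'
  simp [sliceMean, hc]

theorem sliceMean_add (c : ι → κ) (η : κ → ℤ) (f g : (ι → ℤˣ) → ℝ) :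
    sliceMean c η (fun σ => f σ + g σ) = sliceMean c η f + sliceMean c η g := by
  simp only [sliceMean, Finset.sum_add_distrib, add_div]

theorem sliceMean_const_mul (c : ι → κ) (η : κ → ℤ) (b : ℝ) (f : (ι → ℤˣ) → ℝ) :
    sliceMean c η (fun σ => b * f σ) = b * sliceMean c η f := by
  simp only [sliceMean, ← Finset.mul_sum, mul_div_assoc]

theorem sliceMean_sum {α : Type*} (s : Finset α) (c : ι → κ) (η : κ → ℤ)
    (f : α → (ι → ℤˣ) → ℝ) :
    sliceMean c η (fun σ => ∑ i ∈ s, f i σ) = ∑ i ∈ s, sliceMean c η (f i) := by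
  simp only [sliceMean, ← Finset.sum_div]
  rw [Finset.sum_comm]

theorem sliceMean_congr_fun {c : ι → κ} {η : κ → ℤ} {f g : (ι → ℤˣ) → ℝ}
    (h : ∀ σ ∈ slice c η, f σ = g σ) : sliceMean c η f = sliceMean c η g := by
  simp only [sliceMean, Finset.sum_congr rfl h]

theorem coeff_momentSeries (c : ι → κ) (η : κ → ℤ) (W : (ι → ℤˣ) → ℝ) (n : ℕ) :
    PowerSeries.coeff n (momentSeries (slice c η) W)
      = sliceMean c η (fun σ => W σ ^ n) / n.factorial := by
  simp [momentSeries, sliceMean, div_div]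

theorem momentSeries_add {c : ι → κ} {η : κ → ℤ} (hne : (slice c η).Nonempty) {X : Finset κ}
    {f g : (ι → ℤˣ) → ℝ} (hf : DependsOnCells c X f) (hg : DependsOnCells c Xᶜ g) :
    momentSeries (slice c η) (fun σ => f σ + g σ)
      = momentSeries (slice c η) f * momentSeries (slice c η) g := by
  ext n
  rw [PowerSeries.coeff_mul]
  simp only [coeff_momentSeries]
  have h1 : ∀ σ, (f σ + g σ) ^ n = ∑ P ∈ Finset.HasAntidiagonal.antidiagonal n,
      (n.choose P.1 : ℝ) * (f σ ^ P.1 * g σ ^ P.2) := by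
    intro σ
    rw [(Commute.all (f σ) (g σ)).add_pow']
    simp only [nsmul_eq_mul]
  simp only [h1]
  rw [sliceMean_sum, Finset.sum_div]
  refine Finset.sum_congr rfl fun P hP => ?_
  rw [sliceMean_const_mul, sliceMean_mul hne (X := X) (f := fun σ => f σ ^ P.1) (g := fun σ => g σ ^ P.2)
    (fun σ τ h => by simp only [hf σ τ h]) (fun σ τ h => by simp only [hg σ τ h])]
  have hP' := Finset.HasAntidiagonal.mem_antidiagonal.1 hP
  subst hP'
  rw [Nat.cast_add_choose ℝ]
  have h2 : (P.1.factorial : ℝ) ≠ 0 := by exact_mod_cast P.1.factorial_ne_zero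
  have h3 : (P.2.factorial : ℝ) ≠ 0 := by exact_mod_cast P.2.factorial_ne_zero
  have h4 : ((P.1 + P.2).factorial : ℝ) ≠ 0 := by exact_mod_cast (P.1 + P.2).factorial_ne_zero
  field_simp

theorem logCoeff_mul {M N : PowerSeries ℝ} (hM : PowerSeries.constantCoeff M ≠ 0)
    (hN : PowerSeries.constantCoeff N ≠ 0) (j : ℕ) :
    logCoeff (M * N) j = logCoeff M j + logCoeff N j := by
  have : PowerSeries.derivative ℝ (M * N) * (M * N)⁻¹
      = PowerSeries.derivative ℝ M * M⁻¹ + PowerSeries.derivative ℝ N * N⁻¹ := by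
    rw [PowerSeries.mul_inv_rev, Derivation.leibniz, smul_eq_mul, smul_eq_mul]
    have h1 := PowerSeries.mul_inv_cancel M hM
    have h2 := PowerSeries.mul_inv_cancel N hN
    linear_combination (PowerSeries.derivative ℝ N * N⁻¹) * h1
      + (PowerSeries.derivative ℝ M * M⁻¹) * h2
  unfold logCoeff
  rw [this, map_add, add_div]

/-- Cumulants of independent observables add up. -/
theorem cumulant_add {c : ι → κ} {η : κ → ℤ} (hne : (slice c η).Nonempty) {X : Finset κ}
    {f g : (ι → ℤˣ) → ℝ} (hf : DependsOnCells c X f) (hg : DependsOnCells c Xᶜ g) (j : ℕ) :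
    cumulant (slice c η) (fun σ => f σ + g σ) j
      = cumulant (slice c η) f j + cumulant (slice c η) g j := by
  unfold cumulant
  rw [momentSeries_add hne hf hg, logCoeff_mul] <;>
  · rw [constantCoeff_momentSeries hne]; exact one_ne_zero

theorem cumulant_congr {c : ι → κ} {η η' : κ → ℤ} (hne : (slice c η).Nonempty)
    (hne' : (slice c η').Nonempty) {X : Finset κ} (h : ∀ k ∈ X, η k = η' k)
    {f : (ι → ℤˣ) → ℝ} (hf : DependsOnCells c X f) (j : ℕ) :
    cumulant (slice c η) f j = cumulant (slice c η') f j := by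
  have : momentSeries (slice c η) f = momentSeries (slice c η') f := by
    ext n
    rw [coeff_momentSeries, coeff_momentSeries, sliceMean_congr hne hne' h]
    exact fun σ τ hs => by simp only [hf σ τ hs]
  unfold cumulant
  rw [this]

/-- The restriction of a pair interaction to the cells in `X`. -/
def restrictA (c : ι → κ) (A : ι → ι → ℝ) (X : Finset κ) : ι → ι → ℝ := fun x y =>
  if c x ∈ X ∧ c y ∈ X then A x y else 0

theorem dependsOnCells_pairW_restrictA (c : ι → κ) (A : ι → ι → ℝ) (X : Finset κ) :
    DependsOnCells c X (pairW (restrictA c A X)) := by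
  intro σ τ h
  unfold pairW
  congr 1
  refine Finset.sum_congr rfl fun x _ => Finset.sum_congr rfl fun y _ => ?_
  by_cases hxy : c x ∈ X ∧ c y ∈ X
  · rw [h x hxy.1, h y hxy.2]
  · simp [restrictA, hxy]

theorem pairW_restrictA_union {c : ι → κ} {A : ι → ι → ℝ} {X₁ X₂ : Finset κ}
    (hd : Disjoint X₁ X₂) (hA : ∀ x y, c x ∈ X₁ → c y ∈ X₂ → A x y = 0 ∧ A y x = 0)
    (σ : ι → ℤˣ) : pairW (restrictA c A (X₁ ∪ X₂)) σ
      = pairW (restrictA c A X₁) σ + pairW (restrictA c A X₂) σ := by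
  unfold pairW
  rw [← mul_add, ← Finset.sum_add_distrib]
  congr 1
  refine Finset.sum_congr rfl fun x _ => ?_
  rw [← Finset.sum_add_distrib]
  refine Finset.sum_congr rfl fun y _ => ?_
  rw [← add_mul]
  congr 1
  have h1 : ∀ z, c z ∈ X₁ → c z ∉ X₂ := fun z h => Finset.disjoint_left.1 hd h
  unfold restrictA
  simp only [Finset.mem_union]
  by_cases a : c x ∈ X₁ <;> by_cases b : c y ∈ X₁ <;> by_cases a' : c x ∈ X₂ <;>
    by_cases b' : c y ∈ X₂ <;> simp_all

theorem cumulant_restrictA_union {c : ι → κ} {η : κ → ℤ} (hne : (slice c η).Nonempty)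
    {A : ι → ι → ℝ} {X₁ X₂ : Finset κ}
    (hd : Disjoint X₁ X₂) (hA : ∀ x y, c x ∈ X₁ → c y ∈ X₂ → A x y = 0 ∧ A y x = 0) (j : ℕ) :
    cumulant (slice c η) (pairW (restrictA c A (X₁ ∪ X₂))) j
      = cumulant (slice c η) (pairW (restrictA c A X₁)) j
        + cumulant (slice c η) (pairW (restrictA c A X₂)) j := by
  rw [← cumulant_add hne (dependsOnCells_pairW_restrictA c A X₁) (X := X₁)]
  · congr 1
    funext σ
    exact pairW_restrictA_union hd hA σ
  · intro σ τ h
    refine dependsOnCells_pairW_restrictA c A X₂ σ τ fun x hx => h x ?_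
    exact Finset.mem_compl.2 fun h1 => Finset.disjoint_left.1 hd h1 hx

theorem cumulant_restrictA_empty {c : ι → κ} {η : κ → ℤ} (hne : (slice c η).Nonempty)
    (A : ι → ι → ℝ) (j : ℕ) : cumulant (slice c η) (pairW (restrictA c A ∅)) j = 0 := by
  have := cumulant_restrictA_union hne (A := A) (X₁ := ∅) (X₂ := ∅) (by simp) (by simp) j
  rw [Finset.union_empty] at this
  linarith

theorem hasDegreeLE_pairW (c : ι → κ) (A : ι → ι → ℝ) (σ : ι → ℤˣ) :
    HasDegreeLE 2 fun X => pairW (restrictA c A X) σ := by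
  unfold pairW
  refine HasDegreeLE.const_mul (hasDegreeLE_sum _ fun x _ => hasDegreeLE_sum _ fun y _ => ?_) _
  have h := (hasDegreeLE_ite_subset {c x, c y} (A x y * (((σ x : ℤ) : ℝ) * ((σ y : ℤ) : ℝ)))).mono
    Finset.card_le_two
  convert h using 2 with X
  simp [restrictA, Finset.insert_subset_iff]

theorem hasDegreeLE_coeff_momentSeries (c : ι → κ) (η : κ → ℤ) (A : ι → ι → ℝ) (n : ℕ) :
    HasDegreeLE (2 * n) fun X => PowerSeries.coeff n
      (momentSeries (slice c η) (pairW (restrictA c A X))) := by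
  simp only [momentSeries, PowerSeries.coeff_mk, div_eq_inv_mul]
  exact (hasDegreeLE_sum _ fun σ _ => (hasDegreeLE_pairW c A σ).pow n).const_mul _

/-- The `j`-th cumulant of a pair interaction, as a function of the set of cells taken into
account, is a combination of terms that involve at most `2j` cells. -/
theorem hasDegreeLE_cumulant {c : ι → κ} {η : κ → ℤ} (hne : (slice c η).Nonempty)
    (A : ι → ι → ℝ) (j : ℕ) :
    HasDegreeLE (2 * j) fun X => cumulant (slice c η) (pairW (restrictA c A X)) j := by
  let M : Finset κ → PowerSeries ℝ := fun X => momentSeries (slice c η) (pairW (restrictA c A X))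
  let K : Finset κ → PowerSeries ℝ := fun X => PowerSeries.derivative ℝ (M X) * (M X)⁻¹
  have hM0 : ∀ X, PowerSeries.constantCoeff (M X) = 1 := fun X => constantCoeff_momentSeries hne _
  have hK : ∀ n, HasDegreeLE (2 * (n + 1)) fun X => PowerSeries.coeff n (K X) := by
    intro n
    induction n using Nat.strong_induction_on with
    | _ n ih =>
    have hrec : ∀ X, PowerSeries.coeff n (K X) = PowerSeries.coeff (n + 1) (M X) * (n + 1)
        - ∑ i ∈ Finset.range n, PowerSeries.coeff i (K X) * PowerSeries.coeff (n - i) (M X) := by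
      intro X
      have h1 : K X * M X = PowerSeries.derivative ℝ (M X) := by
        have := PowerSeries.inv_mul_cancel (M X) (by rw [hM0]; exact one_ne_zero)
        simp only [K]
        rw [mul_assoc, this, mul_one]
      have h2 := congrArg (PowerSeries.coeff n) h1
      rw [PowerSeries.coeff_mul, Finset.Nat.sum_antidiagonal_eq_sum_range_succ_mk,
        Finset.sum_range_succ, PowerSeries.coeff_derivative, Nat.sub_self,
        PowerSeries.coeff_zero_eq_constantCoeff_apply, hM0, mul_one] at h2
      linarith
    simp only [hrec]
    refine HasDegreeLE.sub ?_ (hasDegreeLE_sum _ fun i hi => ?_)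
    · simp only [mul_comm _ ((n : ℝ) + 1)]
      exact (hasDegreeLE_coeff_momentSeries c η A (n + 1)).const_mul _
    · have hi' := Finset.mem_range.1 hi
      exact ((ih i hi').mul (hasDegreeLE_coeff_momentSeries c η A (n - i))).mono (by omega)
  unfold cumulant logCoeff
  rcases j with _ | j
  · simp only [Nat.cast_zero, div_zero]
    exact ⟨fun _ => 0, fun _ _ => rfl, fun X => by simp⟩
  · simp only [div_eq_inv_mul, add_tsub_cancel_right]
    exact (hK j).const_mul _

/-- Cumulants are equivariant under relabelling of the sites that respects the cells. -/
theorem cumulant_equiv {c : ι → κ} {η η' : κ → ℤ} {A A' : ι → ι → ℝ} (e : Equiv.Perm ι)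
    (f : Equiv.Perm κ) (hc : ∀ x, c (e x) = f (c x)) (hη : ∀ k, η' (f k) = η k)
    (hA : ∀ x y, A' (e x) (e y) = A x y) (j : ℕ) :
    cumulant (slice c η') (pairW A') j = cumulant (slice c η) (pairW A) j := by
  have hmem : ∀ σ : ι → ℤˣ, (fun x => σ (e x)) ∈ slice c η ↔ σ ∈ slice c η' := by
    intro σ
    rw [mem_slice, mem_slice]
    refine (forall_congr' fun k => ?_).trans f.forall_congr_right
    rw [hη]
    have : ∑ x ∈ Finset.univ.filter (fun x => c x = k), ((σ (e x) : ℤˣ) : ℤ)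
        = ∑ x ∈ Finset.univ.filter (fun x => c x = f k), ((σ x : ℤˣ) : ℤ) := by
      refine Finset.sum_equiv e (fun x => ?_) fun x _ => rfl
      simp [hc]
    rw [this]
  have hW : ∀ σ : ι → ℤˣ, pairW A (fun x => σ (e x)) = pairW A' σ := by
    intro σ
    unfold pairW
    congr 1
    rw [← Equiv.sum_comp e (fun x => ∑ y, A' x y * (((σ x : ℤ) : ℝ) * ((σ y : ℤ) : ℝ)))]
    refine Finset.sum_congr rfl fun x _ => ?_
    rw [← Equiv.sum_comp e (fun y => A' (e x) y * (((σ (e x) : ℤ) : ℝ) * ((σ y : ℤ) : ℝ)))]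
    simp only [hA]
  have hsum : ∀ F : ℝ → ℝ, ∑ σ ∈ slice c η', F (pairW A' σ) = ∑ σ ∈ slice c η, F (pairW A σ) := by
    intro F
    refine Finset.sum_equiv (Equiv.arrowCongr e.symm (Equiv.refl _)) (fun σ => ?_) fun σ _ => ?_
    · exact (hmem σ).symm
    · rw [← hW]; rfl
  have hcard : (slice c η').card = (slice c η).card := by
    have := hsum fun _ => 1
    simp only [Finset.sum_const, nsmul_eq_mul, mul_one] at this
    exact_mod_cast this
  unfold cumulant
  congr 1
  ext n
  simp only [momentSeries, PowerSeries.coeff_mk, hcard]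
  rw [hsum fun t => t ^ n]

end Independence

/-! ### Geometry of the discrete torus -/

section Torus

/-- The point `k/m` of the circle. -/
def circlePt {m : ℕ} (k : Fin m) : UnitAddCircle := (((k : ℕ) : ℝ) / m : ℝ)

/-- The point `x/n` of the torus, with the Euclidean norm on differences. -/
def torusPt {d n : ℕ} (x : Site d n) : PiLp 2 (fun _ : Fin d => UnitAddCircle) :=
  WithLp.toLp 2 fun i => circlePt (x i)

theorem torusDist_eq_norm {d n : ℕ} (x y : Site d n) : torusDist x y = ‖torusPt x - torusPt y‖ := by
  rw [PiLp.norm_eq_of_L2]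
  rfl

theorem torusDist_self {d n : ℕ} (x : Site d n) : torusDist x x = 0 := by
  simp [torusDist_eq_norm]

theorem torusDist_comm {d n : ℕ} (x y : Site d n) : torusDist x y = torusDist y x := by
  rw [torusDist_eq_norm, torusDist_eq_norm, norm_sub_rev]

theorem torusDist_triangle {d n : ℕ} (x y z : Site d n) :
    torusDist x z ≤ torusDist x y + torusDist y z := by
  simp only [torusDist_eq_norm]
  exact norm_sub_le_norm_sub_add_norm_sub _ _ _

theorem torusDist_nonneg {d n : ℕ} (x y : Site d n) : 0 ≤ torusDist x y := Real.sqrt_nonneg _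

theorem coe_natCast_circle (N : ℕ) : (((N : ℕ) : ℝ) : UnitAddCircle) = 0 :=
  (AddCircle.coe_eq_zero_iff 1).2 ⟨N, by simp⟩

theorem circlePt_add {m : ℕ} (k l : Fin m) : circlePt (k + l) = circlePt k + circlePt l := by
  have hm : (m : ℝ) ≠ 0 := by
    have := k.pos
    exact_mod_cast this.ne'
  have h : (((k : ℕ) : ℝ) / m + ((l : ℕ) : ℝ) / m)
      = (((k + l : Fin m) : ℕ) : ℝ) / m + ((((k : ℕ) + (l : ℕ)) / m : ℕ) : ℝ) := by
    rw [Fin.val_add]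
    have := Nat.mod_add_div ((k : ℕ) + (l : ℕ)) m
    have h2 : ((((k : ℕ) + (l : ℕ)) % m : ℕ) : ℝ) + m * ((((k : ℕ) + (l : ℕ)) / m : ℕ) : ℝ)
        = (k : ℕ) + (l : ℕ) := by exact_mod_cast this
    field_simp
    linarith
  unfold circlePt
  rw [← AddCircle.coe_add, h, AddCircle.coe_add, coe_natCast_circle, add_zero]

theorem circlePt_sub {m : ℕ} [NeZero m] (k l : Fin m) :
    circlePt (k - l) = circlePt k - circlePt l := by
  rw [eq_sub_iff_add_eq, ← circlePt_add, sub_add_cancel]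

theorem circlePt_finProd {m q : ℕ} [NeZero m] [NeZero q] (k : Fin m) (r : Fin q) :
    circlePt (finProdFinEquiv (k, r))
      = circlePt k + (((r : ℕ) : ℝ) / (m * q) : ℝ) := by
  have hm : (m : ℝ) ≠ 0 := by exact_mod_cast NeZero.ne m
  have hq : (q : ℝ) ≠ 0 := by exact_mod_cast NeZero.ne q
  unfold circlePt
  rw [← AddCircle.coe_add, finProdFinEquiv_apply_val]
  congr 1
  push_cast
  field_simp
  ring

theorem norm_circle_le (t : ℝ) : ‖(t : UnitAddCircle)‖ ≤ |t| := by
  rw [UnitAddCircle.norm_eq]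
  simpa using round_le t 0

/-- A microscopic site is close to the corner of its cell. -/
theorem norm_torusPt_sub_cellOf_le {d m q : ℕ} [NeZero m] [NeZero q] (x : Site d (m * q)) :
    ‖torusPt x - torusPt (cellOf x)‖ ≤ Real.sqrt d / m := by
  have hm : (0 : ℝ) < m := by exact_mod_cast NeZero.pos m
  have hq : (0 : ℝ) < q := by exact_mod_cast NeZero.pos q
  have h1 : ∀ i, ‖circlePt (x i) - circlePt (cellOf x i)‖ ≤ 1 / m := by
    intro i
    have h2 : x i = finProdFinEquiv ((x i).divNat, (x i).modNat) := by
      rw [← finProdFinEquiv_symm_apply, Equiv.apply_symm_apply]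
    nth_rewrite 1 [h2]
    rw [circlePt_finProd, cellOf, add_sub_cancel_left]
    refine (norm_circle_le _).trans ?_
    rw [abs_of_nonneg (by positivity), div_le_div_iff₀ (by positivity) hm]
    have h3 : (((x i).modNat : ℕ) : ℝ) ≤ q := by exact_mod_cast (x i).modNat.2.le
    nlinarith
  rw [PiLp.norm_eq_of_L2]
  refine Real.sqrt_le_iff.2 ⟨by positivity, ?_⟩
  calc _ ≤ ∑ _i : Fin d, (1 / m : ℝ) ^ 2 :=
        Finset.sum_le_sum fun i _ => pow_le_pow_left₀ (norm_nonneg _) (h1 i) 2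
    _ = (Real.sqrt d / m) ^ 2 := by
        rw [Finset.sum_const, Finset.card_univ, Fintype.card_fin, nsmul_eq_mul, div_pow, div_pow,
          Real.sq_sqrt (Nat.cast_nonneg d)]
        ring

theorem norm_torusPt_sub_le_of_cellOf_eq {d m q : ℕ} [NeZero m] [NeZero q] {x y : Site d (m * q)}
    (h : cellOf x = cellOf y) : ‖torusPt x - torusPt y‖ ≤ 2 * (Real.sqrt d / m) := by
  have h1 := norm_torusPt_sub_cellOf_le x
  have h2 := norm_torusPt_sub_cellOf_le y
  have h3 : ‖torusPt x - torusPt y‖ ≤ ‖torusPt x - torusPt (cellOf x)‖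
      + ‖torusPt (cellOf x) - torusPt y‖ := norm_sub_le_norm_sub_add_norm_sub _ _ _
  rw [h, norm_sub_rev (torusPt (cellOf y))] at h3
  rw [h] at h1
  linarith

theorem abs_torusDist_sub_le_of_cellOf_eq {d m q : ℕ} [NeZero m] [NeZero q]
    {x x' y y' : Site d (m * q)} (hx : cellOf x = cellOf x') (hy : cellOf y = cellOf y') :
    |torusDist x y - torusDist x' y'| ≤ 4 * (Real.sqrt d / m) := by
  rw [torusDist_eq_norm, torusDist_eq_norm]
  refine (abs_norm_sub_norm_le _ _).trans ?_
  have e : torusPt x - torusPt y - (torusPt x' - torusPt y')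
      = (torusPt x - torusPt x') - (torusPt y - torusPt y') := by abel
  rw [e]
  refine (norm_sub_le _ _).trans ?_
  have h1 := norm_torusPt_sub_le_of_cellOf_eq hx
  have h2 := norm_torusPt_sub_le_of_cellOf_eq hy
  linarith

theorem torusDist_cellOf_le {d m q : ℕ} [NeZero m] [NeZero q] (x y : Site d (m * q)) :
    torusDist (cellOf x) (cellOf y) ≤ torusDist x y + 2 * (Real.sqrt d / m) := by
  rw [torusDist_eq_norm, torusDist_eq_norm]
  have h1 := norm_torusPt_sub_cellOf_le x
  have h2 := norm_torusPt_sub_cellOf_le y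
  have e : torusPt (cellOf x) - torusPt (cellOf y)
      = (torusPt x - torusPt y) - (torusPt x - torusPt (cellOf x))
        + (torusPt y - torusPt (cellOf y)) := by abel
  rw [e]
  have h3 := norm_add_le ((torusPt x - torusPt y) - (torusPt x - torusPt (cellOf x)))
    (torusPt y - torusPt (cellOf y))
  have h4 := norm_sub_le (torusPt x - torusPt y) (torusPt x - torusPt (cellOf x))
  linarith

theorem torusDist_le_cellOf {d m q : ℕ} [NeZero m] [NeZero q] (x y : Site d (m * q)) :
    torusDist x y ≤ torusDist (cellOf x) (cellOf y) + 2 * (Real.sqrt d / m) := by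
  rw [torusDist_eq_norm, torusDist_eq_norm]
  have h1 := norm_torusPt_sub_cellOf_le x
  have h2 := norm_torusPt_sub_cellOf_le y
  have e : torusPt x - torusPt y = (torusPt (cellOf x) - torusPt (cellOf y))
      + (torusPt x - torusPt (cellOf x)) - (torusPt y - torusPt (cellOf y)) := by abel
  rw [e]
  have h3 := norm_sub_le ((torusPt (cellOf x) - torusPt (cellOf y))
    + (torusPt x - torusPt (cellOf x))) (torusPt y - torusPt (cellOf y))
  have h4 := norm_add_le (torusPt (cellOf x) - torusPt (cellOf y)) (torusPt x - torusPt (cellOf x))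
  linarith

/-- The number of residues at circle distance at most `ρ/n`: the nearest representative of the
difference is an integer in `[-ρ, ρ]`. -/
theorem card_circle_ball_le {n : ℕ} (a : Fin n) {ρ : ℝ} (hρ : 0 ≤ ρ) :
    (Finset.univ.filter fun b : Fin n => n * ‖circlePt a - circlePt b‖ ≤ ρ).card
      ≤ 2 * ⌊ρ⌋₊ + 1 := by
  have hn : (0 : ℝ) < n := by exact_mod_cast a.pos
  let t : Fin n → ℤ := fun b =>
    (a : ℕ) - (b : ℕ) - n * round (((a : ℕ) : ℝ) / n - ((b : ℕ) : ℝ) / n)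
  have ht : ∀ b : Fin n, n * ‖circlePt a - circlePt b‖ = |(t b : ℝ)| := by
    intro b
    unfold circlePt
    rw [← AddCircle.coe_sub, UnitAddCircle.norm_eq]
    nth_rewrite 1 [← abs_of_pos hn]
    rw [← abs_mul]
    congr 1
    simp only [t]
    push_cast
    field_simp
  have hcard : (Finset.Icc (-(⌊ρ⌋₊ : ℤ)) ⌊ρ⌋₊).card = 2 * ⌊ρ⌋₊ + 1 := by
    rw [Int.card_Icc]; omega
  rw [← hcard]
  refine Finset.card_le_card_of_injOn t ?_ ?_
  · intro b hb
    have hb' := (Finset.mem_filter.1 hb).2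
    rw [ht] at hb'
    rw [Finset.mem_coe, Finset.mem_Icc, ← abs_le]
    have : |t b| ≤ ⌊ρ⌋ := Int.le_floor.2 (by push_cast; exact hb')
    rwa [← Int.natCast_floor_eq_floor hρ] at this
  · intro b _ b' _ hbb
    simp only [t] at hbb
    have h1 : ((b : ℕ) : ℤ) ≡ ((b' : ℕ) : ℤ) [ZMOD n] := by
      rw [Int.modEq_iff_dvd]
      refine ⟨round (((a : ℕ) : ℝ) / n - ((b : ℕ) : ℝ) / n)
        - round (((a : ℕ) : ℝ) / n - ((b' : ℕ) : ℝ) / n), ?_⟩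
      linear_combination hbb
    have h2 := Int.natCast_modEq_iff.1 h1
    exact Fin.ext (Nat.ModEq.eq_of_lt_of_lt h2 b.2 b'.2)

theorem norm_circle_le_torusDist {d n : ℕ} (x y : Site d n) (i : Fin d) :
    ‖circlePt (x i) - circlePt (y i)‖ ≤ torusDist x y := by
  refine Real.le_sqrt_of_sq_le ?_
  exact Finset.single_le_sum (f := fun i => ‖circlePt (x i) - circlePt (y i)‖ ^ 2)
    (fun _ _ => sq_nonneg _) (Finset.mem_univ i)

theorem card_torus_ball_le {d n : ℕ} (x : Site d n) {ρ : ℝ} (hρ : 0 ≤ ρ) :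
    (Finset.univ.filter fun y : Site d n => n * torusDist x y ≤ ρ).card
      ≤ (2 * ⌊ρ⌋₊ + 1) ^ d := by
  have hsub : (Finset.univ.filter fun y : Site d n => n * torusDist x y ≤ ρ)
      ⊆ Fintype.piFinset fun i => Finset.univ.filter fun b : Fin n =>
        n * ‖circlePt (x i) - circlePt b‖ ≤ ρ := by
    intro y hy
    rw [Fintype.mem_piFinset]
    intro i
    refine Finset.mem_filter.2 ⟨Finset.mem_univ _, le_trans ?_ (Finset.mem_filter.1 hy).2⟩
    exact mul_le_mul_of_nonneg_left (norm_circle_le_torusDist x y i) (Nat.cast_nonneg n)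
  refine (Finset.card_le_card hsub).trans ?_
  rw [Fintype.card_piFinset]
  refine (Finset.prod_le_prod' fun i _ => card_circle_ball_le (x i) hρ).trans ?_
  simp

theorem one_le_mul_torusDist {d n : ℕ} {x y : Site d n} (h : x ≠ y) : 1 ≤ n * torusDist x y := by
  by_contra hlt
  rw [not_le] at hlt
  have h0 : 0 ≤ n * torusDist x y := mul_nonneg (Nat.cast_nonneg n) (torusDist_nonneg x y)
  have h1 := card_torus_ball_le x h0
  rw [Nat.floor_eq_zero.2 hlt] at h1
  simp only [mul_zero, zero_add, one_pow] at h1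
  refine h (Finset.card_le_one.1 h1 x ?_ y ?_)
  · simp [torusDist_self, h0]
  · simp

end Torus

/-! ### Symmetries of the microscopic torus that respect the cells -/

section Symmetry

variable {d m q : ℕ} [NeZero m] [NeZero q]

/-- The translation of the microscopic torus by `a` coarse cells. -/
def transSite (q : ℕ) (a : Site d m) : Equiv.Perm (Site d (m * q)) :=
  Equiv.piCongrRight fun i => finProdFinEquiv.symm.trans
    ((Equiv.prodCongr (Equiv.addRight (a i)) (Equiv.refl (Fin q))).trans finProdFinEquiv)

/-- The point reflection of the microscopic torus that maps the cell `k` to the cell `b - k`. -/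
def reflSite (q : ℕ) (b : Site d m) : Equiv.Perm (Site d (m * q)) :=
  Equiv.piCongrRight fun i => finProdFinEquiv.symm.trans
    ((Equiv.prodCongr (Equiv.subLeft (b i)) (Fin.revPerm : Equiv.Perm (Fin q))).trans finProdFinEquiv)

theorem divNat_finProd (k : Fin m) (r : Fin q) : (finProdFinEquiv (k, r)).divNat = k := by
  have h := finProdFinEquiv.symm_apply_apply (k, r)
  rw [finProdFinEquiv_symm_apply] at h
  exact congrArg Prod.fst h

theorem transSite_apply (a : Site d m) (x : Site d (m * q)) (i : Fin d) :
    transSite q a x i = finProdFinEquiv ((x i).divNat + a i, (x i).modNat) := rfl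

theorem reflSite_apply (b : Site d m) (x : Site d (m * q)) (i : Fin d) :
    reflSite q b x i = finProdFinEquiv (b i - (x i).divNat, (x i).modNat.rev) := rfl

theorem cellOf_transSite (a : Site d m) (x : Site d (m * q)) :
    cellOf (transSite q a x) = Equiv.addRight a (cellOf x) := by
  funext i
  simp only [cellOf, transSite_apply, divNat_finProd]
  rfl

theorem cellOf_reflSite (b : Site d m) (x : Site d (m * q)) :
    cellOf (reflSite q b x) = Equiv.subLeft b (cellOf x) := by
  funext i
  simp only [cellOf, reflSite_apply, divNat_finProd]
  rfl

theorem circlePt_eq_divNat_add (x : Fin (m * q)) :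
    circlePt x = circlePt x.divNat + (((x.modNat : ℕ) : ℝ) / (m * q) : ℝ) := by
  have h2 : x = finProdFinEquiv (x.divNat, x.modNat) := by
    rw [← finProdFinEquiv_symm_apply, Equiv.apply_symm_apply]
  conv_lhs => rw [h2]
  rw [circlePt_finProd]

theorem torusDist_transSite (a : Site d m) (x y : Site d (m * q)) :
    torusDist (transSite q a x) (transSite q a y) = torusDist x y := by
  have h : ∀ z : Site d (m * q), ∀ i, circlePt (transSite q a z i)
      = circlePt (z i) + circlePt (a i) := by
    intro z i
    rw [transSite_apply, circlePt_finProd, circlePt_eq_divNat_add (z i), circlePt_add]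
    abel
  simp only [torusDist, AddCircle.coe_sub]
  change Real.sqrt (∑ i, ‖circlePt _ - circlePt _‖ ^ 2) = Real.sqrt (∑ i, ‖circlePt _ - circlePt _‖ ^ 2)
  simp only [h, add_sub_add_right_eq_sub]

theorem torusDist_reflSite (b : Site d m) (x y : Site d (m * q)) :
    torusDist (reflSite q b x) (reflSite q b y) = torusDist x y := by
  have h : ∀ z : Site d (m * q), ∀ i, circlePt (reflSite q b z i)
      = circlePt (b i) + (((q : ℝ) - 1) / (m * q) : ℝ) - circlePt (z i) := by
    intro z i
    rw [reflSite_apply, circlePt_finProd, circlePt_eq_divNat_add (z i), circlePt_sub]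
    have e : (((z i).modNat.rev : ℕ) : ℝ) / (m * q)
        = ((q : ℝ) - 1) / (m * q) - (((z i).modNat : ℕ) : ℝ) / (m * q) := by
      rw [Fin.val_rev, Nat.cast_sub (z i).modNat.2]
      push_cast
      ring
    rw [e, AddCircle.coe_sub]
    abel
  simp only [torusDist, AddCircle.coe_sub]
  change Real.sqrt (∑ i, ‖circlePt _ - circlePt _‖ ^ 2) = Real.sqrt (∑ i, ‖circlePt _ - circlePt _‖ ^ 2)
  simp only [h, sub_sub_sub_cancel_left]
  congr 1
  exact Finset.sum_congr rfl fun i _ => by rw [norm_sub_rev]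

variable {L : ℝ} {V : ℝ → ℝ} {e : Equiv.Perm (Site d (m * q))} {f : Equiv.Perm (Site d m)}

/-- A permutation of the sites that preserves distances and maps cells to cells. -/
structure IsCellIsometry (e : Equiv.Perm (Site d (m * q))) (f : Equiv.Perm (Site d m)) : Prop where
  cellOf_map : ∀ x, cellOf (e x) = f (cellOf x)
  dist_map : ∀ x y, torusDist (e x) (e y) = torusDist x y

theorem isCellIsometry_transSite (a : Site d m) :
    IsCellIsometry (transSite q a) (Equiv.addRight a) :=
  ⟨cellOf_transSite a, torusDist_transSite a⟩

theorem isCellIsometry_reflSite (b : Site d m) :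
    IsCellIsometry (reflSite q b) (Equiv.subLeft b) :=
  ⟨cellOf_reflSite b, torusDist_reflSite b⟩

theorem mem_cell {k : Site d m} {x : Site d (m * q)} : x ∈ cell q k ↔ cellOf x = k := by
  simp [cell]

theorem pairJ_comm (L : ℝ) (V : ℝ → ℝ) (x y : Site d (m * q)) : pairJ L V x y = pairJ L V y x := by
  rw [pairJ, pairJ, torusDist_comm]

theorem IsCellIsometry.pairJ_map (h : IsCellIsometry e f) (x y : Site d (m * q)) :
    pairJ L V (e x) (e y) = pairJ L V x y := by
  rw [pairJ, pairJ, h.dist_map]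

theorem IsCellIsometry.sum_cell (h : IsCellIsometry e f) (k : Site d m)
    (F : Site d (m * q) → ℝ) : ∑ x ∈ cell q (f k), F x = ∑ x ∈ cell q k, F (e x) := by
  symm
  refine Finset.sum_equiv e (fun x => ?_) fun x _ => rfl
  rw [mem_cell, mem_cell, h.cellOf_map, f.apply_eq_iff_eq]

theorem IsCellIsometry.sum_cell_erase (h : IsCellIsometry e f) (k : Site d m)
    (z : Site d (m * q)) (F : Site d (m * q) → ℝ) :
    ∑ x ∈ (cell q (f k)).erase (e z), F x = ∑ x ∈ (cell q k).erase z, F (e x) := by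
  symm
  refine Finset.sum_equiv e (fun x => ?_) fun x _ => rfl
  rw [Finset.mem_erase, Finset.mem_erase, mem_cell, mem_cell, h.cellOf_map, f.apply_eq_iff_eq,
    ne_eq, ne_eq, e.apply_eq_iff_eq]

theorem IsCellIsometry.avgJ_map (h : IsCellIsometry e f) (k l : Site d m) :
    avgJ L V q (f k) (f l) = avgJ L V q k l := by
  unfold avgJ
  simp only [f.apply_eq_iff_eq, h.sum_cell, h.sum_cell_erase, h.pairJ_map]

theorem IsCellIsometry.devJ_map (h : IsCellIsometry e f) (x y : Site d (m * q)) :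
    devJ L V (e x) (e y) = devJ L V x y := by
  unfold devJ
  rw [h.pairJ_map, h.cellOf_map, h.cellOf_map, h.avgJ_map]

theorem IsCellIsometry.jOne_map (h : IsCellIsometry e f) (k l : Site d m) :
    jOne L V q (f k) (f l) = jOne L V q k l := by
  unfold jOne
  simp only [h.sum_cell, h.sum_cell_erase, h.devJ_map]

theorem IsCellIsometry.jTwo_map (h : IsCellIsometry e f) (k l : Site d m) :
    jTwo L V q (f k) (f l) = jTwo L V q k l := by
  unfold jTwo
  simp only [h.sum_cell, h.sum_cell_erase, h.devJ_map]

theorem IsCellIsometry.jThree_map (h : IsCellIsometry e f) (k l j : Site d m) :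
    jThree L V q (f k) (f l) (f j) = jThree L V q k l j := by
  unfold jThree
  simp only [h.sum_cell, h.sum_cell_erase, h.devJ_map]

theorem jTwo_swap (k l : Site d m) : jTwo L V q k l = jTwo L V q l k := by
  have := (isCellIsometry_reflSite (q := q) (k + l)).jTwo_map (L := L) (V := V) k l
  simpa [Equiv.subLeft_apply] using this.symm

theorem jThree_swap (k l : Site d m) : jThree L V q k k l = jThree L V q l l k := by
  have := (isCellIsometry_reflSite (q := q) (k + l)).jThree_map (L := L) (V := V) k k l
  simpa [Equiv.subLeft_apply] using this.symm

end Symmetry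

/-! ### Row sums of the interaction fluctuations -/

section Profile

variable {V : ℝ → ℝ}

theorem gradSup_nonneg (V : ℝ → ℝ) : 0 ≤ gradSup V := Real.iSup_nonneg fun _ => abs_nonneg _

theorem abs_derivWithin_le_gradSup (hV : ContDiffOn ℝ 1 V (Set.Ici 0)) (hV1 : ∀ r, 1 ≤ r → V r = 0)
    {r : ℝ} (hr : 0 ≤ r) : |derivWithin V (Set.Ici 0) r| ≤ gradSup V := by
  have hcont : ContinuousOn (derivWithin V (Set.Ici 0)) (Set.Ici 0) :=
    hV.continuousOn_derivWithin (uniqueDiffOn_Ici 0) le_rfl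
  obtain ⟨B, hB⟩ := (isCompact_Icc (a := (0 : ℝ)) (b := 2)).exists_bound_of_continuousOn
    (hcont.mono Set.Icc_subset_Ici_self)
  have hbdd : BddAbove (Set.range fun r : Set.Ici (0 : ℝ) => |derivWithin V (Set.Ici 0) (r : ℝ)|) := by
    refine ⟨max B 0, ?_⟩
    rintro _ ⟨⟨s, hs⟩, rfl⟩
    rcases le_or_gt s 2 with h2 | h2
    · exact (hB s ⟨hs, h2⟩).trans (le_max_left _ _)
    · have hev : V =ᶠ[nhdsWithin s (Set.Ici 0)] fun _ => (0 : ℝ) := by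
        refine mem_nhdsWithin_of_mem_nhds ?_
        filter_upwards [lt_mem_nhds (show (1 : ℝ) < s by linarith)] with t ht
        exact hV1 t ht.le
      have : derivWithin V (Set.Ici 0) s = 0 := by
        rw [hev.derivWithin_eq (hV1 s (by linarith))]
        simp
      simp [this]
  exact le_ciSup hbdd ⟨r, hr⟩

theorem abs_sub_le_gradSup (hV : ContDiffOn ℝ 1 V (Set.Ici 0)) (hV1 : ∀ r, 1 ≤ r → V r = 0)
    {r s : ℝ} (hr : 0 ≤ r) (hs : 0 ≤ s) : |V r - V s| ≤ gradSup V * |r - s| :=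
  Convex.norm_image_sub_le_of_norm_derivWithin_le (hV.differentiableOn one_ne_zero)
    (fun _ hx => abs_derivWithin_le_gradSup hV hV1 hx) (convex_Ici 0) hs hr

theorem abs_le_gradSup (hV : ContDiffOn ℝ 1 V (Set.Ici 0)) (hV1 : ∀ r, 1 ≤ r → V r = 0)
    {r : ℝ} (hr : 0 ≤ r) : |V r| ≤ gradSup V := by
  rcases le_or_gt 1 r with h | h
  · rw [hV1 r h, abs_zero]; exact gradSup_nonneg V
  · have := abs_sub_le_gradSup hV hV1 hr zero_le_one
    rw [hV1 1 le_rfl, sub_zero] at this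
    refine this.trans (mul_le_of_le_one_right (gradSup_nonneg V) ?_)
    rw [abs_le]; constructor <;> linarith

end Profile

section RowSum

variable {d m q : ℕ} [NeZero m] [NeZero q] {L : ℝ} {V : ℝ → ℝ}

/-- The ordered pairs of distinct sites of the cells `k` and `l`. -/
def cellPairs (q : ℕ) (k l : Site d m) : Finset (Site d (m * q) × Site d (m * q)) :=
  (cell q k ×ˢ cell q l).filter fun P => P.1 ≠ P.2

theorem mem_cellPairs {k l : Site d m} {P : Site d (m * q) × Site d (m * q)} :
    P ∈ cellPairs q k l ↔ cellOf P.1 = k ∧ cellOf P.2 = l ∧ P.1 ≠ P.2 := by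
  simp [cellPairs, mem_cell, and_assoc]

theorem sum_cellPairs {M : Type*} [AddCommMonoid M] (k l : Site d m)
    (F : Site d (m * q) → Site d (m * q) → M) :
    ∑ P ∈ cellPairs q k l, F P.1 P.2 = ∑ x ∈ cell q k, ∑ y ∈ (cell q l).erase x, F x y := by
  rw [cellPairs, Finset.sum_filter, Finset.sum_product]
  refine Finset.sum_congr rfl fun x _ => ?_
  rw [← Finset.sum_filter]
  refine Finset.sum_congr ?_ fun _ _ => rfl
  ext y
  simp [and_comm, eq_comm]

theorem card_cell_erase (k : Site d m) (x : Site d (m * q)) :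
    ((cell q k).erase x).card = q ^ d - if cellOf x = k then 1 else 0 := by
  split_ifs with h
  · rw [Finset.card_erase_of_mem (mem_cell.2 h), card_cell]
  · rw [Finset.erase_eq_of_notMem (by rwa [mem_cell]), card_cell, Nat.sub_zero]

theorem card_cellPairs (k l : Site d m) {x : Site d (m * q)} (hx : cellOf x = k) :
    (cellPairs q k l).card = q ^ d * ((cell q l).erase x).card := by
  rw [Finset.card_eq_sum_ones, sum_cellPairs k l fun _ _ => 1]
  simp only [Finset.sum_const, smul_eq_mul, mul_one]
  have : ∀ z ∈ cell q k, ((cell q l).erase z).card = ((cell q l).erase x).card := by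
    intro z hz
    rw [card_cell_erase, card_cell_erase, mem_cell.1 hz, hx]
  rw [Finset.sum_congr rfl this, Finset.sum_const, card_cell, smul_eq_mul]

/-- `J̄(k,l)` is the mean of `J` over the pairs of distinct sites of `C_k` and `C_l`. -/
theorem avgJ_eq (k l : Site d m) : avgJ L V q k l
    = (∑ P ∈ cellPairs q k l, pairJ L V P.1 P.2) / (cellPairs q k l).card := by
  have hne : (cell q k).Nonempty := by
    rw [← Finset.card_pos, card_cell]
    exact pow_pos (NeZero.pos q) d
  obtain ⟨x, hx⟩ := hne
  rw [sum_cellPairs k l fun x y => pairJ L V x y, card_cellPairs k l (mem_cell.1 hx),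
    card_cell_erase, mem_cell.1 hx]
  unfold avgJ
  by_cases h : k = l
  · subst h
    rw [if_pos rfl, if_pos rfl]
    have : 1 ≤ q ^ d := Nat.one_le_pow _ _ (NeZero.pos q)
    push_cast [Nat.cast_sub this]
    rfl
  · rw [if_neg h, if_neg h]
    have : ∀ z ∈ cell q k, (cell q l).erase z = cell q l := by
      intro z hz
      refine Finset.erase_eq_of_notMem ?_
      rw [mem_cell, mem_cell.1 hz]
      exact h
    have e : ∑ x ∈ cell q k, ∑ y ∈ (cell q l).erase x, pairJ L V x y
        = ∑ x ∈ cell q k, ∑ y ∈ cell q l, pairJ L V x y :=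
      Finset.sum_congr rfl fun z hz => by rw [this z hz]
    rw [e, Nat.sub_zero, sq]
    push_cast
    rfl

theorem avgJ_comm (k l : Site d m) : avgJ L V q k l = avgJ L V q l k := by
  rw [avgJ_eq, avgJ_eq]
  have h : cellPairs q l k = (cellPairs q k l).map (Equiv.prodComm _ _).toEmbedding := by
    ext P
    rw [Finset.mem_map_equiv, mem_cellPairs, mem_cellPairs]
    simp only [Equiv.prodComm_symm, Equiv.prodComm_apply, Prod.fst_swap, Prod.snd_swap]
    rw [ne_comm]
    tauto
  rw [h, Finset.card_map, Finset.sum_map]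
  congr 1
  exact Finset.sum_congr rfl fun P _ => pairJ_comm _ _ _ _

theorem devJ_comm (x y : Site d (m * q)) : devJ L V x y = devJ L V y x := by
  rw [devJ, devJ, pairJ_comm, avgJ_comm]

/-- The fluctuations average to zero over each pair of cells. -/
theorem sum_devJ_cell (k l : Site d m) :
    ∑ x ∈ cell q k, ∑ y ∈ (cell q l).erase x, devJ L V x y = 0 := by
  have h : ∑ P ∈ cellPairs q k l, devJ L V P.1 P.2
      = ∑ P ∈ cellPairs q k l, (pairJ L V P.1 P.2 - avgJ L V q k l) := by
    refine Finset.sum_congr rfl fun P hP => ?_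
    obtain ⟨h1, h2, _⟩ := mem_cellPairs.1 hP
    rw [devJ, h1, h2]
  rw [← sum_cellPairs k l fun x y => devJ L V x y, h, Finset.sum_sub_distrib, Finset.sum_const,
    nsmul_eq_mul, avgJ_eq]
  rcases (cellPairs q k l).eq_empty_or_nonempty with h0 | h0
  · simp [h0]
  · have : ((cellPairs q k l).card : ℝ) ≠ 0 := by exact_mod_cast h0.card_pos.ne'
    field_simp
    ring

/-- The interaction range in units of the coarse lattice spacing. -/
def cellRange (d : ℕ) (L : ℝ) (q : ℕ) : ℝ := L / q + 2 * Real.sqrt d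

theorem cellRange_nonneg (hL : 0 < L) : 0 ≤ cellRange d L q := by
  unfold cellRange
  positivity

theorem pairJ_eq_zero (hL : 0 < L) (hV1 : ∀ r, 1 ≤ r → V r = 0) {x y : Site d (m * q)}
    (h : L ≤ ((m * q : ℕ) : ℝ) * torusDist x y) : pairJ L V x y = 0 := by
  rw [pairJ, hV1, zero_div]
  rw [div_mul_eq_mul_div, one_le_div hL]
  exact h

theorem pairJ_eq_zero_of_cell (hL : 0 < L) (hV1 : ∀ r, 1 ≤ r → V r = 0) {x y : Site d (m * q)}
    (h : cellRange d L q < m * torusDist (cellOf x) (cellOf y)) : pairJ L V x y = 0 := by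
  have hm : (0 : ℝ) < m := by exact_mod_cast NeZero.pos m
  have hq : (0 : ℝ) < q := by exact_mod_cast NeZero.pos q
  refine pairJ_eq_zero hL hV1 ?_
  have h1 := torusDist_cellOf_le x y
  have h2 : m * torusDist (cellOf x) (cellOf y) ≤ m * torusDist x y + 2 * Real.sqrt d := by
    calc _ ≤ m * (torusDist x y + 2 * (Real.sqrt d / m)) := mul_le_mul_of_nonneg_left h1 hm.le
      _ = _ := by field_simp
  unfold cellRange at h
  have h3 : L / q ≤ m * torusDist x y := by linarith
  rw [div_le_iff₀ hq] at h3
  push_cast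
  linarith

theorem avgJ_eq_zero (hL : 0 < L) (hV1 : ∀ r, 1 ≤ r → V r = 0) {k l : Site d m}
    (h : cellRange d L q < m * torusDist k l) : avgJ L V q k l = 0 := by
  rw [avgJ_eq, Finset.sum_eq_zero, zero_div]
  intro P hP
  obtain ⟨h1, h2, _⟩ := mem_cellPairs.1 hP
  exact pairJ_eq_zero_of_cell hL hV1 (by rwa [h1, h2])

theorem devJ_eq_zero (hL : 0 < L) (hV1 : ∀ r, 1 ≤ r → V r = 0) {x y : Site d (m * q)}
    (h : cellRange d L q < m * torusDist (cellOf x) (cellOf y)) : devJ L V x y = 0 := by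
  rw [devJ, pairJ_eq_zero_of_cell hL hV1 h, avgJ_eq_zero hL hV1 h, sub_zero]

variable (hL : 0 < L) (hV : ContDiffOn ℝ 1 V (Set.Ici 0)) (hV1 : ∀ r, 1 ≤ r → V r = 0)
include hL hV hV1

theorem abs_pairJ_le (x y : Site d (m * q)) : |pairJ L V x y| ≤ gradSup V / L ^ d := by
  rw [pairJ, abs_div, abs_of_pos (pow_pos hL d)]
  refine div_le_div_of_nonneg_right (abs_le_gradSup hV hV1 ?_) (pow_pos hL d).le
  exact mul_nonneg (by positivity) (torusDist_nonneg x y)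

theorem abs_pairJ_sub_le {x x' y y' : Site d (m * q)} (hx : cellOf x = cellOf x')
    (hy : cellOf y = cellOf y') :
    |pairJ L V x y - pairJ L V x' y'| ≤ 4 * Real.sqrt d * (q / L) * gradSup V / L ^ d := by
  have hm : (0 : ℝ) < m := by exact_mod_cast NeZero.pos m
  rw [pairJ, pairJ, ← sub_div, abs_div, abs_of_pos (pow_pos hL d)]
  refine div_le_div_of_nonneg_right ?_ (pow_pos hL d).le
  have hn : (0 : ℝ) ≤ ((m * q : ℕ) : ℝ) / L := by positivity
  refine (abs_sub_le_gradSup hV hV1 (mul_nonneg hn (torusDist_nonneg x y))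
    (mul_nonneg hn (torusDist_nonneg x' y'))).trans ?_
  rw [← mul_sub, abs_mul, abs_of_nonneg hn]
  have h1 := abs_torusDist_sub_le_of_cellOf_eq hx hy
  have h2 : ((m * q : ℕ) : ℝ) / L * |torusDist x y - torusDist x' y'|
      ≤ 4 * Real.sqrt d * (q / L) := by
    calc _ ≤ ((m * q : ℕ) : ℝ) / L * (4 * (Real.sqrt d / m)) := mul_le_mul_of_nonneg_left h1 hn
      _ = _ := by
        push_cast
        field_simp
  calc _ ≤ gradSup V * (4 * Real.sqrt d * (q / L)) := mul_le_mul_of_nonneg_left h2 (gradSup_nonneg V)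
    _ = _ := by ring

theorem abs_devJ_le {x y : Site d (m * q)} (hxy : x ≠ y) :
    |devJ L V x y| ≤ 4 * Real.sqrt d * (q / L) * gradSup V / L ^ d := by
  set B := 4 * Real.sqrt d * (q / L) * gradSup V / L ^ d with hB
  set S := cellPairs q (cellOf x) (cellOf y) with hS
  have hne : S.Nonempty := ⟨(x, y), mem_cellPairs.2 ⟨rfl, rfl, hxy⟩⟩
  have hc : (0 : ℝ) < S.card := by exact_mod_cast hne.card_pos
  have h1 : devJ L V x y = (∑ P ∈ S, (pairJ L V x y - pairJ L V P.1 P.2)) / S.card := by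
    rw [devJ, avgJ_eq, ← hS, Finset.sum_sub_distrib, Finset.sum_const, nsmul_eq_mul]
    field_simp
  rw [h1, abs_div, abs_of_pos hc, div_le_iff₀ hc]
  refine (Finset.abs_sum_le_sum_abs _ _).trans ?_
  rw [mul_comm B, ← nsmul_eq_mul]
  refine Finset.sum_le_card_nsmul _ _ _ fun P hP => ?_
  obtain ⟨h2, h3, _⟩ := mem_cellPairs.1 hP
  exact abs_pairJ_sub_le hL hV hV1 h2.symm h3.symm

/-- The total interaction of one site. For `L ≤ 1` distinct sites do not interact. -/
theorem sum_abs_pairJ_le (x : Site d (m * q)) :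
    ∑ y ∈ Finset.univ.erase x, |pairJ L V x y| ≤ 3 ^ d * gradSup V := by
  have hG := gradSup_nonneg V
  rcases le_or_gt L 1 with h1 | h1
  · rw [Finset.sum_eq_zero]
    · positivity
    · intro y hy
      rw [pairJ_eq_zero hL hV1, abs_zero]
      exact h1.trans (one_le_mul_torusDist (Finset.ne_of_mem_erase hy).symm)
  · have hcard := card_torus_ball_le x hL.le
    have hcard' : ((Finset.univ.filter fun y : Site d (m * q) =>
        ((m * q : ℕ) : ℝ) * torusDist x y ≤ L).card : ℝ) ≤ (3 * L) ^ d := by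
      calc _ ≤ (((2 * ⌊L⌋₊ + 1) ^ d : ℕ) : ℝ) := by exact_mod_cast hcard
        _ = (2 * (⌊L⌋₊ : ℝ) + 1) ^ d := by push_cast; rfl
        _ ≤ (3 * L) ^ d := by
          refine pow_le_pow_left₀ (by positivity) ?_ d
          have := Nat.floor_le hL.le
          linarith
    calc ∑ y ∈ Finset.univ.erase x, |pairJ L V x y| ≤ ∑ y, |pairJ L V x y| :=
          Finset.sum_le_sum_of_subset_of_nonneg (Finset.erase_subset _ _)
            fun _ _ _ => abs_nonneg _
      _ = ∑ y ∈ Finset.univ.filter (fun y : Site d (m * q) =>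
          ((m * q : ℕ) : ℝ) * torusDist x y ≤ L), |pairJ L V x y| := by
          symm
          refine Finset.sum_subset (Finset.filter_subset _ _) fun y _ hy => ?_
          rw [Finset.mem_filter, not_and] at hy
          rw [pairJ_eq_zero hL hV1 (not_le.1 (hy (Finset.mem_univ _))).le, abs_zero]
      _ ≤ (3 * L) ^ d * (gradSup V / L ^ d) := by
          refine (Finset.sum_le_card_nsmul _ _ _ fun y _ => abs_pairJ_le hL hV hV1 x y).trans ?_
          rw [nsmul_eq_mul]
          exact mul_le_mul_of_nonneg_right hcard' (by positivity)
      _ = 3 ^ d * gradSup V := by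
          rw [mul_pow]
          have := (pow_pos hL d).ne'
          field_simp

omit hL hV hV1 in
theorem sum_erase_eq_sum_cell (x : Site d (m * q)) (F : Site d (m * q) → ℝ) :
    ∑ y ∈ Finset.univ.erase x, F y = ∑ l, ∑ y ∈ (cell q l).erase x, F y := by
  rw [← Finset.sum_fiberwise (Finset.univ.erase x) cellOf]
  refine Finset.sum_congr rfl fun l _ => Finset.sum_congr ?_ fun _ _ => rfl
  ext y
  simp [mem_cell]

theorem sum_abs_avgJ_le (x : Site d (m * q)) :
    ∑ y ∈ Finset.univ.erase x, |avgJ L V q (cellOf x) (cellOf y)| ≤ 3 ^ d * gradSup V := by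
  have hQ : (0 : ℝ) < ((q ^ d : ℕ) : ℝ) := by exact_mod_cast pow_pos (NeZero.pos q) d
  set k := cellOf x with hk
  have h1 : ∀ l, ∑ y ∈ (cell q l).erase x, |avgJ L V q k (cellOf y)|
      ≤ (∑ z ∈ cell q k, ∑ y ∈ (cell q l).erase z, |pairJ L V z y|) / ((q ^ d : ℕ) : ℝ) := by
    intro l
    have h2 : ∑ y ∈ (cell q l).erase x, |avgJ L V q k (cellOf y)|
        = ((cell q l).erase x).card * |avgJ L V q k l| := by
      rw [← nsmul_eq_mul, ← Finset.sum_const]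
      refine Finset.sum_congr rfl fun y hy => ?_
      rw [mem_cell.1 (Finset.mem_of_mem_erase hy)]
    rw [h2]
    rcases Nat.eq_zero_or_pos ((cell q l).erase x).card with h0 | h0
    · rw [h0, Nat.cast_zero, zero_mul]
      exact div_nonneg (Finset.sum_nonneg fun _ _ => Finset.sum_nonneg fun _ _ => abs_nonneg _) hQ.le
    · have h0' : (0 : ℝ) < ((cell q l).erase x).card := by exact_mod_cast h0
      rw [avgJ_eq, card_cellPairs k l hk.symm, abs_div, Nat.cast_mul,
        abs_of_pos (mul_pos hQ h0'), ← sum_cellPairs k l fun z y => |pairJ L V z y|]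
      have h3 := Finset.abs_sum_le_sum_abs (fun P : _ × _ => pairJ L V P.1 P.2) (cellPairs q k l)
      rw [le_div_iff₀ hQ]
      calc _ = |∑ P ∈ cellPairs q k l, pairJ L V P.1 P.2| := by field_simp
        _ ≤ _ := h3
  rw [sum_erase_eq_sum_cell]
  refine (Finset.sum_le_sum fun l _ => h1 l).trans ?_
  rw [← Finset.sum_div, Finset.sum_comm, div_le_iff₀ hQ]
  have h4 : ∀ z ∈ cell q k, ∑ l, ∑ y ∈ (cell q l).erase z, |pairJ L V z y| ≤ 3 ^ d * gradSup V := by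
    intro z _
    rw [← sum_erase_eq_sum_cell]
    exact sum_abs_pairJ_le hL hV hV1 z
  refine (Finset.sum_le_card_nsmul _ _ _ h4).trans ?_
  rw [card_cell, nsmul_eq_mul]
  exact le_of_eq (mul_comm _ _)

/-- The constant in the row sum estimate `sum_abs_devJ_le`. The first summand serves the case
`L ≥ q`, the second one the case `L < q`. -/
def rowConst (d : ℕ) : ℝ := 4 * Real.sqrt d * (3 + 8 * Real.sqrt d) ^ d + 2 * 3 ^ d

omit hL hV hV1 in
theorem one_le_rowConst (d : ℕ) : 1 ≤ rowConst d := by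
  unfold rowConst
  have h1 : (1 : ℝ) ≤ 3 ^ d := one_le_pow₀ (by norm_num)
  have h2 : 0 ≤ 4 * Real.sqrt d * (3 + 8 * Real.sqrt d) ^ d := by positivity
  linarith

/-- Each site interacts with the others through fluctuations of total strength
`O((q/L) ‖∇V‖)`. For `L ≥ q` this follows from the regularity of `V` and the number of sites in
the interaction range; for `L < q` already the total interaction of a site is small enough. -/
theorem sum_abs_devJ_le (x : Site d (m * q)) :
    ∑ y ∈ Finset.univ.erase x, |devJ L V x y| ≤ rowConst d * (q / L * gradSup V) := by
  have hG := gradSup_nonneg V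
  have hm : (0 : ℝ) < m := by exact_mod_cast NeZero.pos m
  have hq : (0 : ℝ) < q := by exact_mod_cast NeZero.pos q
  have hq1 : (1 : ℝ) ≤ q := by exact_mod_cast NeZero.pos q
  have hd0 := Real.sqrt_nonneg (d : ℝ)
  have hqL : 0 ≤ q / L * gradSup V := by positivity
  rcases le_or_gt (q : ℝ) L with hLq | hLq
  · set ρ := L + 4 * Real.sqrt d * q with hρ
    have hρ0 : 0 ≤ ρ := by positivity
    have hcard := card_torus_ball_le x hρ0
    have hcard' : ((Finset.univ.filter fun y : Site d (m * q) =>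
        ((m * q : ℕ) : ℝ) * torusDist x y ≤ ρ).card : ℝ) ≤ ((3 + 8 * Real.sqrt d) * L) ^ d := by
      calc _ ≤ (((2 * ⌊ρ⌋₊ + 1) ^ d : ℕ) : ℝ) := by exact_mod_cast hcard
        _ = (2 * (⌊ρ⌋₊ : ℝ) + 1) ^ d := by push_cast; rfl
        _ ≤ _ := by
          refine pow_le_pow_left₀ (by positivity) ?_ d
          have h1 := Nat.floor_le hρ0
          have h2 : Real.sqrt d * q ≤ Real.sqrt d * L := mul_le_mul_of_nonneg_left hLq hd0
          rw [hρ] at h1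
          linarith
    have hzero : ∀ y, ¬ ((m * q : ℕ) : ℝ) * torusDist x y ≤ ρ → devJ L V x y = 0 := by
      intro y hy
      refine devJ_eq_zero hL hV1 ?_
      by_contra hcon
      rw [not_lt] at hcon
      refine hy ?_
      have h1 := torusDist_le_cellOf x y
      unfold cellRange at hcon
      calc ((m * q : ℕ) : ℝ) * torusDist x y
          ≤ ((m * q : ℕ) : ℝ) * (torusDist (cellOf x) (cellOf y) + 2 * (Real.sqrt d / m)) :=
            mul_le_mul_of_nonneg_left h1 (Nat.cast_nonneg _)
        _ = q * (m * torusDist (cellOf x) (cellOf y)) + 2 * Real.sqrt d * q := by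
            push_cast
            field_simp
        _ ≤ q * (L / q + 2 * Real.sqrt d) + 2 * Real.sqrt d * q := by
            have := mul_le_mul_of_nonneg_left hcon hq.le
            linarith
        _ = ρ := by
            rw [hρ]
            field_simp
            ring
    have hsum : ∑ y ∈ Finset.univ.erase x, |devJ L V x y|
        ≤ ((3 + 8 * Real.sqrt d) * L) ^ d * (4 * Real.sqrt d * (q / L) * gradSup V / L ^ d) := by
      have hB : 0 ≤ 4 * Real.sqrt d * (q / L) * gradSup V / L ^ d := by positivity
      calc ∑ y ∈ Finset.univ.erase x, |devJ L V x y|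
          = ∑ y ∈ (Finset.univ.erase x).filter (fun y : Site d (m * q) =>
            ((m * q : ℕ) : ℝ) * torusDist x y ≤ ρ), |devJ L V x y| := by
            symm
            refine Finset.sum_subset (Finset.filter_subset _ _) fun y hy hy' => ?_
            rw [hzero y fun h => hy' (Finset.mem_filter.2 ⟨hy, h⟩), abs_zero]
        _ ≤ _ := Finset.sum_le_card_nsmul _ _ _ fun y hy =>
            abs_devJ_le hL hV hV1 (Finset.ne_of_mem_erase (Finset.mem_filter.1 hy).1).symm
        _ ≤ _ := by
            rw [nsmul_eq_mul]
            refine mul_le_mul_of_nonneg_right (le_trans ?_ hcard') hB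
            exact_mod_cast Finset.card_le_card
              (Finset.filter_subset_filter _ (Finset.subset_univ _))
    refine hsum.trans ?_
    have e : ((3 + 8 * Real.sqrt d) * L) ^ d * (4 * Real.sqrt d * (q / L) * gradSup V / L ^ d)
        = (4 * Real.sqrt d * (3 + 8 * Real.sqrt d) ^ d) * (q / L * gradSup V) := by
      rw [mul_pow]
      have := (pow_pos hL d).ne'
      field_simp
    rw [e]
    refine mul_le_mul_of_nonneg_right ?_ hqL
    unfold rowConst
    have : (0 : ℝ) ≤ 2 * 3 ^ d := by positivity
    linarith
  · have h1 := sum_abs_pairJ_le hL hV hV1 x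
    have h2 := sum_abs_avgJ_le hL hV hV1 x
    have h3 : ∑ y ∈ Finset.univ.erase x, |devJ L V x y|
        ≤ ∑ y ∈ Finset.univ.erase x, |pairJ L V x y|
          + ∑ y ∈ Finset.univ.erase x, |avgJ L V q (cellOf x) (cellOf y)| := by
      rw [← Finset.sum_add_distrib]
      exact Finset.sum_le_sum fun y _ => abs_sub _ _
    have h4 : gradSup V ≤ q / L * gradSup V :=
      le_mul_of_one_le_left hG ((one_le_div hL).2 hLq.le)
    have h5 : (2 * 3 ^ d) * gradSup V ≤ (2 * 3 ^ d) * (q / L * gradSup V) :=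
      mul_le_mul_of_nonneg_left h4 (by positivity)
    have h6 : (2 * 3 ^ d : ℝ) * (q / L * gradSup V) ≤ rowConst d * (q / L * gradSup V) := by
      refine mul_le_mul_of_nonneg_right ?_ hqL
      unfold rowConst
      have : 0 ≤ 4 * Real.sqrt d * (3 + 8 * Real.sqrt d) ^ d := by positivity
      linarith
    linarith

end RowSum

/-! ### Conditional expectations given the block spins -/

section Conditional

variable {d m q : ℕ}

/-- The microscopic configurations with block spins `η`. -/
def fibre (η : CoarseConfig d m q) : Finset (MicroConfig d (m * q)) :=
  slice cellOf fun k => (η k : ℤ)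

theorem mem_fibre {η : CoarseConfig d m q} {σ : MicroConfig d (m * q)} :
    σ ∈ fibre η ↔ blockSpin σ = η := by
  rw [fibre, mem_slice]
  constructor
  · intro h
    funext k
    exact Subtype.ext (h k)
  · rintro rfl k
    rfl

theorem fibre_nonempty (η : CoarseConfig d m q) : (fibre η).Nonempty := by
  have h : ∀ k, ∃ P ⊆ cell q k, 2 * (P.card : ℤ) - ((q ^ d : ℕ) : ℤ) = (η k : ℤ) := by
    intro k
    obtain ⟨j, hj, hjη⟩ := Finset.mem_image.1 (η k).2
    have hj' : j ≤ (cell q k).card := by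
      rw [card_cell]
      exact Nat.lt_succ_iff.1 (Finset.mem_range.1 hj)
    obtain ⟨P, hP, hc⟩ := Finset.exists_subset_card_eq hj'
    exact ⟨P, hP, by rw [hc, hjη]⟩
  choose P hP hcard using h
  refine ⟨fun x => if x ∈ P (cellOf x) then 1 else -1, ?_⟩
  rw [fibre, mem_slice]
  intro k
  rw [← hcard k, ← card_cell (q := q) k]
  have h1 : ∀ x ∈ cell q k, (((if x ∈ P (cellOf x) then 1 else -1 : ℤˣ) : ℤˣ) : ℤ)
      = 2 * (if x ∈ P k then 1 else 0) - 1 := by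
    intro x hx
    rw [(Finset.mem_filter.1 hx).2]
    split_ifs <;> simp
  change ∑ x ∈ cell q k, _ = _
  rw [Finset.sum_congr rfl h1, Finset.sum_sub_distrib, ← Finset.mul_sum, Finset.sum_boole,
    Finset.filter_mem_eq_inter, Finset.inter_eq_right.2 (hP k)]
  simp

theorem spinPrior_singleton (u : ℤˣ) : spinPrior {u} = 1 / 2 := by
  rcases Int.units_eq_one_or u with rfl | rfl
  · simp [spinPrior, Set.indicator]
  · simp [spinPrior, Set.indicator]

instance : IsProbabilityMeasure spinPrior := by
  refine ⟨?_⟩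
  simp [spinPrior, ENNReal.inv_two_add_inv_two]

instance (d n : ℕ) : IsProbabilityMeasure (prior d n) := by
  unfold prior
  infer_instance

theorem prior_singleton {d n : ℕ} (σ : MicroConfig d n) :
    prior d n {σ} = (1 / 2) ^ Fintype.card (Site d n) := by
  rw [prior, Measure.pi_singleton]
  simp only [spinPrior_singleton, Finset.prod_const, Finset.card_univ]

theorem prior_finset {d n : ℕ} (S : Finset (MicroConfig d n)) :
    prior d n (S : Set (MicroConfig d n)) = S.card * (1 / 2) ^ Fintype.card (Site d n) := by
  rw [← MeasureTheory.sum_measure_singleton]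
  simp only [prior_singleton, Finset.sum_const, nsmul_eq_mul]

theorem preimage_blockSpin (η : CoarseConfig d m q) :
    (blockSpin ⁻¹' {η} : Set (MicroConfig d (m * q))) = (fibre η : Set (MicroConfig d (m * q))) := by
  ext σ
  rw [Finset.mem_coe, mem_fibre]
  rfl

/-- The conditional expectation given the block spins is a uniform average. -/
theorem condE_eq (f : MicroConfig d (m * q) → ℝ) (η : CoarseConfig d m q) :
    condE f η = sliceMean cellOf (fun k => (η k : ℤ)) f := by
  have hcard : ((fibre η).card : ℝ) ≠ 0 := by exact_mod_cast (fibre_nonempty η).card_pos.ne'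
  have hreal : ∀ σ, ((ProbabilityTheory.cond (prior d (m * q)) (blockSpin ⁻¹' {η})).real {σ})
      = if σ ∈ fibre η then ((fibre η).card : ℝ)⁻¹ else 0 := by
    intro σ
    rw [preimage_blockSpin, Measure.real, ProbabilityTheory.cond_apply (Finset.measurableSet _),
      prior_finset]
    by_cases hσ : σ ∈ fibre η
    · have h1 : (fibre η : Set (MicroConfig d (m * q))) ∩ {σ} = {σ} := by
        simpa using hσ
      rw [h1, prior_singleton, if_pos hσ]
      simp only [ENNReal.toReal_mul, ENNReal.toReal_inv, ENNReal.toReal_natCast, ENNReal.toReal_pow]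
      have : ((1 / 2 : ENNReal).toReal) ≠ 0 := by simp
      field_simp
    · have h1 : (fibre η : Set (MicroConfig d (m * q))) ∩ {σ} = ∅ := by
        simpa using hσ
      rw [h1, if_neg hσ]
      simp
  unfold condE
  rw [integral_fintype Integrable.of_finite]
  simp only [hreal, smul_eq_mul, ite_mul, zero_mul]
  rw [Finset.sum_ite_mem, Finset.univ_inter, ← Finset.mul_sum, sliceMean, div_eq_inv_mul]
  rfl

theorem condE_add (η : CoarseConfig d m q) (f g : MicroConfig d (m * q) → ℝ) :
    condE (fun σ => f σ + g σ) η = condE f η + condE g η := by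
  simp only [condE_eq, sliceMean_add]

theorem condE_const_mul (η : CoarseConfig d m q) (b : ℝ) (f : MicroConfig d (m * q) → ℝ) :
    condE (fun σ => b * f σ) η = b * condE f η := by
  simp only [condE_eq, sliceMean_const_mul]

theorem condE_sum {α : Type*} (s : Finset α) (η : CoarseConfig d m q)
    (f : α → MicroConfig d (m * q) → ℝ) :
    condE (fun σ => ∑ i ∈ s, f i σ) η = ∑ i ∈ s, condE (f i) η := by
  simp only [condE_eq, sliceMean_sum]

theorem condE_const (η : CoarseConfig d m q) (b : ℝ) :
    condE (fun _ : MicroConfig d (m * q) => b) η = b := by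
  rw [condE_eq, sliceMean_const (fibre_nonempty η)]

theorem condE_congr {η : CoarseConfig d m q} {f g : MicroConfig d (m * q) → ℝ}
    (h : ∀ σ ∈ fibre η, f σ = g σ) : condE f η = condE g η := by
  rw [condE_eq, condE_eq, sliceMean_congr_fun h]

theorem condE_mul {η : CoarseConfig d m q} {X : Finset (Site d m)}
    {f g : MicroConfig d (m * q) → ℝ} (hf : DependsOnCells cellOf X f)
    (hg : DependsOnCells cellOf Xᶜ g) :
    condE (fun σ => f σ * g σ) η = condE f η * condE g η := by
  simp only [condE_eq, sliceMean_mul (fibre_nonempty η) hf hg]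

theorem condE_swap (η : CoarseConfig d m q) (f : MicroConfig d (m * q) → ℝ)
    {x y : Site d (m * q)} (h : cellOf x = cellOf y) :
    condE (fun σ => f fun z => σ (Equiv.swap x y z)) η = condE f η := by
  simp only [condE_eq, sliceMean]
  congr 1
  refine Finset.sum_nbij' (fun σ z => σ (Equiv.swap x y z)) (fun σ z => σ (Equiv.swap x y z))
    (fun σ hσ => slice_swap hσ h) (fun σ hσ => slice_swap hσ h) ?_ ?_ fun _ _ => rfl
  · intro σ _; funext u; simp
  · intro σ _; funext u; simp

/-! ### Moments of spins within one cell -/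

theorem spin_mul_self {n : ℕ} (σ : MicroConfig d n) (x : Site d n) : spin σ x * spin σ x = 1 := by
  unfold spin
  rcases Int.units_eq_one_or (σ x) with h | h <;> simp [h]

theorem sum_spin_cell {η : CoarseConfig d m q} {σ : MicroConfig d (m * q)} (hσ : σ ∈ fibre η)
    (k : Site d m) : ∑ x ∈ cell q k, spin σ x = ((η k : ℤ) : ℝ) := by
  have := mem_slice.1 hσ k
  unfold spin
  rw [← this]
  push_cast
  rfl

/-- The mean of a product of distinct spins. -/
def prodMean (η : CoarseConfig d m q) (S : Finset (Site d (m * q))) : ℝ :=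
  condE (fun σ => ∏ x ∈ S, spin σ x) η

theorem prodMean_insert_congr (η : CoarseConfig d m q) {S : Finset (Site d (m * q))}
    {x y : Site d (m * q)} (hx : x ∉ S) (hy : y ∉ S) (h : cellOf x = cellOf y) :
    prodMean η (insert x S) = prodMean η (insert y S) := by
  unfold prodMean
  rw [← condE_swap η (fun σ => ∏ x ∈ insert y S, spin σ x) h]
  congr 1
  funext σ
  rw [Finset.prod_insert hx, Finset.prod_insert hy]
  congr 1
  · simp [spin]
  · refine Finset.prod_congr rfl fun z hz => ?_
    change ((σ z : ℤ) : ℝ) = ((σ (Equiv.swap x y z) : ℤ) : ℝ)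
    rw [Equiv.swap_apply_of_ne_of_ne]
    · rintro rfl; exact hx hz
    · rintro rfl; exact hy hz

/-- The recursion for moments of distinct spins in a cell, from
`η(k) ∏_{x ∈ S} σ(x) = ∑_{y ∈ C_k} σ(y) ∏_{x ∈ S} σ(x)`. -/
theorem prodMean_recursion (η : CoarseConfig d m q) (k : Site d m) {i : ℕ} {v v' : ℝ}
    (hv : ∀ S ⊆ cell q k, S.card = i → prodMean η S = v)
    (hv' : ∀ S ⊆ cell q k, S.card + 1 = i → prodMean η S = v')
    {S : Finset (Site d (m * q))} (hS : S ⊆ cell q k) (hc : S.card = i + 1) :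
    ((q : ℝ) ^ d - i) * prodMean η S = ((η k : ℤ) : ℝ) * v - i * v' := by
  obtain ⟨x, hx⟩ : S.Nonempty := Finset.card_pos.1 (by omega)
  set T := S.erase x with hT
  have hTc : T.card = i := by rw [hT, Finset.card_erase_of_mem hx, hc]; rfl
  have hTk : T ⊆ cell q k := (Finset.erase_subset _ _).trans hS
  have hxT : x ∉ T := Finset.notMem_erase _ _
  have hins : insert x T = S := Finset.insert_erase hx
  have h1 : ((η k : ℤ) : ℝ) * prodMean η T = ∑ y ∈ cell q k,
      condE (fun σ => spin σ y * ∏ z ∈ T, spin σ z) η := by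
    unfold prodMean
    rw [← condE_const_mul, ← condE_sum]
    refine condE_congr fun σ hσ => ?_
    rw [← sum_spin_cell hσ k, Finset.sum_mul]
  have h2 : ∑ y ∈ T, condE (fun σ => spin σ y * ∏ z ∈ T, spin σ z) η = i * v' := by
    rw [← hTc, ← nsmul_eq_mul, ← Finset.sum_const]
    refine Finset.sum_congr rfl fun y hy => ?_
    rw [← hv' (T.erase y) ((Finset.erase_subset _ _).trans hTk)
      (by rw [Finset.card_erase_of_mem hy, hTc]; have := Finset.card_pos.2 ⟨y, hy⟩; omega)]
    unfold prodMean
    congr 1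
    funext σ
    rw [← Finset.mul_prod_erase T _ hy, ← mul_assoc, spin_mul_self, one_mul]
  have h3 : ∑ y ∈ cell q k \ T, condE (fun σ => spin σ y * ∏ z ∈ T, spin σ z) η
      = ((q : ℝ) ^ d - i) * prodMean η S := by
    have hcard : ((cell q k \ T).card : ℝ) = (q : ℝ) ^ d - i := by
      rw [Finset.card_sdiff_of_subset hTk, card_cell, hTc, Nat.cast_sub]
      · push_cast; rfl
      · have := Finset.card_le_card hTk
        rwa [hTc, card_cell] at this
    rw [← hcard, ← nsmul_eq_mul, ← Finset.sum_const]
    refine Finset.sum_congr rfl fun y hy => ?_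
    obtain ⟨hy1, hy2⟩ := Finset.mem_sdiff.1 hy
    rw [← hins, prodMean_insert_congr η hxT hy2]
    · unfold prodMean
      congr 1
      funext σ
      rw [Finset.prod_insert hy2]
    · rw [(Finset.mem_filter.1 hy1).2, (Finset.mem_filter.1 (hS hx)).2]
  rw [hv T hTk hTc, ← Finset.sum_sdiff hTk, h2, h3] at h1
  linarith

theorem two_mul_alpha (η : CoarseConfig d m q) (k : Site d m) :
    ((η k : ℤ) : ℝ) = 2 * alpha η k - (q : ℝ) ^ d := by
  unfold alpha
  ring

section

variable (η : CoarseConfig d m q) (k : Site d m)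

theorem lt_card_of_subset_cell {S : Finset (Site d (m * q))} (hS : S ⊆ cell q k) {i : ℕ}
    (hc : S.card = i + 1) : 0 < (q : ℝ) ^ d - i := by
  have h := Finset.card_le_card hS
  rw [hc, card_cell] at h
  have : ((i + 1 : ℕ) : ℝ) ≤ ((q ^ d : ℕ) : ℝ) := by exact_mod_cast h
  push_cast at this
  linarith

theorem prodMean_zero {S : Finset (Site d (m * q))} (hc : S.card = 0) : prodMean η S = 1 := by
  rw [Finset.card_eq_zero] at hc
  subst hc
  simp only [prodMean, Finset.prod_empty, condE_const]

theorem prodMean_one {S : Finset (Site d (m * q))} (hS : S ⊆ cell q k) (hc : S.card = 1) :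
    prodMean η S = mom1 ((q : ℝ) ^ d) (alpha η k) := by
  have h0 := lt_card_of_subset_cell k hS (i := 0) hc
  have h := prodMean_recursion η k (i := 0) (v := 1) (v' := 0)
    (fun S _ hc => prodMean_zero η hc) (fun S _ hc => by omega) hS hc
  rw [two_mul_alpha] at h
  set Q := (q : ℝ) ^ d
  simp only [Nat.cast_zero, sub_zero] at h h0
  rw [mom1, eq_div_iff h0.ne']
  linarith

theorem prodMean_two {S : Finset (Site d (m * q))} (hS : S ⊆ cell q k) (hc : S.card = 2) :
    prodMean η S = mom2 ((q : ℝ) ^ d) (alpha η k) := by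
  have h1 := lt_card_of_subset_cell k hS (i := 1) hc
  have h := prodMean_recursion η k (i := 1) (fun S => prodMean_one η k)
    (fun S _ hc => prodMean_zero η (by omega)) hS hc
  rw [two_mul_alpha] at h
  set Q := (q : ℝ) ^ d
  simp only [Nat.cast_one] at h h1
  have h0 : Q ≠ 0 := by linarith
  have e : mom1 Q (alpha η k) * Q = 2 * alpha η k - Q := by rw [mom1]; field_simp
  simp only [mom2]
  rw [eq_div_iff (mul_ne_zero h0 h1.ne')]
  linear_combination Q * h + (2 * alpha η k - Q) * e

theorem prodMean_three {S : Finset (Site d (m * q))} (hS : S ⊆ cell q k) (hc : S.card = 3) :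
    prodMean η S = mom3 ((q : ℝ) ^ d) (alpha η k) := by
  have h2 := lt_card_of_subset_cell k hS (i := 2) hc
  have h := prodMean_recursion η k (i := 2) (fun S => prodMean_two η k)
    (fun S hS hc => prodMean_one η k hS (by omega)) hS hc
  rw [two_mul_alpha] at h
  set Q := (q : ℝ) ^ d
  simp only [Nat.cast_ofNat] at h h2
  have h0 : Q ≠ 0 := by linarith
  have h1 : Q - 1 ≠ 0 := by linarith
  have e1 : mom1 Q (alpha η k) * Q = 2 * alpha η k - Q := by rw [mom1]; field_simp
  have e2 : mom2 Q (alpha η k) * (Q * (Q - 1)) = (2 * alpha η k - Q) ^ 2 - Q := by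
    simp only [mom2]
    rw [div_mul_cancel₀ _ (mul_ne_zero h0 h1)]
    ring
  simp only [mom3]
  rw [eq_div_iff (mul_ne_zero (mul_ne_zero h0 h1) h2.ne')]
  linear_combination (Q * (Q - 1)) * h + (2 * alpha η k - Q) * e2 - 2 * (Q - 1) * e1

theorem prodMean_four {S : Finset (Site d (m * q))} (hS : S ⊆ cell q k) (hc : S.card = 4) :
    prodMean η S = mom4 ((q : ℝ) ^ d) (alpha η k) := by
  have h3 := lt_card_of_subset_cell k hS (i := 3) hc
  have h := prodMean_recursion η k (i := 3) (fun S => prodMean_three η k)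
    (fun S hS hc => prodMean_two η k hS (by omega)) hS hc
  rw [two_mul_alpha] at h
  set Q := (q : ℝ) ^ d
  simp only [Nat.cast_ofNat] at h h3
  have h0 : Q ≠ 0 := by linarith
  have h1 : Q - 1 ≠ 0 := by linarith
  have h2 : Q - 2 ≠ 0 := by linarith
  have e2 : mom2 Q (alpha η k) * (Q * (Q - 1)) = (2 * alpha η k - Q) ^ 2 - Q := by
    simp only [mom2]
    rw [div_mul_cancel₀ _ (mul_ne_zero h0 h1)]
    ring
  have e3 : mom3 Q (alpha η k) * (Q * (Q - 1) * (Q - 2))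
      = (2 * alpha η k - Q) ^ 3 - (3 * Q - 2) * (2 * alpha η k - Q) := by
    simp only [mom3]
    rw [div_mul_cancel₀ _ (mul_ne_zero (mul_ne_zero h0 h1) h2)]
    ring
  simp only [mom4]
  rw [eq_div_iff (mul_ne_zero (mul_ne_zero (mul_ne_zero h0 h1) h2) h3.ne')]
  linear_combination (Q * (Q - 1) * (Q - 2)) * h + (2 * alpha η k - Q) * e3
    - 3 * (Q - 2) * e2

end

end Conditional

/-! ### Covariances of the fluctuation energies -/

section Second

/-- Evaluation of a double sum with Kronecker symbols. -/
theorem sum_sum_mul_delta {α : Type*} [DecidableEq α] {s t : Finset α} {x y : α} (hx : x ∈ s)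
    (hy : y ∈ t) (F : α → α → ℝ) (a b c e : ℝ) :
    ∑ x' ∈ s, ∑ y' ∈ t, F x' y' * (a + b * (if x = x' then 1 else 0)
        + c * (if y = y' then 1 else 0)
        + e * ((if x = x' then 1 else 0) * (if y = y' then 1 else 0)))
      = a * ∑ x' ∈ s, ∑ y' ∈ t, F x' y' + b * ∑ y' ∈ t, F x y' + c * ∑ x' ∈ s, F x' y
        + e * F x y := by
  have h1 : ∀ (u : Finset α) (z : α), z ∈ u → ∀ G : α → ℝ,
      ∑ z' ∈ u, G z' * (if z = z' then 1 else 0) = G z := by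
    intro u z hz G
    simp only [mul_ite, mul_one, mul_zero]
    rw [Finset.sum_ite_eq, if_pos hz]
  have h2 : ∑ x' ∈ s, ∑ y' ∈ t, F x' y' * (if x = x' then 1 else 0) = ∑ y' ∈ t, F x y' := by
    simp only [← Finset.sum_mul]
    exact h1 s x hx fun x' => ∑ y' ∈ t, F x' y'
  have h3 : ∑ x' ∈ s, ∑ y' ∈ t, F x' y' * (if y = y' then 1 else 0) = ∑ x' ∈ s, F x' y :=
    Finset.sum_congr rfl fun x' _ => h1 t y hy (F x')
  have h4 : ∑ x' ∈ s, ∑ y' ∈ t, F x' y' * ((if x = x' then 1 else 0) * (if y = y' then 1 else 0))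
      = F x y := by
    have : ∀ x' ∈ s, ∑ y' ∈ t, F x' y' * ((if x = x' then 1 else 0) * (if y = y' then 1 else 0))
        = F x' y * (if x = x' then 1 else 0) := by
      intro x' _
      rw [← h1 t y hy fun y' => F x' y' * (if x = x' then 1 else 0)]
      exact Finset.sum_congr rfl fun _ _ => by ring
    rw [Finset.sum_congr rfl this]
    exact h1 s x hx fun x' => F x' y
  calc _ = ∑ x' ∈ s, ∑ y' ∈ t, (a * F x' y' + b * (F x' y' * (if x = x' then 1 else 0))
        + c * (F x' y' * (if y = y' then 1 else 0))
        + e * (F x' y' * ((if x = x' then 1 else 0) * (if y = y' then 1 else 0)))) :=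
        Finset.sum_congr rfl fun _ _ => Finset.sum_congr rfl fun _ _ => by ring
    _ = _ := by
        simp only [Finset.sum_add_distrib, ← Finset.mul_sum]
        rw [h2, h3, h4]

variable {d m q : ℕ} [NeZero m] [NeZero q] {L : ℝ} {V : ℝ → ℝ}

/-- The fluctuation `E(x,y)`, set to `0` on the diagonal. -/
def offDev (L : ℝ) (V : ℝ → ℝ) (x y : Site d (m * q)) : ℝ := if x = y then 0 else devJ L V x y

theorem offDev_comm (x y : Site d (m * q)) : offDev L V x y = offDev L V y x := by
  unfold offDev
  rw [devJ_comm (m := m) (q := q) y x]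
  by_cases h : x = y
  · rw [if_pos h, if_pos h.symm]
  · rw [if_neg h, if_neg (Ne.symm h)]

theorem offDev_self (x : Site d (m * q)) : offDev L V x x = 0 := if_pos rfl

theorem sum_cell_erase_eq (l : Site d m) (x : Site d (m * q)) (F : Site d (m * q) → ℝ) :
    ∑ y ∈ (cell q l).erase x, F y = ∑ y ∈ cell q l, if x = y then 0 else F y := by
  rw [← Finset.filter_ne, Finset.sum_filter]
  refine Finset.sum_congr rfl fun y _ => ?_
  by_cases h : x = y <;> simp [h]

theorem sum_offDev_cell (k l : Site d m) :
    ∑ x ∈ cell q k, ∑ y ∈ cell q l, offDev L V x y = 0 := by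
  refine Eq.trans ?_ (sum_devJ_cell (q := q) (L := L) (V := V) k l)
  simp only [sum_cell_erase_eq, offDev]

theorem jOne_eq (k l : Site d m) :
    jOne L V q k l = ∑ x ∈ cell q k, ∑ y ∈ cell q l, offDev L V x y * offDev L V x y := by
  unfold jOne
  refine Finset.sum_congr rfl fun x _ => ?_
  rw [sum_cell_erase_eq]
  refine Finset.sum_congr rfl fun y _ => ?_
  by_cases h : x = y <;> simp [offDev, h, sq]

theorem jTwo_eq (k l : Site d m) :
    jTwo L V q k l = ∑ x ∈ cell q k, ∑ y ∈ cell q l,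
      offDev L V x y * ∑ y' ∈ cell q l, offDev L V x y' := by
  unfold jTwo
  refine Finset.sum_congr rfl fun x _ => ?_
  rw [sum_cell_erase_eq]
  refine Finset.sum_congr rfl fun y _ => ?_
  rw [sum_cell_erase_eq, Finset.mul_sum]
  by_cases h : x = y
  · simp [offDev, h]
  · rw [if_neg h]
    refine Finset.sum_congr rfl fun y' _ => ?_
    by_cases h' : x = y' <;> simp [offDev, h, h']

theorem jThree_eq (k₁ k₂ k₃ : Site d m) :
    jThree L V q k₁ k₂ k₃ = ∑ y ∈ cell q k₂, ∑ x ∈ cell q k₁,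
      offDev L V x y * ∑ z ∈ cell q k₃, offDev L V y z := by
  unfold jThree
  refine Finset.sum_congr rfl fun y _ => ?_
  rw [sum_cell_erase_eq]
  refine Finset.sum_congr rfl fun x _ => ?_
  rw [sum_cell_erase_eq, Finset.mul_sum]
  by_cases h : x = y
  · simp [offDev, h]
  · rw [if_neg (Ne.symm h)]
    refine Finset.sum_congr rfl fun z _ => ?_
    by_cases h' : y = z <;> simp [offDev, h, h']

section Means

variable {η : CoarseConfig d m q} {k l j : Site d m}

theorem dependsOn_spin {x : Site d (m * q)} {X : Finset (Site d m)} (h : cellOf x ∈ X) :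
    DependsOnCells cellOf X fun σ => spin σ x := by
  intro σ τ hst
  simp only [spin, hst x h]

theorem DependsOnCells.mul' {X : Finset (Site d m)} {f g : MicroConfig d (m * q) → ℝ}
    (hf : DependsOnCells cellOf X f) (hg : DependsOnCells cellOf X g) :
    DependsOnCells cellOf X fun σ => f σ * g σ := fun σ τ h => by
  simp only [hf σ τ h, hg σ τ h]

theorem condE_spin {x : Site d (m * q)} (hx : x ∈ cell q k) :
    condE (fun σ => spin σ x) η = mom1 ((q : ℝ) ^ d) (alpha η k) := by
  rw [← prodMean_one η k (S := {x}) (by simpa using hx) (by simp)]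
  simp [prodMean]

theorem condE_spin_pair_of_ne {x y : Site d (m * q)} (hx : x ∈ cell q k) (hy : y ∈ cell q k)
    (h : x ≠ y) :
    condE (fun σ => spin σ x * spin σ y) η = mom2 ((q : ℝ) ^ d) (alpha η k) := by
  rw [← prodMean_two η k (S := {x, y}) (by simp [Finset.insert_subset_iff, hx, hy])
    (Finset.card_pair h)]
  simp only [prodMean, Finset.prod_pair h]

theorem condE_spin_pair {x y : Site d (m * q)} (hx : x ∈ cell q k) (hy : y ∈ cell q k) :
    condE (fun σ => spin σ x * spin σ y) η = mom2 ((q : ℝ) ^ d) (alpha η k)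
      + (1 - mom2 ((q : ℝ) ^ d) (alpha η k)) * (if x = y then 1 else 0) := by
  by_cases h : x = y
  · subst h
    simp only [spin_mul_self, condE_const, if_true]
    ring
  · rw [condE_spin_pair_of_ne hx hy h, if_neg h, mul_zero, add_zero]

theorem condE_spin_pair_cells (hkl : k ≠ l) {x y : Site d (m * q)} (hx : x ∈ cell q k)
    (hy : y ∈ cell q l) :
    condE (fun σ => spin σ x * spin σ y) η
      = mom1 ((q : ℝ) ^ d) (alpha η k) * mom1 ((q : ℝ) ^ d) (alpha η l) := by
  rw [condE_mul (X := {k}) (dependsOn_spin (by simpa using mem_cell.1 hx))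
    (dependsOn_spin (by simpa [mem_cell.1 hy] using hkl.symm)), condE_spin hx, condE_spin hy]

/-- Three spins of one cell, the first two of which are distinct. -/
theorem condE_spin_triple {x x' y : Site d (m * q)} (hx : x ∈ cell q k) (hx' : x' ∈ cell q k)
    (hy : y ∈ cell q k) (h : x ≠ x') :
    condE (fun σ => spin σ x * spin σ x' * spin σ y) η = mom3 ((q : ℝ) ^ d) (alpha η k)
      + (mom1 ((q : ℝ) ^ d) (alpha η k) - mom3 ((q : ℝ) ^ d) (alpha η k))
        * ((if x = y then 1 else 0) + (if x' = y then 1 else 0)) := by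
  by_cases h1 : x = y
  · subst h1
    have : ∀ σ : MicroConfig d (m * q), spin σ x * spin σ x' * spin σ x = spin σ x' := by
      intro σ
      linear_combination spin σ x' * spin_mul_self σ x
    simp only [this, condE_spin hx', if_neg h.symm, if_true]
    ring
  by_cases h2 : x' = y
  · subst h2
    have : ∀ σ : MicroConfig d (m * q), spin σ x * spin σ x' * spin σ x' = spin σ x := by
      intro σ
      linear_combination spin σ x * spin_mul_self σ x'
    simp only [this, condE_spin hx, if_neg h, if_true]
    ring
  rw [if_neg h1, if_neg h2, add_zero, mul_zero, add_zero,
    ← prodMean_three η k (S := {x, x', y}) (by simp [Finset.insert_subset_iff, hx, hx', hy])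
    (by rw [Finset.card_insert_of_notMem (by simp [h, h1]), Finset.card_pair h2])]
  simp only [prodMean]
  congr 1
  funext σ
  rw [Finset.prod_insert (by simp [h, h1]), Finset.prod_pair h2, mul_assoc]

/-- Two pairs of distinct spins of one cell. The Kronecker symbols account for the coincidences
between the pairs; the two brackets are grouped as required by `sum_sum_mul_delta`. -/
theorem condE_spin_quadruple {x y x' y' : Site d (m * q)} (hx : x ∈ cell q k) (hy : y ∈ cell q k)
    (hx' : x' ∈ cell q k) (hy' : y' ∈ cell q k) (h : x ≠ y) (h' : x' ≠ y') :
    condE (fun σ => (spin σ x * spin σ y) * (spin σ x' * spin σ y')) η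
      = (mom4 ((q : ℝ) ^ d) (alpha η k)
        + (mom2 ((q : ℝ) ^ d) (alpha η k) - mom4 ((q : ℝ) ^ d) (alpha η k)) * (if x = x' then 1 else 0)
        + (mom2 ((q : ℝ) ^ d) (alpha η k) - mom4 ((q : ℝ) ^ d) (alpha η k)) * (if y = y' then 1 else 0)
        + (1 - 2 * mom2 ((q : ℝ) ^ d) (alpha η k) + mom4 ((q : ℝ) ^ d) (alpha η k))
          * ((if x = x' then 1 else 0) * (if y = y' then 1 else 0)))
      + (0 + (mom2 ((q : ℝ) ^ d) (alpha η k) - mom4 ((q : ℝ) ^ d) (alpha η k))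
          * (if y = x' then 1 else 0)
        + (mom2 ((q : ℝ) ^ d) (alpha η k) - mom4 ((q : ℝ) ^ d) (alpha η k)) * (if x = y' then 1 else 0)
        + (1 - 2 * mom2 ((q : ℝ) ^ d) (alpha η k) + mom4 ((q : ℝ) ^ d) (alpha η k))
          * ((if y = x' then 1 else 0) * (if x = y' then 1 else 0))) := by
  by_cases h1 : x = x'
  · subst h1
    by_cases h2 : y = y'
    · subst h2
      have : ∀ σ : MicroConfig d (m * q), (spin σ x * spin σ y) * (spin σ x * spin σ y) = 1 := by
        intro σ
        linear_combination spin σ y * spin σ y * spin_mul_self σ x + spin_mul_self σ y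
      simp only [this, condE_const, if_neg h, if_neg h.symm, if_true]
      ring
    · have : ∀ σ : MicroConfig d (m * q), (spin σ x * spin σ y) * (spin σ x * spin σ y')
          = spin σ y * spin σ y' := by
        intro σ
        linear_combination spin σ y * spin σ y' * spin_mul_self σ x
      simp only [this, condE_spin_pair_of_ne hy hy' h2, if_neg h', if_neg h2, if_neg h.symm, if_true]
      ring
  by_cases h2 : y = y'
  · subst h2
    have : ∀ σ : MicroConfig d (m * q), (spin σ x * spin σ y) * (spin σ x' * spin σ y)
        = spin σ x * spin σ x' := by
      intro σ
      linear_combination spin σ x * spin σ x' * spin_mul_self σ y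
    simp only [this, condE_spin_pair_of_ne hx hx' h1, if_neg h1, if_neg h, if_neg h'.symm, if_true]
    ring
  by_cases h3 : y = x'
  · subst h3
    by_cases h4 : x = y'
    · subst h4
      have : ∀ σ : MicroConfig d (m * q), (spin σ x * spin σ y) * (spin σ y * spin σ x) = 1 := by
        intro σ
        linear_combination spin σ y * spin σ y * spin_mul_self σ x + spin_mul_self σ y
      simp only [this, condE_const, if_neg h1, if_neg h2, if_true]
      ring
    · have : ∀ σ : MicroConfig d (m * q), (spin σ x * spin σ y) * (spin σ y * spin σ y')
          = spin σ x * spin σ y' := by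
        intro σ
        linear_combination spin σ x * spin σ y' * spin_mul_self σ y
      simp only [this, condE_spin_pair_of_ne hx hy' h4, if_neg h1, if_neg h2, if_neg h4, if_true]
      ring
  by_cases h4 : x = y'
  · subst h4
    have : ∀ σ : MicroConfig d (m * q), (spin σ x * spin σ y) * (spin σ x' * spin σ x)
        = spin σ y * spin σ x' := by
      intro σ
      linear_combination spin σ y * spin σ x' * spin_mul_self σ x
    simp only [this, condE_spin_pair_of_ne hy hx' h3, if_neg h1, if_neg h2, if_neg h3, if_true]
    ring
  simp only [if_neg h1, if_neg h2, if_neg h3, if_neg h4, mul_zero, add_zero]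
  rw [← prodMean_four η k (S := {x, y, x', y'})
    (by simp [Finset.insert_subset_iff, hx, hy, hx', hy'])
    (by rw [Finset.card_insert_of_notMem (by simp [h, h1, h4]),
      Finset.card_insert_of_notMem (by simp [h2, h3]), Finset.card_pair h'])]
  simp only [prodMean]
  congr 1
  funext σ
  rw [Finset.prod_insert (by simp [h, h1, h4]), Finset.prod_insert (by simp [h2, h3]),
    Finset.prod_pair h']
  ring

end Means

/-- The sum of the fluctuations between the cells `k`, `l`, without the prefactor `-1/2` of an
energy. -/
def blockW (L : ℝ) (V : ℝ → ℝ) (k l : Site d m) (σ : MicroConfig d (m * q)) : ℝ :=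
  ∑ x ∈ cell q k, ∑ y ∈ cell q l, offDev L V x y * (spin σ x * spin σ y)

theorem blockW_comm (k l : Site d m) (σ : MicroConfig d (m * q)) :
    blockW L V k l σ = blockW L V l k σ := by
  unfold blockW
  rw [Finset.sum_comm]
  refine Finset.sum_congr rfl fun x _ => Finset.sum_congr rfl fun y _ => ?_
  rw [offDev_comm, mul_comm (spin σ y)]

theorem dependsOn_blockW {k l : Site d m} {X : Finset (Site d m)} (hk : k ∈ X) (hl : l ∈ X) :
    DependsOnCells cellOf X (blockW (q := q) L V k l) := by
  intro σ τ h
  unfold blockW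
  refine Finset.sum_congr rfl fun x hx => Finset.sum_congr rfl fun y hy => ?_
  rw [spin, spin, h x (by rwa [mem_cell.1 hx]), h y (by rwa [mem_cell.1 hy])]
  rfl

variable (η : CoarseConfig d m q)

/-- The pair correlation is the same for all pairs of distinct sites of the two cells, and the
fluctuations add up to zero. -/
theorem condE_blockW (k l : Site d m) : condE (blockW (q := q) L V k l) η = 0 := by
  have h : ∃ b, ∀ x ∈ cell q k, ∀ y ∈ cell q l,
      offDev L V x y * condE (fun σ => spin σ x * spin σ y) η = offDev L V x y * b := by
    by_cases hkl : k = l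
    · subst hkl
      refine ⟨mom2 ((q : ℝ) ^ d) (alpha η k), fun x hx y hy => ?_⟩
      by_cases hxy : x = y
      · subst hxy; rw [offDev_self, zero_mul, zero_mul]
      · rw [condE_spin_pair_of_ne hx hy hxy]
    · exact ⟨_, fun x hx y hy => by rw [condE_spin_pair_cells hkl hx hy]⟩
  obtain ⟨b, hb⟩ := h
  unfold blockW
  rw [condE_sum]
  simp only [condE_sum, condE_const_mul]
  rw [Finset.sum_congr rfl fun x hx => Finset.sum_congr rfl fun y hy => hb x hx y hy]
  simp only [← Finset.sum_mul]
  rw [sum_offDev_cell, zero_mul]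

theorem condE_blockW_mul (k l k' l' : Site d m) :
    condE (fun σ => blockW (q := q) L V k l σ * blockW L V k' l' σ) η
      = ∑ x ∈ cell q k, ∑ y ∈ cell q l, offDev L V x y * ∑ x' ∈ cell q k', ∑ y' ∈ cell q l',
        offDev L V x' y' * condE (fun σ => (spin σ x * spin σ y) * (spin σ x' * spin σ y')) η := by
  unfold blockW
  simp only [Finset.sum_mul]
  rw [condE_sum]
  refine Finset.sum_congr rfl fun x _ => ?_
  rw [condE_sum]
  refine Finset.sum_congr rfl fun y _ => ?_
  simp only [mul_assoc]
  rw [condE_const_mul]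
  congr 1
  simp only [Finset.mul_sum]
  rw [condE_sum]
  refine Finset.sum_congr rfl fun x' _ => ?_
  rw [condE_sum]
  refine Finset.sum_congr rfl fun y' _ => ?_
  rw [← condE_const_mul]
  congr 1
  funext σ
  ring

theorem condE_blockW_mul_of_disjoint {k l k' l' : Site d m} (h1 : k' ≠ k) (h2 : k' ≠ l)
    (h3 : l' ≠ k) (h4 : l' ≠ l) :
    condE (fun σ => blockW (q := q) L V k l σ * blockW L V k' l' σ) η = 0 := by
  rw [condE_mul (X := {k, l}) (dependsOn_blockW (by simp) (by simp))
    (dependsOn_blockW (by simp [h1, h2]) (by simp [h3, h4])), condE_blockW, zero_mul]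

/-- The covariance within one cell. In this and the following covariances, the part of the four-spin
correlation that is constant in one of the pairs drops out because the fluctuations of a pair of
cells add up to zero; only coincidences of sites contribute. -/
theorem condE_blockW_same (k : Site d m) :
    condE (fun σ => blockW (q := q) L V k k σ * blockW L V k k σ) η
      = 4 * jTwo L V q k k * (-mom4 ((q : ℝ) ^ d) (alpha η k) + mom2 ((q : ℝ) ^ d) (alpha η k))
        + 2 * jOne L V q k k * (mom4 ((q : ℝ) ^ d) (alpha η k) + 1
          - 2 * mom2 ((q : ℝ) ^ d) (alpha η k)) := by
  rw [condE_blockW_mul]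
  set M2 := mom2 ((q : ℝ) ^ d) (alpha η k) with hM2
  set M4 := mom4 ((q : ℝ) ^ d) (alpha η k) with hM4
  have hinner : ∀ x ∈ cell q k, ∀ y ∈ cell q k, offDev L V x y * ∑ x' ∈ cell q k, ∑ y' ∈ cell q k,
      offDev L V x' y' * condE (fun σ => (spin σ x * spin σ y) * (spin σ x' * spin σ y')) η
      = 2 * (M2 - M4) * (offDev L V x y * ∑ y' ∈ cell q k, offDev L V x y')
        + 2 * (M2 - M4) * (offDev L V y x * ∑ x' ∈ cell q k, offDev L V y x')
        + 2 * (1 - 2 * M2 + M4) * (offDev L V x y * offDev L V x y) := by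
    intro x hx y hy
    by_cases hxy : x = y
    · subst hxy
      simp only [offDev_self, zero_mul, mul_zero, add_zero]
    have h1 : ∀ x' ∈ cell q k, ∀ y' ∈ cell q k, offDev L V x' y'
        * condE (fun σ => (spin σ x * spin σ y) * (spin σ x' * spin σ y')) η
        = offDev L V x' y' * (M4 + (M2 - M4) * (if x = x' then 1 else 0)
          + (M2 - M4) * (if y = y' then 1 else 0)
          + (1 - 2 * M2 + M4) * ((if x = x' then 1 else 0) * (if y = y' then 1 else 0)))
        + offDev L V x' y' * (0 + (M2 - M4) * (if y = x' then 1 else 0)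
          + (M2 - M4) * (if x = y' then 1 else 0)
          + (1 - 2 * M2 + M4) * ((if y = x' then 1 else 0) * (if x = y' then 1 else 0))) := by
      intro x' hx' y' hy'
      by_cases h' : x' = y'
      · subst h'; simp only [offDev_self, zero_mul, add_zero]
      · rw [condE_spin_quadruple hx hy hx' hy' hxy h', ← mul_add]
    rw [Finset.sum_congr rfl fun x' hx' => Finset.sum_congr rfl fun y' hy' => h1 x' hx' y' hy']
    simp only [Finset.sum_add_distrib]
    rw [sum_sum_mul_delta hx hy, sum_sum_mul_delta hy hx, sum_offDev_cell]
    have hc : ∀ w, ∑ x' ∈ cell q k, offDev L V x' w = ∑ x' ∈ cell q k, offDev L V w x' :=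
      fun w => Finset.sum_congr rfl fun z _ => offDev_comm z w
    rw [hc, hc, offDev_comm y x]
    ring
  rw [Finset.sum_congr rfl fun x hx => Finset.sum_congr rfl fun y hy => hinner x hx y hy]
  simp only [Finset.sum_add_distrib]
  have h3 := jTwo_eq (q := q) (L := L) (V := V) k k
  have h2 : jTwo L V q k k = ∑ x ∈ cell q k, ∑ y ∈ cell q k,
      offDev L V y x * ∑ x' ∈ cell q k, offDev L V y x' := by
    rw [h3, Finset.sum_comm]
  have h4 := jOne_eq (q := q) (L := L) (V := V) k k
  have pull : ∀ (b : ℝ) (F : Site d (m * q) → Site d (m * q) → ℝ),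
      ∑ x ∈ cell q k, ∑ y ∈ cell q k, b * F x y = b * ∑ x ∈ cell q k, ∑ y ∈ cell q k, F x y := by
    intro b F
    simp only [Finset.mul_sum]
  rw [pull, pull, pull, ← h2, ← h3, ← h4]
  ring

theorem condE_blockW_pair {k l : Site d m} (hkl : k ≠ l) :
    condE (fun σ => blockW (q := q) L V k l σ * blockW L V k l σ) η
      = jOne L V q k l * (mom2 ((q : ℝ) ^ d) (alpha η k) * mom2 ((q : ℝ) ^ d) (alpha η l)
          - mom2 ((q : ℝ) ^ d) (alpha η l) - mom2 ((q : ℝ) ^ d) (alpha η k) + 1)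
        + jTwo L V q k l * (-2 * mom2 ((q : ℝ) ^ d) (alpha η k) * mom2 ((q : ℝ) ^ d) (alpha η l)
          + mom2 ((q : ℝ) ^ d) (alpha η k) + mom2 ((q : ℝ) ^ d) (alpha η l)) := by
  rw [condE_blockW_mul]
  set A := mom2 ((q : ℝ) ^ d) (alpha η k) with hA
  set B := mom2 ((q : ℝ) ^ d) (alpha η l) with hB
  have hinner : ∀ x ∈ cell q k, ∀ y ∈ cell q l, offDev L V x y * ∑ x' ∈ cell q k, ∑ y' ∈ cell q l,
      offDev L V x' y' * condE (fun σ => (spin σ x * spin σ y) * (spin σ x' * spin σ y')) η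
      = (1 - A) * B * (offDev L V x y * ∑ y' ∈ cell q l, offDev L V x y')
        + A * (1 - B) * (offDev L V y x * ∑ x' ∈ cell q k, offDev L V y x')
        + (1 - A) * (1 - B) * (offDev L V x y * offDev L V x y) := by
    intro x hx y hy
    have h1 : ∀ x' ∈ cell q k, ∀ y' ∈ cell q l, offDev L V x' y'
        * condE (fun σ => (spin σ x * spin σ y) * (spin σ x' * spin σ y')) η
        = offDev L V x' y' * (A * B + (1 - A) * B * (if x = x' then 1 else 0)
          + A * (1 - B) * (if y = y' then 1 else 0)
          + (1 - A) * (1 - B) * ((if x = x' then 1 else 0) * (if y = y' then 1 else 0))) := by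
      intro x' hx' y' hy'
      have e : condE (fun σ => (spin σ x * spin σ y) * (spin σ x' * spin σ y')) η
          = condE (fun σ => spin σ x * spin σ x') η * condE (fun σ => spin σ y * spin σ y') η := by
        rw [← condE_mul (X := {k})]
        · congr 1
          funext σ
          ring
        · exact (dependsOn_spin (by simpa using mem_cell.1 hx)).mul'
            (dependsOn_spin (by simpa using mem_cell.1 hx'))
        · exact (dependsOn_spin (by simpa [mem_cell.1 hy] using hkl.symm)).mul'
            (dependsOn_spin (by simpa [mem_cell.1 hy'] using hkl.symm))
      rw [e, condE_spin_pair hx hx', condE_spin_pair hy hy']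
      ring
    rw [Finset.sum_congr rfl fun x' hx' => Finset.sum_congr rfl fun y' hy' => h1 x' hx' y' hy',
      sum_sum_mul_delta hx hy, sum_offDev_cell]
    have hc : ∑ x' ∈ cell q k, offDev L V x' y = ∑ x' ∈ cell q k, offDev L V y x' :=
      Finset.sum_congr rfl fun z _ => offDev_comm z y
    rw [hc, offDev_comm y x]
    ring
  rw [Finset.sum_congr rfl fun x hx => Finset.sum_congr rfl fun y hy => hinner x hx y hy]
  simp only [Finset.sum_add_distrib]
  have h2 : jTwo L V q k l = ∑ x ∈ cell q k, ∑ y ∈ cell q l,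
      offDev L V y x * ∑ x' ∈ cell q k, offDev L V y x' := by
    rw [jTwo_swap, jTwo_eq, Finset.sum_comm]
  have h3 := jTwo_eq (q := q) (L := L) (V := V) k l
  have h4 := jOne_eq (q := q) (L := L) (V := V) k l
  have pull : ∀ (b : ℝ) (F : Site d (m * q) → Site d (m * q) → ℝ),
      ∑ x ∈ cell q k, ∑ y ∈ cell q l, b * F x y = b * ∑ x ∈ cell q k, ∑ y ∈ cell q l, F x y := by
    intro b F
    simp only [Finset.mul_sum]
  rw [pull, pull, pull, ← h2, ← h3, ← h4]
  ring

theorem condE_blockW_self_pair {k l : Site d m} (hkl : k ≠ l) :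
    condE (fun σ => blockW (q := q) L V k k σ * blockW L V k l σ) η
      = 2 * jThree L V q k k l * ((mom1 ((q : ℝ) ^ d) (alpha η k) - mom3 ((q : ℝ) ^ d) (alpha η k))
        * mom1 ((q : ℝ) ^ d) (alpha η l)) := by
  rw [condE_blockW_mul]
  set A := mom1 ((q : ℝ) ^ d) (alpha η k) with hA
  set A3 := mom3 ((q : ℝ) ^ d) (alpha η k) with hA3
  set B := mom1 ((q : ℝ) ^ d) (alpha η l) with hB
  have hinner : ∀ x ∈ cell q k, ∀ y ∈ cell q k, offDev L V x y * ∑ x' ∈ cell q k, ∑ y' ∈ cell q l,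
      offDev L V x' y' * condE (fun σ => (spin σ x * spin σ y) * (spin σ x' * spin σ y')) η
      = (A - A3) * B * (offDev L V x y * ∑ z ∈ cell q l, offDev L V y z)
        + (A - A3) * B * (offDev L V y x * ∑ z ∈ cell q l, offDev L V x z) := by
    intro x hx y hy
    by_cases hxy : x = y
    · subst hxy
      simp only [offDev_self, zero_mul, mul_zero, add_zero]
    have h1 : ∀ x' ∈ cell q k, ∀ y' ∈ cell q l, offDev L V x' y'
        * condE (fun σ => (spin σ x * spin σ y) * (spin σ x' * spin σ y')) η
        = offDev L V x' y' * (A3 * B + (A - A3) * B * (if x = x' then 1 else 0)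
          + 0 * (if y = y' then 1 else 0)
          + 0 * ((if x = x' then 1 else 0) * (if y = y' then 1 else 0)))
        + offDev L V x' y' * (0 + (A - A3) * B * (if y = x' then 1 else 0)
          + 0 * (if y = y' then 1 else 0)
          + 0 * ((if y = x' then 1 else 0) * (if y = y' then 1 else 0))) := by
      intro x' hx' y' hy'
      have e : condE (fun σ => (spin σ x * spin σ y) * (spin σ x' * spin σ y')) η
          = condE (fun σ => spin σ x * spin σ y * spin σ x') η * condE (fun σ => spin σ y') η := by
        rw [← condE_mul (X := {k})]
        · congr 1
          funext σ
          ring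
        · exact ((dependsOn_spin (by simpa using mem_cell.1 hx)).mul'
            (dependsOn_spin (by simpa using mem_cell.1 hy))).mul'
            (dependsOn_spin (by simpa using mem_cell.1 hx'))
        · exact dependsOn_spin (by simpa [mem_cell.1 hy'] using hkl.symm)
      rw [e, condE_spin_triple hx hy hx' hxy, condE_spin hy']
      ring
    rw [Finset.sum_congr rfl fun x' hx' => Finset.sum_congr rfl fun y' hy' => h1 x' hx' y' hy']
    simp only [Finset.sum_add_distrib]
    have h5 : ∀ (F : Site d (m * q) → Site d (m * q) → ℝ) (a b : ℝ), ∀ z ∈ cell q k,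
        ∑ x' ∈ cell q k, ∑ y' ∈ cell q l, F x' y' * (a + b * (if z = x' then 1 else 0)
          + 0 * (if y = y' then 1 else 0)
          + 0 * ((if z = x' then 1 else 0) * (if y = y' then 1 else 0)))
        = a * ∑ x' ∈ cell q k, ∑ y' ∈ cell q l, F x' y' + b * ∑ y' ∈ cell q l, F z y' := by
      intro F a b z hz
      obtain ⟨w, hw⟩ : (cell q l).Nonempty := by
        rw [← Finset.card_pos, card_cell]
        exact pow_pos (NeZero.pos q) d
      have := sum_sum_mul_delta hz hw F a b 0 0
      simp only [zero_mul, add_zero] at this ⊢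
      exact this
    rw [h5 _ _ _ x hx, h5 _ _ _ y hy, sum_offDev_cell, offDev_comm y x]
    ring
  rw [Finset.sum_congr rfl fun x hx => Finset.sum_congr rfl fun y hy => hinner x hx y hy]
  simp only [Finset.sum_add_distrib]
  have h2 : jThree L V q k k l = ∑ x ∈ cell q k, ∑ y ∈ cell q k,
      offDev L V y x * ∑ z ∈ cell q l, offDev L V x z := jThree_eq k k l
  have h3 : jThree L V q k k l = ∑ x ∈ cell q k, ∑ y ∈ cell q k,
      offDev L V x y * ∑ z ∈ cell q l, offDev L V y z := by
    rw [h2, Finset.sum_comm]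
  have pull : ∀ (b : ℝ) (F : Site d (m * q) → Site d (m * q) → ℝ),
      ∑ x ∈ cell q k, ∑ y ∈ cell q k, b * F x y = b * ∑ x ∈ cell q k, ∑ y ∈ cell q k, F x y := by
    intro b F
    simp only [Finset.mul_sum]
  rw [pull, pull, ← h2, ← h3]
  ring

theorem condE_blockW_triple {k l j : Site d m} (hkl : k ≠ l) (hlj : l ≠ j) (hkj : k ≠ j) :
    condE (fun σ => blockW (q := q) L V k l σ * blockW L V l j σ) η
      = jThree L V q k l j * (-mom1 ((q : ℝ) ^ d) (alpha η k) * mom2 ((q : ℝ) ^ d) (alpha η l)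
          * mom1 ((q : ℝ) ^ d) (alpha η j)
        + mom1 ((q : ℝ) ^ d) (alpha η k) * mom1 ((q : ℝ) ^ d) (alpha η j)) := by
  rw [condE_blockW_mul]
  set A := mom1 ((q : ℝ) ^ d) (alpha η k) with hA
  set M := mom2 ((q : ℝ) ^ d) (alpha η l) with hM
  set B := mom1 ((q : ℝ) ^ d) (alpha η j) with hB
  obtain ⟨w, hw⟩ : (cell q j).Nonempty := by
    rw [← Finset.card_pos, card_cell]
    exact pow_pos (NeZero.pos q) d
  have hinner : ∀ x ∈ cell q k, ∀ y ∈ cell q l, offDev L V x y * ∑ x' ∈ cell q l, ∑ y' ∈ cell q j,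
      offDev L V x' y' * condE (fun σ => (spin σ x * spin σ y) * (spin σ x' * spin σ y')) η
      = A * (1 - M) * B * (offDev L V x y * ∑ z ∈ cell q j, offDev L V y z) := by
    intro x hx y hy
    have h1 : ∀ x' ∈ cell q l, ∀ y' ∈ cell q j, offDev L V x' y'
        * condE (fun σ => (spin σ x * spin σ y) * (spin σ x' * spin σ y')) η
        = offDev L V x' y' * (A * M * B + A * (1 - M) * B * (if y = x' then 1 else 0)
          + 0 * (if w = y' then 1 else 0)
          + 0 * ((if y = x' then 1 else 0) * (if w = y' then 1 else 0))) := by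
      intro x' hx' y' hy'
      have e : condE (fun σ => (spin σ x * spin σ y) * (spin σ x' * spin σ y')) η
          = condE (fun σ => spin σ x) η * (condE (fun σ => spin σ y * spin σ x') η
            * condE (fun σ => spin σ y') η) := by
        rw [← condE_mul (X := {l}), ← condE_mul (X := {k})]
        · congr 1
          funext σ
          ring
        · exact dependsOn_spin (by simpa using mem_cell.1 hx)
        · exact ((dependsOn_spin (by simpa [mem_cell.1 hy] using hkl.symm)).mul'
            (dependsOn_spin (by simpa [mem_cell.1 hx'] using hkl.symm))).mul'
            (dependsOn_spin (by simpa [mem_cell.1 hy'] using hkj.symm))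
        · exact (dependsOn_spin (by simpa using mem_cell.1 hy)).mul'
            (dependsOn_spin (by simpa using mem_cell.1 hx'))
        · exact dependsOn_spin (by simpa [mem_cell.1 hy'] using hlj.symm)
      rw [e, condE_spin hx, condE_spin_pair hy hx', condE_spin hy']
      ring
    rw [Finset.sum_congr rfl fun x' hx' => Finset.sum_congr rfl fun y' hy' => h1 x' hx' y' hy',
      sum_sum_mul_delta hy hw, sum_offDev_cell]
    ring
  rw [Finset.sum_congr rfl fun x hx => Finset.sum_congr rfl fun y hy => hinner x hx y hy,
    jThree_eq, Finset.sum_comm]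
  simp only [Finset.mul_sum, Finset.sum_mul]
  refine Finset.sum_congr rfl fun y _ => Finset.sum_congr rfl fun x _ =>
    Finset.sum_congr rfl fun z _ => ?_
  ring

end Second

/-! ### The second cumulant as the second-order correction -/

section Combine

variable {κ : Type*} [Fintype κ] [DecidableEq κ]

theorem sum_sum_erase_comm (f : κ → κ → ℝ) :
    ∑ k, ∑ l ∈ Finset.univ.erase k, f k l = ∑ k, ∑ l ∈ Finset.univ.erase k, f l k :=
  Finset.sum_comm' fun k l => by simp [eq_comm]

theorem sum_pairs_meeting_one {g : κ → κ → ℝ} (hg : ∀ a b, g a b = g b a) (k : κ)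
    (h0 : ∀ a b, a ≠ k → b ≠ k → g a b = 0) :
    ∑ a, ∑ b, g a b = g k k + 2 * ∑ l ∈ Finset.univ.erase k, g k l := by
  rw [← Finset.add_sum_erase _ _ (Finset.mem_univ k),
    ← Finset.add_sum_erase _ (g k) (Finset.mem_univ k)]
  have : ∀ a ∈ Finset.univ.erase k, ∑ b, g a b = g k a := by
    intro a ha
    rw [hg k a]
    exact Finset.sum_eq_single k (fun b _ hb => h0 a b (Finset.ne_of_mem_erase ha) hb) (by simp)
  rw [Finset.sum_congr rfl this]
  ring

theorem sum_pairs_meeting_two {g : κ → κ → ℝ} (hg : ∀ a b, g a b = g b a) {k l : κ} (hkl : l ≠ k)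
    (h0 : ∀ a b, a ≠ k → a ≠ l → b ≠ k → b ≠ l → g a b = 0) :
    ∑ a, ∑ b, g a b = g k k + g l l + 2 * g k l
      + 2 * ∑ j ∈ (Finset.univ.erase k).erase l, (g k j + g l j) := by
  have hl : l ∈ Finset.univ.erase k := by simp [hkl]
  have split : ∀ F : κ → ℝ, ∑ a, F a = F k + (F l + ∑ j ∈ (Finset.univ.erase k).erase l, F j) := by
    intro F
    rw [Finset.add_sum_erase _ _ hl, Finset.add_sum_erase _ _ (Finset.mem_univ k)]
  have : ∀ a ∈ (Finset.univ.erase k).erase l, ∑ b, g a b = g k a + g l a := by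
    intro a ha
    have h1 : a ≠ l := Finset.ne_of_mem_erase ha
    have h2 : a ≠ k := Finset.ne_of_mem_erase (Finset.mem_of_mem_erase ha)
    rw [split, Finset.sum_eq_zero, hg a k, hg a l, add_zero]
    intro b hb
    exact h0 a b h2 h1 (Finset.ne_of_mem_erase (Finset.mem_of_mem_erase hb))
      (Finset.ne_of_mem_erase hb)
  rw [split, Finset.sum_congr rfl this, split (g k), split (g l), Finset.sum_add_distrib, hg l k]
  ring

/-- The expansion of the square of a sum of pair terms, of which those without a common index
are uncorrelated. -/
theorem sum_pairs_square {G : κ → κ → κ → κ → ℝ} (h1 : ∀ k l a b, G k l a b = G l k a b)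
    (h2 : ∀ k l a b, G k l a b = G k l b a) (h3 : ∀ k l a b, G k l a b = G a b k l)
    (h0 : ∀ k l a b, a ≠ k → a ≠ l → b ≠ k → b ≠ l → G k l a b = 0) :
    ∑ k, ∑ l, ∑ a, ∑ b, G k l a b = ∑ k, G k k k k
      + 2 * ∑ k, ∑ l ∈ Finset.univ.erase k, G k l k l
      + 4 * ∑ k, ∑ l ∈ Finset.univ.erase k, G k k k l
      + 4 * ∑ k, ∑ l ∈ Finset.univ.erase k, ∑ j ∈ (Finset.univ.erase k).erase l, G l k k j := by
  have e1 : ∀ k, ∑ a, ∑ b, G k k a b = G k k k k + 2 * ∑ l ∈ Finset.univ.erase k, G k k k l :=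
    fun k => sum_pairs_meeting_one (h2 k k) k fun a b ha hb => h0 k k a b ha ha hb hb
  have e2 : ∀ k, ∀ l ∈ Finset.univ.erase k, ∑ a, ∑ b, G k l a b
      = G k k k l + G l l l k + 2 * G k l k l
        + 2 * ∑ j ∈ (Finset.univ.erase k).erase l, (G l k k j + G k l l j) := by
    intro k l hl
    rw [sum_pairs_meeting_two (h2 k l) (Finset.ne_of_mem_erase hl) (h0 k l), h3 k l k k, h3 k l l l,
      h2 l l k l]
    simp only [h1 k l k]
  have e3 : ∑ k, ∑ l ∈ Finset.univ.erase k, ∑ j ∈ (Finset.univ.erase k).erase l, G k l l j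
      = ∑ k, ∑ l ∈ Finset.univ.erase k, ∑ j ∈ (Finset.univ.erase k).erase l, G l k k j := by
    rw [sum_sum_erase_comm]
    simp only [Finset.erase_right_comm]
  have e4 : ∑ k, ∑ l ∈ Finset.univ.erase k, G l l l k
      = ∑ k, ∑ l ∈ Finset.univ.erase k, G k k k l := sum_sum_erase_comm _
  have e5 : ∀ k, ∑ l, ∑ a, ∑ b, G k l a b = (G k k k k + 2 * ∑ l ∈ Finset.univ.erase k, G k k k l)
      + ∑ l ∈ Finset.univ.erase k, (G k k k l + G l l l k + 2 * G k l k l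
        + 2 * ∑ j ∈ (Finset.univ.erase k).erase l, (G l k k j + G k l l j)) := by
    intro k
    rw [← Finset.add_sum_erase _ _ (Finset.mem_univ k), e1, Finset.sum_congr rfl (e2 k)]
  simp only [e5, Finset.sum_add_distrib, ← Finset.mul_sum]
  rw [e3, e4]
  ring

end Combine

section Second

variable {d m q : ℕ} [NeZero m] [NeZero q] {L : ℝ} {V : ℝ → ℝ}

/-- The fluctuation part of the interaction, multiplied by the inverse temperature. -/
def devCoupling (L : ℝ) (V : ℝ → ℝ) (β : ℝ) (x y : Site d (m * q)) : ℝ := β * offDev L V x y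

theorem sum_eq_sum_cell (F : Site d (m * q) → ℝ) : ∑ x, F x = ∑ k, ∑ x ∈ cell q k, F x :=
  (Finset.sum_fiberwise Finset.univ cellOf F).symm

theorem pairW_devCoupling (β : ℝ) (σ : MicroConfig d (m * q)) :
    pairW (devCoupling L V β) σ = β / 2 * ∑ k, ∑ l, blockW L V k l σ := by
  unfold pairW blockW
  rw [sum_eq_sum_cell, Finset.mul_sum, Finset.mul_sum]
  refine Finset.sum_congr rfl fun k _ => ?_
  rw [Finset.sum_comm (s := Finset.univ) (t := cell q k), Finset.mul_sum, Finset.mul_sum]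
  refine Finset.sum_congr rfl fun x _ => ?_
  rw [sum_eq_sum_cell, Finset.mul_sum, Finset.mul_sum]
  refine Finset.sum_congr rfl fun l _ => ?_
  rw [Finset.mul_sum, Finset.mul_sum]
  refine Finset.sum_congr rfl fun y _ => ?_
  simp only [devCoupling, spin]
  ring

theorem condE_pairW_devCoupling (β : ℝ) (η : CoarseConfig d m q) :
    condE (pairW (devCoupling L V β)) η = 0 := by
  have : pairW (devCoupling L V β) = fun σ : MicroConfig d (m * q) =>
      β / 2 * ∑ k, ∑ l, blockW L V k l σ := funext fun σ => pairW_devCoupling β σ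
  rw [this, condE_const_mul]
  simp only [condE_sum, condE_blockW, Finset.sum_const_zero, mul_zero]

theorem cumulant_fibre_one {η : CoarseConfig d m q} (W : MicroConfig d (m * q) → ℝ) :
    cumulant (fibre η) W 1 = condE W η := by
  have h0 := constantCoeff_momentSeries (fibre_nonempty η) W
  have h1 := coeff_momentSeries cellOf (fun k => (η k : ℤ)) W 1
  rw [cumulant, logCoeff, condE_eq]
  simp only [Nat.sub_self, Nat.cast_one, div_one, PowerSeries.coeff_zero_eq_constantCoeff_apply,
    map_mul, PowerSeries.constantCoeff_inv, h0, inv_one, mul_one]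
  rw [← PowerSeries.coeff_zero_eq_constantCoeff_apply, PowerSeries.coeff_derivative]
  simpa [fibre] using h1

/-- The second cumulant, divided by `2!`, is half the variance. -/
theorem cumulant_fibre_two {η : CoarseConfig d m q} (W : MicroConfig d (m * q) → ℝ)
    (hW : condE W η = 0) : cumulant (fibre η) W 2 = condE (fun σ => W σ * W σ) η / 2 := by
  have h0 := constantCoeff_momentSeries (fibre_nonempty η) W
  have h1 := coeff_momentSeries cellOf (fun k => (η k : ℤ)) W 1
  have h2 := coeff_momentSeries cellOf (fun k => (η k : ℤ)) W 2
  simp only [pow_one, ← condE_eq, hW, zero_div] at h1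
  simp only [pow_two, ← condE_eq] at h2
  rw [cumulant, logCoeff]
  change PowerSeries.coeff 1 _ / _ = _
  rw [PowerSeries.coeff_mul, Finset.Nat.sum_antidiagonal_eq_sum_range_succ_mk]
  simp only [Finset.sum_range_succ, Finset.range_zero, Finset.sum_empty, zero_add, Nat.sub_zero,
    Nat.sub_self, PowerSeries.coeff_derivative, PowerSeries.coeff_zero_eq_constantCoeff_apply,
    PowerSeries.constantCoeff_inv]
  rw [h0, show PowerSeries.coeff 1 (momentSeries (fibre η) W) = 0 from h1,
    show PowerSeries.coeff (1 + 1) (momentSeries (fibre η) W) = _ from h2]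
  norm_num

/-- The second cumulant of the fluctuation energy is the second-order correction. -/
theorem cumulant_two_eq (β : ℝ) (η : CoarseConfig d m q) :
    cumulant (fibre η) (pairW (devCoupling L V β)) 2
      = -β * (coarseH1 L V β η + coarseH2 L V β η) := by
  rw [cumulant_fibre_two _ (condE_pairW_devCoupling β η)]
  set G : Site d m → Site d m → Site d m → Site d m → ℝ := fun k l a b =>
    condE (fun σ => blockW (q := q) L V k l σ * blockW L V a b σ) η with hG
  have hsq : condE (fun σ : MicroConfig d (m * q) =>
      pairW (devCoupling L V β) σ * pairW (devCoupling L V β) σ) η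
      = β ^ 2 / 4 * ∑ k, ∑ l, ∑ a, ∑ b, G k l a b := by
    simp only [hG, ← condE_sum]
    rw [← condE_const_mul]
    congr 1
    funext σ
    rw [pairW_devCoupling]
    simp only [← Finset.mul_sum, ← Finset.sum_mul]
    ring
  have h1 : ∀ k l a b, G k l a b = G l k a b := fun k l a b => by
    simp only [hG, blockW_comm k l]
  have h2 : ∀ k l a b, G k l a b = G k l b a := fun k l a b => by
    simp only [hG, blockW_comm a b]
  have h3 : ∀ k l a b, G k l a b = G a b k l := fun k l a b => by
    simp only [hG, mul_comm]
  rw [hsq, sum_pairs_square h1 h2 h3 fun k l a b ha ha' hb hb' =>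
    condE_blockW_mul_of_disjoint η ha ha' hb hb']
  have t1 : ∀ k, G k k k k = _ := fun k => condE_blockW_same η k
  have t2 : ∀ k, ∀ l ∈ Finset.univ.erase k, G k l k l = _ := fun k l hl =>
    condE_blockW_pair η (Finset.ne_of_mem_erase hl).symm
  have t3 : ∀ k, ∀ l ∈ Finset.univ.erase k, G k k k l = _ := fun k l hl =>
    condE_blockW_self_pair η (Finset.ne_of_mem_erase hl).symm
  have t4 : ∀ k, ∀ l ∈ Finset.univ.erase k, ∀ j ∈ (Finset.univ.erase k).erase l, G l k k j = _ :=
    fun k l hl j hj => condE_blockW_triple η (Finset.ne_of_mem_erase hl)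
      (Finset.ne_of_mem_erase (Finset.mem_of_mem_erase hj)).symm (Finset.ne_of_mem_erase hj).symm
  rw [Finset.sum_congr rfl fun k _ => t1 k,
    Finset.sum_congr rfl fun k _ => Finset.sum_congr rfl (t2 k),
    Finset.sum_congr rfl fun k _ => Finset.sum_congr rfl (t3 k),
    Finset.sum_congr rfl fun k _ => Finset.sum_congr rfl fun l hl =>
      Finset.sum_congr rfl (t4 k l hl)]
  -- By the reflection symmetry of `j²` the two terms with `E₃` have equal sums.
  have sym : ∑ k, ∑ l ∈ Finset.univ.erase k, 2 * jThree L V q k k l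
        * ((mom1 ((q : ℝ) ^ d) (alpha η k) - mom3 ((q : ℝ) ^ d) (alpha η k))
          * mom1 ((q : ℝ) ^ d) (alpha η l))
      = ∑ k, ∑ l ∈ Finset.univ.erase k, jThree L V q k k l
        * (-mom3 ((q : ℝ) ^ d) (alpha η k) * mom1 ((q : ℝ) ^ d) (alpha η l)
          + 2 * mom1 ((q : ℝ) ^ d) (alpha η k) * mom1 ((q : ℝ) ^ d) (alpha η l)
          - mom3 ((q : ℝ) ^ d) (alpha η l) * mom1 ((q : ℝ) ^ d) (alpha η k)) := by
    have hs := sum_sum_erase_comm fun k l => jThree L V q k k l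
      * (mom3 ((q : ℝ) ^ d) (alpha η k) * mom1 ((q : ℝ) ^ d) (alpha η l))
    have hs' : ∀ k l : Site d m, jThree L V q l l k
        * (mom3 ((q : ℝ) ^ d) (alpha η l) * mom1 ((q : ℝ) ^ d) (alpha η k))
        = jThree L V q k k l
        * (mom3 ((q : ℝ) ^ d) (alpha η l) * mom1 ((q : ℝ) ^ d) (alpha η k)) := fun k l => by
      rw [jThree_swap]
    simp only [hs'] at hs
    rw [← sub_eq_zero] at hs ⊢
    simp only [← Finset.sum_sub_distrib] at hs ⊢
    rw [← neg_eq_zero, ← hs]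
    simp only [← Finset.sum_neg_distrib]
    refine Finset.sum_congr rfl fun k _ => Finset.sum_congr rfl fun l _ => ?_
    ring
  rw [sym]
  simp only [coarseH1, coarseH2]
  ring

end Second

/-! ### The exact coarse-grained Hamiltonian -/

section Exact

variable {d m q : ℕ} [NeZero m] [NeZero q] {L : ℝ} {V : ℝ → ℝ}

/-- The energy of the cell-averaged interaction, which depends on the block spins only. The
subtracted term removes the self-interaction of the spins. -/
def meanFieldH (L : ℝ) (V : ℝ → ℝ) (h : ℝ) (η : CoarseConfig d m q) : ℝ :=
  -(1 / 2) * (∑ k, ∑ l, avgJ L V q k l * (((η k : ℤ) : ℝ) * ((η l : ℤ) : ℝ))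
    - ∑ k : Site d m, (q : ℝ) ^ d * avgJ L V q k k) + h * ∑ k, ((η k : ℤ) : ℝ)

theorem sum_avgJ_spin {η : CoarseConfig d m q} {σ : MicroConfig d (m * q)} (hσ : σ ∈ fibre η) :
    ∑ x, ∑ y, avgJ L V q (cellOf x) (cellOf y) * (spin σ x * spin σ y)
      = ∑ k, ∑ l, avgJ L V q k l * (((η k : ℤ) : ℝ) * ((η l : ℤ) : ℝ)) := by
  have h1 : ∀ x, ∑ y, avgJ L V q (cellOf x) (cellOf y) * (spin σ x * spin σ y)
      = ∑ l, avgJ L V q (cellOf x) l * (spin σ x * ((η l : ℤ) : ℝ)) := by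
    intro x
    rw [sum_eq_sum_cell]
    refine Finset.sum_congr rfl fun l _ => ?_
    rw [← sum_spin_cell hσ l, Finset.mul_sum, Finset.mul_sum]
    exact Finset.sum_congr rfl fun y hy => by rw [mem_cell.1 hy]
  simp only [h1]
  rw [sum_eq_sum_cell]
  refine Finset.sum_congr rfl fun k _ => ?_
  rw [Finset.sum_comm]
  refine Finset.sum_congr rfl fun l _ => ?_
  rw [← sum_spin_cell hσ k, Finset.sum_mul, Finset.mul_sum]
  exact Finset.sum_congr rfl fun x hx => by rw [mem_cell.1 hx]

/-- On the configurations with block spins `η` the microscopic energy is a constant plus the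
fluctuation energy. -/
theorem microH_eq {β : ℝ} (hβ : 0 < β) (h : ℝ) {η : CoarseConfig d m q}
    {σ : MicroConfig d (m * q)} (hσ : σ ∈ fibre η) :
    microH L V h σ = meanFieldH L V h η + -(1 / β) * pairW (devCoupling L V β) σ := by
  have h1 : ∀ x, ∑ y ∈ Finset.univ.erase x, pairJ L V x y * spin σ x * spin σ y
      = ∑ y, offDev L V x y * (spin σ x * spin σ y)
        + ∑ y, avgJ L V q (cellOf x) (cellOf y) * (spin σ x * spin σ y)
        - avgJ L V q (cellOf x) (cellOf x) := by
    intro x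
    rw [← Finset.add_sum_erase _ (fun y => offDev L V x y * (spin σ x * spin σ y))
      (Finset.mem_univ x), ← Finset.add_sum_erase _
      (fun y => avgJ L V q (cellOf x) (cellOf y) * (spin σ x * spin σ y)) (Finset.mem_univ x),
      offDev_self, spin_mul_self]
    have : ∀ y ∈ Finset.univ.erase x, pairJ L V x y * spin σ x * spin σ y
        = offDev L V x y * (spin σ x * spin σ y)
          + avgJ L V q (cellOf x) (cellOf y) * (spin σ x * spin σ y) := by
      intro y hy
      rw [offDev, if_neg (Finset.ne_of_mem_erase hy).symm, devJ]
      ring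
    rw [Finset.sum_congr rfl this, Finset.sum_add_distrib]
    ring
  have h2 : ∑ x : Site d (m * q), avgJ L V q (cellOf x) (cellOf x)
      = ∑ k : Site d m, (q : ℝ) ^ d * avgJ L V q k k := by
    rw [sum_eq_sum_cell]
    refine Finset.sum_congr rfl fun k _ => ?_
    rw [Finset.sum_congr rfl fun x hx => by rw [mem_cell.1 hx], Finset.sum_const, card_cell,
      nsmul_eq_mul, Nat.cast_pow]
  have h3 : ∑ x, spin σ x = ∑ k, ((η k : ℤ) : ℝ) := by
    rw [sum_eq_sum_cell]
    exact Finset.sum_congr rfl fun k _ => sum_spin_cell hσ k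
  have h4 : -(1 / β) * pairW (devCoupling L V β) σ
      = -(1 / 2) * ∑ x, ∑ y, offDev L V x y * (spin σ x * spin σ y) := by
    unfold pairW devCoupling
    simp only [mul_assoc, ← Finset.mul_sum, spin]
    field_simp
  rw [h4, microH, meanFieldH, Finset.sum_congr rfl fun x _ => h1 x, Finset.sum_sub_distrib,
    Finset.sum_add_distrib, sum_avgJ_spin hσ, h2, h3]
  ring

theorem coarseH0_eq (h : ℝ) (η : CoarseConfig d m q) : coarseH0 L V h η = meanFieldH L V h η := by
  rw [coarseH0, condE_congr fun σ hσ => microH_eq one_pos h hσ, condE_add, condE_const,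
    condE_const_mul, condE_pairW_devCoupling, mul_zero, add_zero]

/-- The deviation of the exact coarse-grained Hamiltonian from its zeroth approximation is the
logarithm of an exponential moment of the fluctuation energy. -/
theorem exactH_eq {β : ℝ} (hβ : 0 < β) (h : ℝ) (η : CoarseConfig d m q) :
    exactH L V β h η = coarseH0 L V h η - 1 / β
      * Real.log ((∑ σ ∈ fibre η, Real.exp (pairW (devCoupling L V β) σ)) / (fibre η).card) := by
  have hc : (0 : ℝ) < (fibre η).card := by exact_mod_cast (fibre_nonempty η).card_pos
  have hs : 0 < ∑ σ ∈ fibre η, Real.exp (pairW (devCoupling L V β) σ) :=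
    Finset.sum_pos (fun σ _ => Real.exp_pos _) (fibre_nonempty η)
  have h1 : condE (fun σ => Real.exp (-β * microH L V h σ)) η
      = Real.exp (-β * meanFieldH L V h η)
        * ((∑ σ ∈ fibre η, Real.exp (pairW (devCoupling L V β) σ)) / (fibre η).card) := by
    rw [condE_congr (g := fun σ => Real.exp (-β * meanFieldH L V h η)
      * Real.exp (pairW (devCoupling L V β) σ)), condE_const_mul, condE_eq]
    · rfl
    · intro σ hσ
      rw [microH_eq hβ h hσ, ← Real.exp_add]
      congr 1
      field_simp
      ring
  rw [exactH, h1, Real.log_mul (Real.exp_pos _).ne' (div_pos hs hc).ne', Real.log_exp, coarseH0_eq]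
  field_simp
  ring

theorem sum_abs_offDev_le (hL : 0 < L) (hV : ContDiffOn ℝ 1 V (Set.Ici 0))
    (hV1 : ∀ r, 1 ≤ r → V r = 0) (x : Site d (m * q)) :
    ∑ y, |offDev L V x y| ≤ rowConst d * (q / L * gradSup V) := by
  rw [← Finset.add_sum_erase _ _ (Finset.mem_univ x), offDev_self, abs_zero, zero_add]
  refine le_trans (le_of_eq ?_) (sum_abs_devJ_le hL hV hV1 x)
  exact Finset.sum_congr rfl fun y hy => by
    rw [offDev, if_neg (Finset.ne_of_mem_erase hy).symm]

theorem smallEps_nonneg {β : ℝ} (hL : 0 < L) (hβ : 0 < β) (q : ℕ) : 0 ≤ smallEps L V β q := by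
  unfold smallEps
  exact mul_nonneg (by positivity) (gradSup_nonneg V)

/-- The cumulant expansion of the exact coarse-grained Hamiltonian. -/
theorem cumulant_expansion (hL : 0 < L) (hV : ContDiffOn ℝ 1 V (Set.Ici 0))
    (hV1 : ∀ r, 1 ≤ r → V r = 0) {β : ℝ} (hβ : 0 < β) (h : ℝ) (η : CoarseConfig d m q)
    (hρ : 160 * (rowConst d * smallEps L V β q) ≤ 1) :
    (∀ j, 1 ≤ j → |cumulant (fibre η) (pairW (devCoupling L V β)) j|
      ≤ 4 * (((m * q) ^ d : ℕ) : ℝ) * (rowConst d * smallEps L V β q)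
        * (80 * (rowConst d * smallEps L V β q)) ^ (j - 1)) ∧
    HasSum (cumulant (fibre η) (pairW (devCoupling L V β)))
      (-β * (exactH L V β h η - coarseH0 L V h η)) := by
  have hrow : ∀ x : Site d (m * q), ∑ y, (|devCoupling L V β x y| + |devCoupling L V β y x|)
      ≤ 2 * (rowConst d * smallEps L V β q) := by
    intro x
    have h1 : ∀ y, |devCoupling L V β x y| + |devCoupling L V β y x|
        = 2 * β * |offDev L V x y| := by
      intro y
      rw [devCoupling, devCoupling, offDev_comm y x, abs_mul, abs_of_pos hβ]
      ring
    simp only [h1, ← Finset.mul_sum]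
    have h2 := mul_le_mul_of_nonneg_left (sum_abs_offDev_le hL hV hV1 x)
      (by positivity : 0 ≤ 2 * β)
    refine h2.trans (le_of_eq ?_)
    unfold smallEps
    ring
  have h0 : 0 ≤ rowConst d * smallEps L V β q :=
    mul_nonneg (zero_le_one.trans (one_le_rowConst d)) (smallEps_nonneg hL hβ q)
  obtain ⟨h1, h2⟩ := cumulant_slice (c := cellOf) (η := fun k => (η k : ℤ)) (fibre_nonempty η)
    (devCoupling L V β) hrow h0 hρ
  refine ⟨fun j hj => ?_, ?_⟩
  · refine (h1 j hj).trans (le_of_eq ?_)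
    simp
  · have h3 : -β * (exactH L V β h η - coarseH0 L V h η)
        = Real.log ((∑ σ ∈ fibre η, Real.exp (pairW (devCoupling L V β) σ)) / (fibre η).card) := by
      rw [exactH_eq hβ]
      field_simp
      ring
    rw [h3]
    exact h2

theorem abs_condE_le_one {η : CoarseConfig d m q} {f : MicroConfig d (m * q) → ℝ}
    (hf : ∀ σ, |f σ| ≤ 1) : |condE f η| ≤ 1 := by
  have hc : (0 : ℝ) < (fibre η).card := by exact_mod_cast (fibre_nonempty η).card_pos
  rw [condE_eq, sliceMean, ← fibre, abs_div, abs_of_pos hc, div_le_one hc]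
  refine (Finset.abs_sum_le_sum_abs _ _).trans ?_
  refine (Finset.sum_le_sum fun σ _ => hf σ).trans (le_of_eq ?_)
  simp [fibre]

theorem abs_spin {n : ℕ} (σ : MicroConfig d n) (x : Site d n) : |spin σ x| = 1 := by
  unfold spin
  rcases Int.units_eq_one_or (σ x) with h | h <;> simp [h]

theorem abs_mom1_le_one (η : CoarseConfig d m q) (k : Site d m) :
    |mom1 ((q : ℝ) ^ d) (alpha η k)| ≤ 1 := by
  obtain ⟨w, hw⟩ : (cell q k).Nonempty := by
    rw [← Finset.card_pos, card_cell]
    exact pow_pos (NeZero.pos q) d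
  rw [← condE_spin hw]
  exact abs_condE_le_one fun σ => (abs_spin σ w).le

theorem abs_mom2_le_one (η : CoarseConfig d m q) (k : Site d m) :
    |mom2 ((q : ℝ) ^ d) (alpha η k)| ≤ 1 := by
  by_cases hQ : (cell q k).card ≤ 1
  · have h1 : q ^ d = 1 := le_antisymm (by rwa [card_cell] at hQ) (pow_pos (NeZero.pos q) d)
    have h2 : (q : ℝ) ^ d = 1 := by exact_mod_cast h1
    simp [mom2, h2]
  · obtain ⟨x, hx, y, hy, hxy⟩ := Finset.one_lt_card.1 (not_le.1 hQ)
    rw [← condE_spin_pair_of_ne hx hy hxy]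
    exact abs_condE_le_one fun σ => by rw [abs_mul, abs_spin, abs_spin, mul_one]

theorem sum_abs_jThree_le (hL : 0 < L) (hV : ContDiffOn ℝ 1 V (Set.Ici 0))
    (hV1 : ∀ r, 1 ≤ r → V r = 0) :
    ∑ k₂ : Site d m, ∑ k₁, ∑ k₃, |jThree L V q k₁ k₂ k₃|
      ≤ (((m * q) ^ d : ℕ) : ℝ) * (rowConst d * (q / L * gradSup V)) ^ 2 := by
  have h1 : ∀ k₁ k₂ k₃ : Site d m, |jThree L V q k₁ k₂ k₃| ≤ ∑ y ∈ cell q k₂,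
      (∑ x ∈ cell q k₁, |offDev L V y x|) * ∑ z ∈ cell q k₃, |offDev L V y z| := by
    intro k₁ k₂ k₃
    rw [jThree_eq]
    refine (Finset.abs_sum_le_sum_abs _ _).trans (Finset.sum_le_sum fun y _ => ?_)
    rw [Finset.sum_mul]
    refine (Finset.abs_sum_le_sum_abs _ _).trans (Finset.sum_le_sum fun x _ => ?_)
    rw [abs_mul, offDev_comm x y]
    exact mul_le_mul_of_nonneg_left (Finset.abs_sum_le_sum_abs _ _) (abs_nonneg _)
  have h2 : ∀ k₂ : Site d m, ∑ k₁, ∑ k₃, |jThree L V q k₁ k₂ k₃|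
      ≤ ∑ y ∈ cell q k₂, (∑ x, |offDev L V y x|) ^ 2 := by
    intro k₂
    refine (Finset.sum_le_sum fun k₁ _ => Finset.sum_le_sum fun k₃ _ => h1 k₁ k₂ k₃).trans
      (le_of_eq ?_)
    have : ∀ k₁ : Site d m, ∑ k₃ : Site d m, ∑ y ∈ cell q k₂,
        (∑ x ∈ cell q k₁, |offDev L V y x|) * ∑ z ∈ cell q k₃, |offDev L V y z|
        = ∑ y ∈ cell q k₂, (∑ x ∈ cell q k₁, |offDev L V y x|) * ∑ x, |offDev L V y x| := by
      intro k₁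
      rw [Finset.sum_comm]
      refine Finset.sum_congr rfl fun y _ => ?_
      rw [← Finset.mul_sum, ← sum_eq_sum_cell]
    simp only [this]
    rw [Finset.sum_comm]
    refine Finset.sum_congr rfl fun y _ => ?_
    rw [← Finset.sum_mul, ← sum_eq_sum_cell, sq]
  refine (Finset.sum_le_sum fun k₂ _ => h2 k₂).trans ?_
  rw [← sum_eq_sum_cell]
  refine (Finset.sum_le_sum fun y _ => pow_le_pow_left₀ (Finset.sum_nonneg fun _ _ => abs_nonneg _)
    (sum_abs_offDev_le hL hV hV1 y) 2).trans (le_of_eq ?_)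
  simp

/-- The three-cell part of the second-order correction is of second order: a sum of products of two
fluctuations with a common site is controlled by the square of a row sum. -/
theorem abs_coarseH2_le (hL : 0 < L) (hV : ContDiffOn ℝ 1 V (Set.Ici 0))
    (hV1 : ∀ r, 1 ≤ r → V r = 0) {β : ℝ} (hβ : 0 < β) (η : CoarseConfig d m q) :
    |β * coarseH2 L V β η| ≤ (((m * q) ^ d : ℕ) : ℝ) * (rowConst d * smallEps L V β q) ^ 2 := by
  have h1 : ∀ k₁ k₂ k₃ : Site d m, |jThree L V q k₁ k₂ k₃
      * (-mom1 ((q : ℝ) ^ d) (alpha η k₁) * mom2 ((q : ℝ) ^ d) (alpha η k₂)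
          * mom1 ((q : ℝ) ^ d) (alpha η k₃)
        + mom1 ((q : ℝ) ^ d) (alpha η k₁) * mom1 ((q : ℝ) ^ d) (alpha η k₃))|
      ≤ 2 * |jThree L V q k₁ k₂ k₃| := by
    intro k₁ k₂ k₃
    rw [abs_mul, mul_comm]
    refine mul_le_mul_of_nonneg_right ?_ (abs_nonneg _)
    have a1 := abs_mom1_le_one η k₁
    have a2 := abs_mom2_le_one η k₂
    have a3 := abs_mom1_le_one η k₃
    refine (abs_add_le _ _).trans ?_
    simp only [abs_mul, abs_neg]
    have b1 : |mom1 ((q : ℝ) ^ d) (alpha η k₁)| * |mom1 ((q : ℝ) ^ d) (alpha η k₃)| ≤ 1 :=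
      mul_le_one₀ a1 (abs_nonneg _) a3
    have b2 := mul_le_one₀ (mul_le_one₀ a1 (abs_nonneg _) a2) (abs_nonneg _) a3
    linarith
  have h2 : |∑ k₂ : Site d m, ∑ k₁ ∈ Finset.univ.erase k₂, ∑ k₃ ∈ (Finset.univ.erase k₂).erase k₁,
      jThree L V q k₁ k₂ k₃
      * (-mom1 ((q : ℝ) ^ d) (alpha η k₁) * mom2 ((q : ℝ) ^ d) (alpha η k₂)
          * mom1 ((q : ℝ) ^ d) (alpha η k₃)
        + mom1 ((q : ℝ) ^ d) (alpha η k₁) * mom1 ((q : ℝ) ^ d) (alpha η k₃))|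
      ≤ ∑ k₂ : Site d m, ∑ k₁, ∑ k₃, 2 * |jThree L V q k₁ k₂ k₃| := by
    refine (Finset.abs_sum_le_sum_abs _ _).trans (Finset.sum_le_sum fun k₂ _ => ?_)
    refine (Finset.abs_sum_le_sum_abs _ _).trans ?_
    refine (Finset.sum_le_sum fun k₁ _ => ?_).trans
      (Finset.sum_le_sum_of_subset_of_nonneg (Finset.subset_univ _)
        fun k₁ _ _ => Finset.sum_nonneg fun k₃ _ => by positivity)
    refine (Finset.abs_sum_le_sum_abs _ _).trans ?_
    exact (Finset.sum_le_sum fun k₃ _ => h1 k₁ k₂ k₃).trans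
      (Finset.sum_le_sum_of_subset_of_nonneg (Finset.subset_univ _)
        fun k₃ _ _ => by positivity)
  have h3 := sum_abs_jThree_le (m := m) (q := q) (d := d) hL hV hV1
  simp only [← Finset.mul_sum] at h2
  simp only [coarseH2]
  rw [show ∀ S : ℝ, β * -(β * (1 / 2 * S)) = -(β ^ 2 / 2 * S) from fun S => by ring, abs_neg, abs_mul,
    abs_of_nonneg (by positivity : 0 ≤ β ^ 2 / 2)]
  refine (mul_le_mul_of_nonneg_left (h2.trans (mul_le_mul_of_nonneg_left h3 zero_le_two))
    (by positivity)).trans (le_of_eq ?_)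
  unfold smallEps
  ring

end Exact

/-! ### Relative entropy -/

section Entropy

variable {α : Type*} [Finite α] [MeasurableSpace α] [MeasurableSingletonClass α]

/-- The relative entropy of a measure tilted by a bounded function. -/
theorem klDiv_tilted_self_le (ν : Measure α) [IsProbabilityMeasure ν] {f : α → ℝ} {c : ℝ}
    (hf : ∀ x, |f x| ≤ c) :
    InformationTheory.klDiv (ν.tilted f) ν ≤ ENNReal.ofReal (2 * c) := by
  have hint : ∀ g : α → ℝ, Integrable g ν := fun g => Integrable.of_finite
  have : IsProbabilityMeasure (ν.tilted f) := isProbabilityMeasure_tilted (hint _)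
  have hac : ν.tilted f ≪ ν := tilted_absolutelyContinuous ν f
  have hi : Integrable (llr (ν.tilted f) ν) (ν.tilted f) := Integrable.of_finite
  rw [InformationTheory.klDiv_of_ac_of_integrable hac hi]
  refine ENNReal.ofReal_le_ofReal ?_
  simp only [probReal_univ, add_sub_cancel_right]
  have hZ : -c ≤ Real.log (∫ x, Real.exp (f x) ∂ν) := by
    rw [Real.le_log_iff_exp_le (integral_exp_pos (hint _))]
    have h1 : ∫ _, Real.exp (-c) ∂ν ≤ ∫ x, Real.exp (f x) ∂ν :=
      integral_mono (hint _) (hint _) fun x => Real.exp_le_exp.2 (neg_le_of_abs_le (hf x))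
    simpa using h1
  have hll : llr (ν.tilted f) ν =ᵐ[ν.tilted f]
      fun x => f x - Real.log (∫ x, Real.exp (f x) ∂ν) :=
    hac.ae_le (log_rnDeriv_tilted_left_self (hint _))
  rw [integral_congr_ae hll]
  have h2 : ∫ x, (f x - Real.log (∫ x, Real.exp (f x) ∂ν)) ∂(ν.tilted f)
      ≤ ∫ _, 2 * c ∂(ν.tilted f) := by
    refine integral_mono Integrable.of_finite Integrable.of_finite fun x => ?_
    have := le_of_abs_le (hf x)
    change f x - _ ≤ 2 * c
    linarith
  simpa using h2

/-- Two Gibbs measures are close in relative entropy if their energies are uniformly close. -/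
theorem klDiv_tilted_le (μ : Measure α) [IsProbabilityMeasure μ] {f g : α → ℝ} {c : ℝ}
    (hfg : ∀ x, |f x - g x| ≤ c) :
    InformationTheory.klDiv (μ.tilted f) (μ.tilted g) ≤ ENNReal.ofReal (2 * c) := by
  have : IsProbabilityMeasure (μ.tilted g) := isProbabilityMeasure_tilted Integrable.of_finite
  have h1 : μ.tilted f = (μ.tilted g).tilted (f - g) := by
    rw [tilted_tilted Integrable.of_finite, add_sub_cancel]
  rw [h1]
  exact klDiv_tilted_self_le _ hfg

end Entropy

section Entropy

variable {d m q : ℕ}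

instance : IsProbabilityMeasure (coarsePrior d m q) :=
  Measure.isProbabilityMeasure_map Measurable.of_discrete.aemeasurable

theorem coarsePrior_singleton (η : CoarseConfig d m q) :
    coarsePrior d m q {η} = (fibre η).card * (1 / 2) ^ Fintype.card (Site d (m * q)) := by
  rw [coarsePrior, Measure.map_apply Measurable.of_discrete (measurableSet_singleton η),
    preimage_blockSpin, prior_finset]

theorem condE_mul_coarsePrior (f : MicroConfig d (m * q) → ℝ) (η : CoarseConfig d m q) :
    condE f η * (coarsePrior d m q).real {η} = ∫ σ in blockSpin ⁻¹' {η}, f σ ∂prior d (m * q) := by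
  have hc : ((fibre η).card : ℝ) ≠ 0 := by exact_mod_cast (fibre_nonempty η).card_pos.ne'
  rw [preimage_blockSpin, setIntegral_finset, condE_eq, sliceMean,
    ← fibre, Measure.real, coarsePrior_singleton]
  · simp only [Measure.real, prior_singleton, smul_eq_mul, ← Finset.mul_sum, ENNReal.toReal_mul,
      ENNReal.toReal_natCast]
    field_simp
  · exact Integrable.of_finite.integrableOn

/-- The exact coarse-grained Hamiltonian describes the image of the microscopic Gibbs measure. -/
theorem map_microGibbs (L : ℝ) (V : ℝ → ℝ) {β : ℝ} (hβ : 0 < β) (h : ℝ) :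
    (microGibbs L V β h d (m * q)).map blockSpin
      = coarseGibbs β fun η : CoarseConfig d m q => exactH L V β h η := by
  set f : MicroConfig d (m * q) → ℝ := fun σ => -β * microH L V h σ with hf
  have hexp : ∀ η : CoarseConfig d m q, Real.exp (-β * exactH L V β h η)
      = condE (fun σ => Real.exp (f σ)) η := by
    intro η
    have hpos : 0 < condE (fun σ => Real.exp (f σ)) η := by
      rw [condE_eq, sliceMean, ← fibre]
      exact div_pos (Finset.sum_pos (fun σ _ => Real.exp_pos _) (fibre_nonempty η))
        (by exact_mod_cast (fibre_nonempty η).card_pos)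
    rw [exactH, ← mul_assoc, neg_mul_neg, mul_one_div_cancel hβ.ne', one_mul, Real.exp_log hpos]
  have hZ : ∫ η, Real.exp (-β * exactH L V β h η) ∂coarsePrior d m q
      = ∫ σ, Real.exp (f σ) ∂prior d (m * q) := by
    rw [integral_fintype Integrable.of_finite]
    simp only [hexp, smul_eq_mul]
    simp only [mul_comm _ (condE _ _), condE_mul_coarsePrior]
    rw [← integral_iUnion_fintype (fun η => MeasurableSet.of_discrete) ?_
      fun η => Integrable.of_finite.integrableOn]
    · rw [← Set.preimage_iUnion, Set.iUnion_of_singleton, Set.preimage_univ, setIntegral_univ]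
    · intro η η' hne
      exact Disjoint.preimage _ (Set.disjoint_singleton.2 hne)
  refine Measure.ext_of_singleton fun η => ?_
  rw [Measure.map_apply Measurable.of_discrete (measurableSet_singleton η), microGibbs, coarseGibbs,
    tilted_apply_eq_ofReal_integral, tilted_apply_eq_ofReal_integral, hZ]
  congr 1
  rw [integral_singleton]
  simp only [integral_div]
  rw [← condE_mul_coarsePrior, smul_eq_mul, hexp]
  ring

/-- An energy that approximates the exact coarse-grained Hamiltonian gives a Gibbs measure close to
the image of the microscopic one. -/
theorem klDiv_coarseGibbs_le {L : ℝ} {V : ℝ → ℝ} {β : ℝ} (hβ : 0 < β) (h : ℝ) [NeZero m] [NeZero q]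
    {K : CoarseConfig d m q → ℝ} {c : ℝ}
    (hK : ∀ η, |β / (((m * q) ^ d : ℕ) : ℝ) * (exactH L V β h η - K η)| ≤ c) :
    InformationTheory.klDiv (coarseGibbs β K) ((microGibbs L V β h d (m * q)).map blockSpin)
      / (((m * q) ^ d : ℕ) : ℝ≥0∞) ≤ ENNReal.ofReal (2 * c) := by
  have hN : (0 : ℝ) < (((m * q) ^ d : ℕ) : ℝ) := by
    exact_mod_cast pow_pos (Nat.mul_pos (NeZero.pos m) (NeZero.pos q)) d
  rw [map_microGibbs L V hβ h]
  refine ENNReal.div_le_of_le_mul ?_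
  rw [← ENNReal.ofReal_natCast, ← ENNReal.ofReal_mul' hN.le]
  refine (klDiv_tilted_le _ (c := c * (((m * q) ^ d : ℕ) : ℝ)) fun η => ?_).trans_eq
    (by rw [mul_assoc])
  have := hK η
  rw [div_mul_eq_mul_div, abs_div, abs_of_pos hN, div_le_iff₀ hN] at this
  refine le_trans (le_of_eq ?_) this
  congr 1
  ring

end Entropy

/-! ### Potentials -/

section Potentials

variable {d m q : ℕ}

theorem IsFiniteRangePotential.mono {R R' : ℝ} {Φ : Finset (Site d m) → CoarseConfig d m q → ℝ}
    (h : IsFiniteRangePotential R Φ) (hR : R ≤ R') : IsFiniteRangePotential R' Φ :=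
  ⟨h.empty, h.local_dep, h.translation, fun X ⟨k, hk, l, hl, hkl⟩ =>
    h.range X ⟨k, hk, l, hl, hR.trans_lt hkl⟩⟩

/-- The potential with the Hamiltonian `∑ g(k₁, k₂, k₃)`, a sum over all triples of cells. -/
def triplePotential (g : CoarseConfig d m q → Site d m → Site d m → Site d m → ℝ)
    (X : Finset (Site d m)) (η : CoarseConfig d m q) : ℝ :=
  ∑ k₁, ∑ k₂, ∑ k₃, if {k₁, k₂, k₃} = X then g η k₁ k₂ k₃ else 0

theorem potentialH_triplePotential
    (g : CoarseConfig d m q → Site d m → Site d m → Site d m → ℝ) (η : CoarseConfig d m q) :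
    potentialH (triplePotential g) η = ∑ k₁, ∑ k₂, ∑ k₃, g η k₁ k₂ k₃ := by
  unfold potentialH triplePotential
  rw [Finset.sum_comm]
  refine Finset.sum_congr rfl fun k₁ _ => ?_
  rw [Finset.sum_comm]
  refine Finset.sum_congr rfl fun k₂ _ => ?_
  rw [Finset.sum_comm]
  refine Finset.sum_congr rfl fun k₃ _ => ?_
  rw [Finset.sum_ite_eq, if_pos (Finset.mem_univ _)]

/-- A sum over chains `k₁, k₂, k₃` of cells with steps of bounded length has a potential of finite
range. -/
theorem isFiniteRangePotential_triplePotential [NeZero m]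
    {g : CoarseConfig d m q → Site d m → Site d m → Site d m → ℝ} {r : ℝ} (hr : 0 ≤ r)
    (hloc : ∀ η η' k₁ k₂ k₃, η k₁ = η' k₁ → η k₂ = η' k₂ → η k₃ = η' k₃ →
      g η k₁ k₂ k₃ = g η' k₁ k₂ k₃)
    (htrans : ∀ (a : Site d m) η k₁ k₂ k₃,
      g (fun k => η (k - a)) (k₁ + a) (k₂ + a) (k₃ + a) = g η k₁ k₂ k₃)
    (h₁ : ∀ η k₁ k₂ k₃, r < m * torusDist k₁ k₂ → g η k₁ k₂ k₃ = 0)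
    (h₂ : ∀ η k₁ k₂ k₃, r < m * torusDist k₂ k₃ → g η k₁ k₂ k₃ = 0) :
    IsFiniteRangePotential (2 * r) (triplePotential g) := by
  refine ⟨fun η => ?_, fun X η η' h => ?_, fun a X η => ?_, ?_⟩
  · simp [triplePotential]
  · unfold triplePotential
    refine Finset.sum_congr rfl fun k₁ _ => Finset.sum_congr rfl fun k₂ _ =>
      Finset.sum_congr rfl fun k₃ _ => ?_
    by_cases hX : {k₁, k₂, k₃} = X
    · subst hX
      rw [if_pos rfl, if_pos rfl]
      exact hloc _ _ _ _ _ (h _ (by simp)) (h _ (by simp)) (h _ (by simp))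
    · rw [if_neg hX, if_neg hX]
  · unfold triplePotential
    rw [← Equiv.sum_comp (Equiv.addRight a)]
    refine Finset.sum_congr rfl fun k₁ _ => ?_
    rw [← Equiv.sum_comp (Equiv.addRight a)]
    refine Finset.sum_congr rfl fun k₂ _ => ?_
    rw [← Equiv.sum_comp (Equiv.addRight a)]
    refine Finset.sum_congr rfl fun k₃ _ => ?_
    have hX : ({Equiv.addRight a k₁, Equiv.addRight a k₂, Equiv.addRight a k₃} : Finset (Site d m))
        = X.image (fun k => k + a) ↔ {k₁, k₂, k₃} = X := by
      have : ({Equiv.addRight a k₁, Equiv.addRight a k₂, Equiv.addRight a k₃} : Finset (Site d m))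
          = Finset.image (Equiv.addRight a) {k₁, k₂, k₃} := by
        simp only [Finset.image_insert, Finset.image_singleton]
      rw [this]
      exact (Finset.image_injective (Equiv.addRight a).injective).eq_iff
    simp only [hX]
    congr 1
    exact htrans a η k₁ k₂ k₃
  · rintro X ⟨k, hk, l, hl, hkl⟩ η
    refine Finset.sum_eq_zero fun k₁ _ => Finset.sum_eq_zero fun k₂ _ =>
      Finset.sum_eq_zero fun k₃ _ => ?_
    by_cases hX : {k₁, k₂, k₃} = X
    · rw [if_pos hX]
      subst hX
      by_contra hne
      have a1 : m * torusDist k₁ k₂ ≤ r := not_lt.1 fun hlt => hne (h₁ _ _ _ _ hlt)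
      have a2 : m * torusDist k₂ k₃ ≤ r := not_lt.1 fun hlt => hne (h₂ _ _ _ _ hlt)
      -- Every cell of the chain is within distance `r` of the middle one.
      have a3 : ∀ j ∈ ({k₁, k₂, k₃} : Finset (Site d m)), m * torusDist j k₂ ≤ r := by
        intro j hj
        simp only [Finset.mem_insert, Finset.mem_singleton] at hj
        rcases hj with rfl | rfl | rfl
        · exact a1
        · rw [torusDist_self, mul_zero]; exact hr
        · rw [torusDist_comm]; exact a2
      have a4 := mul_le_mul_of_nonneg_left (torusDist_triangle k k₂ l) (Nat.cast_nonneg (α := ℝ) m)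
      have a5 := a3 k hk
      have a6 := a3 l hl
      rw [torusDist_comm] at a6
      rw [mul_add] at a4
      linarith
    · rw [if_neg hX]

variable [NeZero m] [NeZero q] {L : ℝ} {V : ℝ → ℝ}

theorem offDev_eq_zero (hL : 0 < L) (hV1 : ∀ r, 1 ≤ r → V r = 0) {x y : Site d (m * q)}
    (h : cellRange d L q < m * torusDist (cellOf x) (cellOf y)) : offDev L V x y = 0 := by
  unfold offDev
  split_ifs
  · rfl
  · exact devJ_eq_zero hL hV1 h

theorem offDev_transSite (a : Site d m) (x y : Site d (m * q)) :
    offDev L V (transSite q a x) (transSite q a y) = offDev L V x y := by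
  unfold offDev
  rw [(isCellIsometry_transSite a).devJ_map]
  simp only [EmbeddingLike.apply_eq_iff_eq]

theorem offDev_eq_zero_of_cell (hL : 0 < L) (hV1 : ∀ r, 1 ≤ r → V r = 0) {k l : Site d m}
    (h : cellRange d L q < m * torusDist k l) {x y : Site d (m * q)} (hx : x ∈ cell q k)
    (hy : y ∈ cell q l) : offDev L V x y = 0 :=
  offDev_eq_zero hL hV1 (by rwa [mem_cell.1 hx, mem_cell.1 hy])

theorem jOne_eq_zero (hL : 0 < L) (hV1 : ∀ r, 1 ≤ r → V r = 0) {k l : Site d m}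
    (h : cellRange d L q < m * torusDist k l) : jOne L V q k l = 0 := by
  rw [jOne_eq]
  exact Finset.sum_eq_zero fun x hx => Finset.sum_eq_zero fun y hy => by
    rw [offDev_eq_zero_of_cell hL hV1 h hx hy, zero_mul]

theorem jTwo_eq_zero (hL : 0 < L) (hV1 : ∀ r, 1 ≤ r → V r = 0) {k l : Site d m}
    (h : cellRange d L q < m * torusDist k l) : jTwo L V q k l = 0 := by
  rw [jTwo_eq]
  exact Finset.sum_eq_zero fun x hx => Finset.sum_eq_zero fun y hy => by
    rw [offDev_eq_zero_of_cell hL hV1 h hx hy, zero_mul]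

theorem jThree_eq_zero_left (hL : 0 < L) (hV1 : ∀ r, 1 ≤ r → V r = 0) {k₁ k₂ : Site d m}
    (k₃ : Site d m) (h : cellRange d L q < m * torusDist k₁ k₂) : jThree L V q k₁ k₂ k₃ = 0 := by
  rw [jThree_eq]
  exact Finset.sum_eq_zero fun y hy => Finset.sum_eq_zero fun x hx => by
    rw [offDev_eq_zero_of_cell hL hV1 h hx hy, zero_mul]

theorem jThree_eq_zero_right (hL : 0 < L) (hV1 : ∀ r, 1 ≤ r → V r = 0) (k₁ : Site d m)
    {k₂ k₃ : Site d m} (h : cellRange d L q < m * torusDist k₂ k₃) :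
    jThree L V q k₁ k₂ k₃ = 0 := by
  rw [jThree_eq]
  exact Finset.sum_eq_zero fun y hy => Finset.sum_eq_zero fun x hx => by
    rw [Finset.sum_eq_zero fun z hz => offDev_eq_zero_of_cell hL hV1 h hy hz, mul_zero]

/-- The terms of `coarseH0`, indexed by the chains `k, l, l`, in which `k = l` is allowed; other
chains do not contribute. -/
def chainH0 (L : ℝ) (V : ℝ → ℝ) (h : ℝ) (η : CoarseConfig d m q) (k l j : Site d m) : ℝ :=
  if j = l then
    -(1 / 2) * (avgJ L V q k l * (((η k : ℤ) : ℝ) * ((η l : ℤ) : ℝ)))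
      + if k = l then 1 / 2 * ((q : ℝ) ^ d * avgJ L V q k k) + h * ((η k : ℤ) : ℝ) else 0
  else 0

/-- The terms of `coarseH1`, indexed by the chains `k, l, l`, in which `k = l` is allowed; other
chains do not contribute. -/
def chainH1 (L : ℝ) (V : ℝ → ℝ) (β : ℝ) (η : CoarseConfig d m q) (k l j : Site d m) : ℝ :=
  let E₁ := fun k => mom1 ((q : ℝ) ^ d) (alpha η k)
  let E₂ := fun k => mom2 ((q : ℝ) ^ d) (alpha η k)
  let E₃ := fun k => mom3 ((q : ℝ) ^ d) (alpha η k)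
  let E₄ := fun k => mom4 ((q : ℝ) ^ d) (alpha η k);
  if j = l then
    if l = k then
      -(β / 8 * (4 * jTwo L V q k k * (-E₄ k + E₂ k)
        + 2 * jOne L V q k k * (E₄ k + 1 - 2 * E₂ k)))
    else
      -(β / 2 * (1 / 2 * (jOne L V q k l * (E₂ k * E₂ l - E₂ l - E₂ k + 1)
          + jTwo L V q k l * (-2 * E₂ k * E₂ l + E₂ k + E₂ l)))
        + β / 2 * (jThree L V q k k l * (-E₃ k * E₁ l + 2 * E₁ k * E₁ l - E₃ l * E₁ k)))
  else 0

/-- The terms of `coarseH2`, indexed by the chains of three different cells. -/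
def chainH2 (L : ℝ) (V : ℝ → ℝ) (β : ℝ) (η : CoarseConfig d m q) (k₁ k₂ k₃ : Site d m) : ℝ :=
  let E₁ := fun k => mom1 ((q : ℝ) ^ d) (alpha η k)
  let E₂ := fun k => mom2 ((q : ℝ) ^ d) (alpha η k);
  if k₁ = k₂ ∨ k₃ = k₂ ∨ k₃ = k₁ then 0
  else -(β * (1 / 2 * (jThree L V q k₁ k₂ k₃ * (-E₁ k₁ * E₂ k₂ * E₁ k₃ + E₁ k₁ * E₁ k₃))))

theorem sum_chainH0 (h : ℝ) (η : CoarseConfig d m q) :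
    ∑ k, ∑ l, ∑ j, chainH0 L V h η k l j = coarseH0 L V h η := by
  rw [coarseH0_eq]
  simp only [chainH0, Finset.sum_ite_eq', Finset.sum_ite_eq, Finset.mem_univ, if_true,
    Finset.sum_add_distrib, meanFieldH, ← Finset.mul_sum]
  ring

theorem sum_chainH1 (β : ℝ) (η : CoarseConfig d m q) :
    ∑ k, ∑ l, ∑ j, chainH1 L V β η k l j = coarseH1 L V β η := by
  have h1 : ∀ (F : Site d m → ℝ) (G : Site d m → Site d m → ℝ),
      ∑ k, ∑ l, (if l = k then F k else G k l)
        = ∑ k, F k + ∑ k, ∑ l ∈ Finset.univ.erase k, G k l := by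
    intro F G
    rw [← Finset.sum_add_distrib]
    refine Finset.sum_congr rfl fun k _ => ?_
    rw [← Finset.add_sum_erase _ _ (Finset.mem_univ k), if_pos rfl]
    congr 1
    exact Finset.sum_congr rfl fun l hl => if_neg (Finset.ne_of_mem_erase hl)
  simp only [chainH1, Finset.sum_ite_eq', Finset.mem_univ, if_true]
  rw [h1]
  simp only [coarseH1, Finset.sum_neg_distrib, Finset.sum_add_distrib, ← Finset.mul_sum]
  ring

theorem sum_chainH2 (β : ℝ) (η : CoarseConfig d m q) :
    ∑ k₁, ∑ k₂, ∑ k₃, chainH2 L V β η k₁ k₂ k₃ = coarseH2 L V β η := by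
  have h1 : ∀ F : Site d m → Site d m → Site d m → ℝ,
      ∑ k₁, ∑ k₂, ∑ k₃, (if k₁ = k₂ ∨ k₃ = k₂ ∨ k₃ = k₁ then 0 else F k₁ k₂ k₃)
        = ∑ k₂, ∑ k₁ ∈ Finset.univ.erase k₂, ∑ k₃ ∈ (Finset.univ.erase k₂).erase k₁,
          F k₁ k₂ k₃ := by
    intro F
    rw [Finset.sum_comm]
    refine Finset.sum_congr rfl fun k₂ _ => ?_
    rw [← Finset.filter_ne', Finset.sum_filter]
    refine Finset.sum_congr rfl fun k₁ _ => ?_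
    by_cases hk : k₁ = k₂
    · simp [hk]
    · rw [if_pos hk, ← Finset.filter_ne', Finset.filter_filter, Finset.sum_filter]
      refine Finset.sum_congr rfl fun k₃ _ => ?_
      by_cases h2 : k₃ = k₂ <;> by_cases h3 : k₃ = k₁ <;> simp [hk, h2, h3]
  simp only [chainH2]
  rw [h1]
  simp only [coarseH2, Finset.sum_neg_distrib, ← Finset.mul_sum]

theorem alpha_congr {η η' : CoarseConfig d m q} {k : Site d m} (h : η k = η' k) :
    alpha η k = alpha η' k := by
  unfold alpha
  rw [h]

theorem alpha_shift (η : CoarseConfig d m q) (a k : Site d m) :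
    alpha (fun j => η (j - a)) (k + a) = alpha η k := by
  simp only [alpha, add_sub_cancel_right]

theorem avgJ_add_right (a k l : Site d m) : avgJ L V q (k + a) (l + a) = avgJ L V q k l :=
  (isCellIsometry_transSite a).avgJ_map k l

theorem jOne_add_right (a k l : Site d m) : jOne L V q (k + a) (l + a) = jOne L V q k l :=
  (isCellIsometry_transSite a).jOne_map k l

theorem jTwo_add_right (a k l : Site d m) : jTwo L V q (k + a) (l + a) = jTwo L V q k l :=
  (isCellIsometry_transSite a).jTwo_map k l

theorem jThree_add_right (a k l j : Site d m) :
    jThree L V q (k + a) (l + a) (j + a) = jThree L V q k l j :=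
  (isCellIsometry_transSite a).jThree_map k l j

theorem isFiniteRangePotential_chainH0 (hL : 0 < L) (hV1 : ∀ r, 1 ≤ r → V r = 0) (h : ℝ) :
    IsFiniteRangePotential (2 * cellRange d L q)
      (triplePotential (chainH0 (d := d) (m := m) (q := q) L V h)) := by
  have hr := cellRange_nonneg (d := d) (q := q) hL
  have hself : ∀ k : Site d m, ¬ cellRange d L q < m * torusDist k k := fun k => by
    rw [torusDist_self, mul_zero]
    exact not_lt.2 hr
  refine isFiniteRangePotential_triplePotential hr ?_ ?_ ?_ ?_
  · intro η η' k l j hk hl hj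
    simp only [chainH0, hk, hl]
  · intro a η k l j
    simp only [chainH0, add_sub_cancel_right, avgJ_add_right, add_left_inj]
  · intro η k l j hkl
    have hne : k ≠ l := by rintro rfl; exact hself _ hkl
    simp [chainH0, avgJ_eq_zero hL hV1 hkl, hne]
  · intro η k l j hlj
    have hne : j ≠ l := by rintro rfl; exact hself _ hlj
    simp [chainH0, hne]

theorem isFiniteRangePotential_chainH1 (hL : 0 < L) (hV1 : ∀ r, 1 ≤ r → V r = 0) (β : ℝ) :
    IsFiniteRangePotential (2 * cellRange d L q)
      (triplePotential (chainH1 (d := d) (m := m) (q := q) L V β)) := by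
  have hr := cellRange_nonneg (d := d) (q := q) hL
  have hself : ∀ k : Site d m, ¬ cellRange d L q < m * torusDist k k := fun k => by
    rw [torusDist_self, mul_zero]
    exact not_lt.2 hr
  refine isFiniteRangePotential_triplePotential hr ?_ ?_ ?_ ?_
  · intro η η' k l j hk hl hj
    simp only [chainH1, alpha_congr hk, alpha_congr hl]
  · intro a η k l j
    simp only [chainH1, alpha_shift, jOne_add_right, jTwo_add_right, jThree_add_right, add_left_inj]
  · intro η k l j hkl
    have hne : l ≠ k := by rintro rfl; exact hself _ hkl
    simp [chainH1, jOne_eq_zero hL hV1 hkl, jTwo_eq_zero hL hV1 hkl,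
      jThree_eq_zero_right hL hV1 k hkl, hne]
  · intro η k l j hlj
    have hne : j ≠ l := by rintro rfl; exact hself _ hlj
    simp [chainH1, hne]

theorem isFiniteRangePotential_chainH2 (hL : 0 < L) (hV1 : ∀ r, 1 ≤ r → V r = 0) (β : ℝ) :
    IsFiniteRangePotential (2 * cellRange d L q)
      (triplePotential (chainH2 (d := d) (m := m) (q := q) L V β)) := by
  refine isFiniteRangePotential_triplePotential (cellRange_nonneg hL) ?_ ?_ ?_ ?_
  · intro η η' k l j hk hl hj
    simp only [chainH2, alpha_congr hk, alpha_congr hl, alpha_congr hj]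
  · intro a η k l j
    simp only [chainH2, alpha_shift, jThree_add_right, add_left_inj]
  · intro η k l j hkl
    simp [chainH2, jThree_eq_zero_left hL hV1 j hkl]
  · intro η k l j hlj
    simp [chainH2, jThree_eq_zero_right hL hV1 k hlj]

theorem cumulant_fibre_congr {η η' : CoarseConfig d m q} {X : Finset (Site d m)}
    (h : ∀ k ∈ X, η k = η' k) {f : MicroConfig d (m * q) → ℝ} (hf : DependsOnCells cellOf X f)
    (j : ℕ) : cumulant (fibre η) f j = cumulant (fibre η') f j := by
  have hη : ∀ k ∈ X, (η k : ℤ) = (η' k : ℤ) := fun k hk => by rw [h k hk]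
  exact cumulant_congr (fibre_nonempty η) (fibre_nonempty η') hη hf j

/-- The potential of the `p`-th cumulant: the Möbius transform of the cumulants of the fluctuation
energies of the subsets of cells. -/
def cumulantPotential (L : ℝ) (V : ℝ → ℝ) (β : ℝ) (p : ℕ) (X : Finset (Site d m))
    (η : CoarseConfig d m q) : ℝ :=
  -(1 / β) * mobius (fun Y => cumulant (fibre η)
    (pairW (restrictA cellOf (devCoupling L V β) Y)) p) X

theorem potentialH_cumulantPotential (β : ℝ) (p : ℕ) (η : CoarseConfig d m q) :
    potentialH (cumulantPotential L V β p) η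
      = -(1 / β) * cumulant (fibre η) (pairW (devCoupling L V β)) p := by
  have h : restrictA cellOf (devCoupling L V β) Finset.univ
      = devCoupling (d := d) (m := m) (q := q) L V β := by
    funext x y
    simp [restrictA]
  unfold potentialH cumulantPotential
  rw [← Finset.mul_sum, ← Finset.powerset_univ, sum_powerset_mobius, h]

/-- Cumulants are local because the cells are independent given `η`, and their range is limited by
the number `2p` of cells that occur in a product of `p` pair interactions. -/
theorem isFiniteRangePotential_cumulantPotential (hL : 0 < L) (hV1 : ∀ r, 1 ≤ r → V r = 0)
    (β : ℝ) (p : ℕ) :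
    IsFiniteRangePotential ((2 * p : ℕ) * cellRange d L q)
      (cumulantPotential (d := d) (m := m) (q := q) L V β p) := by
  refine ⟨fun η => ?_, fun X η η' h => ?_, fun a X η => ?_, ?_⟩
  · unfold cumulantPotential
    have h := cumulant_restrictA_empty (fibre_nonempty η) (devCoupling L V β) p
    rw [mobius_eq, show ((∅ : Finset (Site d m)).ssubsets) = ∅ from rfl, Finset.sum_empty, fibre, h]
    simp
  · unfold cumulantPotential
    refine congrArg (fun t => -(1 / β) * t) ?_
    refine mobius_congr X fun Y hY => ?_
    exact cumulant_fibre_congr (fun k hk => h k (hY hk))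
      (dependsOnCells_pairW_restrictA cellOf (devCoupling L V β) Y) p
  · unfold cumulantPotential
    refine congrArg (fun t => -(1 / β) * t) ?_
    refine mobius_image (Equiv.addRight a) (fun Y => ?_) X
    refine cumulant_equiv (transSite q a) (Equiv.addRight a) (cellOf_transSite a) (fun k => ?_)
      (fun x y => ?_) p
    · simp only [Equiv.coe_addRight, add_sub_cancel_right]
    · have hmem : ∀ x : Site d (m * q), cellOf (transSite q a x) ∈ Y.image (Equiv.addRight a)
          ↔ cellOf x ∈ Y := by
        intro x
        rw [cellOf_transSite, Finset.mem_image]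
        constructor
        · rintro ⟨k, hk, hkx⟩
          rwa [← (Equiv.addRight a).injective hkx]
        · exact fun hx => ⟨_, hx, rfl⟩
      simp only [restrictA, hmem, devCoupling, offDev_transSite]
  · rintro X ⟨k, hk, l, hl, hkl⟩ η
    have hmob : mobius (fun Y => cumulant (fibre η)
        (pairW (restrictA cellOf (devCoupling L V β) Y)) p) X = 0 := by
      refine mobius_eq_zero_of_far (u := fun k l => m * torusDist k l) (cellRange_nonneg hL)
        (fun k => by rw [torusDist_self, mul_zero]) (fun k l j => ?_)
        (cumulant_restrictA_empty (fibre_nonempty η) _ p)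
        (hasDegreeLE_cumulant (fibre_nonempty η) _ p) (fun X₁ X₂ hd hsep => ?_) hk hl hkl
      · rw [← mul_add]
        exact mul_le_mul_of_nonneg_left (torusDist_triangle k l j) (Nat.cast_nonneg m)
      · refine cumulant_restrictA_union (fibre_nonempty η) hd (fun x y hx hy => ?_) p
        have hz : offDev L V x y = 0 := offDev_eq_zero hL hV1 (hsep _ hx _ hy)
        exact ⟨by rw [devCoupling, hz, mul_zero], by rw [devCoupling, offDev_comm, hz, mul_zero]⟩
    rw [cumulantPotential, hmob, mul_zero]

end Potentials

/-! ### The expansion -/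

section Expansion

variable {d m q : ℕ} [NeZero m] [NeZero q] {L : ℝ} {V : ℝ → ℝ}

/-- The potentials of the expansion. The first three have explicit Hamiltonians; the two of second
order together make up the second cumulant. -/
def expansionPotential (L : ℝ) (V : ℝ → ℝ) (β h : ℝ) :
    ℕ → Finset (Site d m) → CoarseConfig d m q → ℝ
  | 0 => triplePotential (chainH0 L V h)
  | 1 => triplePotential (chainH1 L V β)
  | 2 => triplePotential (chainH2 L V β)
  | p + 3 => cumulantPotential L V β (p + 3)

theorem potentialH_zero (β h : ℝ) (η : CoarseConfig d m q) :
    potentialH (expansionPotential L V β h 0) η = coarseH0 L V h η :=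
  (potentialH_triplePotential _ η).trans (sum_chainH0 h η)

theorem potentialH_one (β h : ℝ) (η : CoarseConfig d m q) :
    potentialH (expansionPotential L V β h 1) η = coarseH1 L V β η :=
  (potentialH_triplePotential _ η).trans (sum_chainH1 β η)

theorem potentialH_two (β h : ℝ) (η : CoarseConfig d m q) :
    potentialH (expansionPotential L V β h 2) η = coarseH2 L V β η :=
  (potentialH_triplePotential _ η).trans (sum_chainH2 β η)

theorem potentialH_add_three (β h : ℝ) (p : ℕ) (η : CoarseConfig d m q) :
    potentialH (expansionPotential L V β h (p + 3)) η
      = -(1 / β) * cumulant (fibre η) (pairW (devCoupling L V β)) (p + 3) :=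
  potentialH_cumulantPotential β (p + 3) η

theorem isFiniteRangePotential_expansionPotential (hL : 0 < L) (hV1 : ∀ r, 1 ≤ r → V r = 0)
    (β h : ℝ) (p : ℕ) :
    IsFiniteRangePotential ((2 * p + 2) * cellRange d L q)
      (expansionPotential (d := d) (m := m) (q := q) L V β h p) := by
  have hr := cellRange_nonneg (d := d) (q := q) hL
  have h2 : 2 * cellRange d L q ≤ (2 * p + 2) * cellRange d L q :=
    mul_le_mul_of_nonneg_right (by linarith [Nat.cast_nonneg (α := ℝ) p]) hr
  match p with
  | 0 => exact (isFiniteRangePotential_chainH0 hL hV1 h).mono h2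
  | 1 => exact (isFiniteRangePotential_chainH1 hL hV1 β).mono h2
  | 2 => exact (isFiniteRangePotential_chainH2 hL hV1 β).mono h2
  | p + 3 =>
    refine (isFiniteRangePotential_cumulantPotential hL hV1 β (p + 3)).mono
      (mul_le_mul_of_nonneg_right ?_ hr)
    push_cast
    linarith

theorem cumulant_zero {α : Type*} (Ω : Finset α) (W : α → ℝ) : cumulant Ω W 0 = 0 := by
  simp [cumulant, logCoeff]

theorem sum_range_two_cumulant (β : ℝ) (η : CoarseConfig d m q) :
    ∑ j ∈ Finset.range 2, cumulant (fibre η) (pairW (devCoupling L V β)) j = 0 := by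
  rw [Finset.sum_range_succ, Finset.sum_range_one, cumulant_zero, cumulant_fibre_one,
    condE_pairW_devCoupling, add_zero]

/-- From the second order on, the partial sums of the cumulants are those of the expansion. -/
theorem sum_range_add_three (β h : ℝ) (hβ : 0 < β) (p : ℕ) (η : CoarseConfig d m q) :
    β * ∑ i ∈ Finset.range (p + 3), potentialH (expansionPotential L V β h i) η
      = β * coarseH0 L V h η
        - ∑ j ∈ Finset.range (p + 3), cumulant (fibre η) (pairW (devCoupling L V β)) j := by
  induction p with
  | zero =>
    rw [Finset.sum_range_succ (n := 2), Finset.sum_range_succ (n := 2), sum_range_two_cumulant,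
      cumulant_two_eq, Finset.sum_range_succ, Finset.sum_range_one, potentialH_zero,
      potentialH_one, potentialH_two]
    ring
  | succ p ih =>
    rw [Finset.sum_range_succ, mul_add, show p + 1 + 2 = p + 3 from rfl, ih, potentialH_add_three,
      Finset.sum_range_succ (n := p + 3)]
    field_simp
    ring

/-- The tail of a geometrically bounded series. -/
theorem abs_sub_sum_range_le {c : ℕ → ℝ} {S B x : ℝ} (hc : HasSum c S) (hx0 : 0 ≤ x)
    (hx : 2 * x ≤ 1) (hb : ∀ j, 1 ≤ j → |c j| ≤ B * x * x ^ (j - 1)) (p : ℕ) :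
    |S - ∑ j ∈ Finset.range (p + 1), c j| ≤ 2 * B * x ^ (p + 1) := by
  have hB : 0 ≤ B * x := by simpa using (abs_nonneg _).trans (hb 1 le_rfl)
  have h1 : HasSum (fun n => c (n + (p + 1))) (S - ∑ j ∈ Finset.range (p + 1), c j) :=
    (hasSum_nat_add_iff' (p + 1)).2 hc
  have h2 : HasSum (fun n => B * x * x ^ p * x ^ n) (B * x * x ^ p * (1 - x)⁻¹) :=
    (hasSum_geometric_of_lt_one hx0 (by linarith)).mul_left _
  have h3 : ∀ n, |c (n + (p + 1))| ≤ B * x * x ^ p * x ^ n := fun n => by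
    refine (hb _ (by omega)).trans (le_of_eq ?_)
    rw [show n + (p + 1) - 1 = p + n by omega, pow_add, mul_assoc, mul_assoc, mul_assoc]
  have h4 : |S - ∑ j ∈ Finset.range (p + 1), c j| ≤ B * x * x ^ p * (1 - x)⁻¹ := by
    rw [← h1.tsum_eq, ← h2.tsum_eq]
    have hs : Summable fun n => |c (n + (p + 1))| :=
      Summable.of_nonneg_of_le (fun _ => abs_nonneg _) h3 h2.summable
    have h5 : ‖∑' n, c (n + (p + 1))‖ ≤ ∑' n, ‖c (n + (p + 1))‖ := norm_tsum_le_tsum_norm hs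
    exact h5.trans (hs.tsum_le_tsum h3 h2.summable)
  have h6 : (1 - x)⁻¹ ≤ 2 := inv_le_of_inv_le₀ (by norm_num) (by linarith)
  refine h4.trans ((mul_le_mul_of_nonneg_left h6 (by positivity)).trans (le_of_eq ?_))
  rw [pow_succ]
  ring

variable (hL : 0 < L) (hV : ContDiffOn ℝ 1 V (Set.Ici 0)) (hV1 : ∀ r, 1 ≤ r → V r = 0)
  {β : ℝ} (hβ : 0 < β) (h : ℝ) (η : CoarseConfig d m q)
  (hρ : 160 * (rowConst d * smallEps L V β q) ≤ 1)

include hL hV hV1 hβ hρ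

/-- The remainder of the cumulant expansion. -/
theorem abs_cumulant_remainder_le (p : ℕ) :
    |-β * (exactH L V β h η - coarseH0 L V h η)
        - ∑ j ∈ Finset.range (p + 1), cumulant (fibre η) (pairW (devCoupling L V β)) j|
      ≤ (((m * q) ^ d : ℕ) : ℝ) * (80 * (rowConst d * smallEps L V β q)) ^ (p + 1) := by
  obtain ⟨h1, h2⟩ := cumulant_expansion hL hV hV1 hβ h η hρ
  have h0 : 0 ≤ rowConst d * smallEps L V β q :=
    mul_nonneg (zero_le_one.trans (one_le_rowConst d)) (smallEps_nonneg hL hβ q)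
  have hN : (0 : ℝ) ≤ (((m * q) ^ d : ℕ) : ℝ) := Nat.cast_nonneg _
  have h3 := abs_sub_sum_range_le (B := (((m * q) ^ d : ℕ) : ℝ) / 2) h2
    (x := 80 * (rowConst d * smallEps L V β q)) (by positivity) (by linarith) (fun j hj => by
      refine (h1 j hj).trans ?_
      have : 0 ≤ (((m * q) ^ d : ℕ) : ℝ) * (rowConst d * smallEps L V β q)
          * (80 * (rowConst d * smallEps L V β q)) ^ (j - 1) := by positivity
      linarith) p
  refine h3.trans (le_of_eq (by ring))

theorem hasSum_potentialH :
    HasSum (fun p => potentialH (expansionPotential L V β h p) η) (exactH L V β h η) := by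
  obtain ⟨-, h2⟩ := cumulant_expansion hL hV hV1 hβ h η hρ
  have h3 := ((hasSum_nat_add_iff' 3).2 h2).mul_left (-(1 / β))
  rw [← hasSum_nat_add_iff' 3]
  simp only [potentialH_add_three]
  have h4 := sum_range_add_three (L := L) (V := V) β h hβ 0 η
  rw [zero_add] at h4
  have h5 : ∑ i ∈ Finset.range 3, potentialH (expansionPotential L V β h i) η
      = 1 / β * (β * ∑ i ∈ Finset.range 3, potentialH (expansionPotential L V β h i) η) := by
    field_simp
  have h6 : exactH L V β h η
      - ∑ i ∈ Finset.range 3, potentialH (expansionPotential L V β h i) η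
      = -(1 / β) * (-β * (exactH L V β h η - coarseH0 L V h η)
        - ∑ j ∈ Finset.range 3, cumulant (fibre η) (pairW (devCoupling L V β)) j) := by
    rw [h5, h4]
    field_simp
    ring
  rw [h6]
  exact h3

/-- The error of the expansion after the zeroth term, which is of second order because the
fluctuation energy has mean zero. -/
theorem abs_error_zero_le :
    |β / (((m * q) ^ d : ℕ) : ℝ) * (exactH L V β h η - coarseH0 L V h η)|
      ≤ (80 * (rowConst d * smallEps L V β q)) ^ 2 := by
  have hN : (0 : ℝ) < (((m * q) ^ d : ℕ) : ℝ) := by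
    exact_mod_cast pow_pos (Nat.mul_pos (NeZero.pos m) (NeZero.pos q)) d
  have h1 := abs_cumulant_remainder_le hL hV hV1 hβ h η hρ 1
  rw [sum_range_two_cumulant, sub_zero, neg_mul, abs_neg] at h1
  rw [div_mul_eq_mul_div, abs_div, abs_of_pos hN, div_le_iff₀ hN, mul_comm (_ ^ 2)]
  exact h1

/-- The error of the expansion after the term of index `p`. The partial sums agree with those of the
cumulant series except at `p = 1`, where the second cumulant is only taken into account in part. -/
theorem abs_error_le (p : ℕ) :
    |β / (((m * q) ^ d : ℕ) : ℝ) * (exactH L V β h η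
        - ∑ i ∈ Finset.range (p + 1), potentialH (expansionPotential L V β h i) η)|
      ≤ 2 * (80 * (rowConst d * smallEps L V β q)) ^ (p + 1) := by
  have hN : (0 : ℝ) < (((m * q) ^ d : ℕ) : ℝ) := by
    exact_mod_cast pow_pos (Nat.mul_pos (NeZero.pos m) (NeZero.pos q)) d
  have h0 : 0 ≤ rowConst d * smallEps L V β q :=
    mul_nonneg (zero_le_one.trans (one_le_rowConst d)) (smallEps_nonneg hL hβ q)
  match p with
  | 0 =>
    rw [Finset.sum_range_one, potentialH_zero]
    refine (abs_error_zero_le hL hV hV1 hβ h η hρ).trans ?_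
    generalize rowConst d * smallEps L V β q = t at h0 hρ ⊢
    rw [zero_add, pow_one]
    nlinarith
  | 1 =>
    rw [div_mul_eq_mul_div, abs_div, abs_of_pos hN, div_le_iff₀ hN]
    have h1 := abs_cumulant_remainder_le hL hV hV1 hβ h η hρ 2
    have h2 := abs_coarseH2_le hL hV hV1 hβ η
    have h3 := sum_range_add_three (L := L) (V := V) β h hβ 0 η
    simp only [zero_add, Nat.reduceAdd] at h1 h3
    rw [Finset.sum_range_succ, potentialH_two] at h3
    -- Dropping the three-cell part of the second cumulant costs its trivial bound.
    have h4 : β * (exactH L V β h η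
        - ∑ i ∈ Finset.range (1 + 1), potentialH (expansionPotential L V β h i) η)
        = -(-β * (exactH L V β h η - coarseH0 L V h η)
        - ∑ j ∈ Finset.range 3, cumulant (fibre η) (pairW (devCoupling L V β)) j)
          + β * coarseH2 L V β η := by
      simp only [Nat.reduceAdd]
      linarith
    rw [h4]
    refine (abs_add_le _ _).trans ?_
    rw [abs_neg]
    refine (add_le_add h1 h2).trans ?_
    rw [← mul_add, mul_comm]
    refine mul_le_mul_of_nonneg_right ?_ hN.le
    generalize rowConst d * smallEps L V β q = t at h0 hρ ⊢
    have h5 : (80 * t) ^ 3 ≤ (80 * t) ^ 2 :=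
      pow_le_pow_of_le_one (by positivity) (by linarith) (by norm_num)
    have h6 : t ^ 2 ≤ (80 * t) ^ 2 := by nlinarith
    simp only [Nat.reduceAdd]
    linarith
  | p + 2 =>
    rw [div_mul_eq_mul_div, abs_div, abs_of_pos hN, div_le_iff₀ hN]
    have h1 := abs_cumulant_remainder_le hL hV hV1 hβ h η hρ (p + 2)
    have h2 := sum_range_add_three (L := L) (V := V) β h hβ p η
    rw [mul_sub, show p + 2 + 1 = p + 3 from rfl, h2, ← abs_neg]
    refine (le_of_eq ?_).trans (h1.trans ?_)
    · congr 1
      ring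
    · have : 0 ≤ (((m * q) ^ d : ℕ) : ℝ) * (80 * (rowConst d * smallEps L V β q)) ^ (p + 2 + 1) := by
        positivity
      linarith

end Expansion

end Kadanoff

end

theorem mainTheorem1 (d : ℕ) (hd : 0 < d) :
    ∃ δ₀ : ℝ, 0 < δ₀ ∧ ∃ C : ℕ → ℝ,
      ∀ (q : ℕ) (L : ℝ) (V : ℝ → ℝ) (β h : ℝ),
        0 < q → 0 < L → 0 < β →
        ContDiffOn ℝ 1 V (Set.Ici 0) → (∀ r, 1 ≤ r → V r = 0) →
        (q : ℝ) ^ d * Kadanoff.smallEps L V β q < δ₀ →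
        ∃ R : ℕ → ℝ, ∀ m : ℕ, 0 < m →
          ∃ Φ : ℕ → Finset (Kadanoff.Site d m) → Kadanoff.CoarseConfig d m q → ℝ,
            (∀ p, Kadanoff.IsFiniteRangePotential (R p) (Φ p)) ∧
            (∀ η, Kadanoff.potentialH (Φ 0) η = Kadanoff.coarseH0 L V h η) ∧
            (∀ η, Kadanoff.potentialH (Φ 1) η = Kadanoff.coarseH1 L V β η) ∧
            (∀ η, Kadanoff.potentialH (Φ 2) η = Kadanoff.coarseH2 L V β η) ∧
            (∀ η, HasSum (fun p => Kadanoff.potentialH (Φ p) η) (Kadanoff.exactH L V β h η)) ∧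
            (∀ (p : ℕ) (η : Kadanoff.CoarseConfig d m q),
              |β / (((m * q) ^ d : ℕ) : ℝ) * (Kadanoff.exactH L V β h η
                  - ∑ i ∈ Finset.range (p + 1), Kadanoff.potentialH (Φ i) η)|
                ≤ C p * Kadanoff.smallEps L V β q ^ (p + 1)) ∧
            InformationTheory.klDiv
                (Kadanoff.coarseGibbs β fun η => Kadanoff.potentialH (Φ 0) η)
                ((Kadanoff.microGibbs L V β h d (m * q)).map Kadanoff.blockSpin)
                / (((m * q) ^ d : ℕ) : ENNReal)
              ≤ ENNReal.ofReal (C 0 * Kadanoff.smallEps L V β q ^ 2) ∧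
            (∀ p : ℕ, InformationTheory.klDiv
                (Kadanoff.coarseGibbs β fun η =>
                  ∑ i ∈ Finset.range (p + 1), Kadanoff.potentialH (Φ i) η)
                ((Kadanoff.microGibbs L V β h d (m * q)).map Kadanoff.blockSpin)
                / (((m * q) ^ d : ℕ) : ENNReal)
              ≤ ENNReal.ofReal (C p * Kadanoff.smallEps L V β q ^ (p + 1))) := by
  have hκ := Kadanoff.one_le_rowConst d
  set κ := Kadanoff.rowConst d
  -- As `ε ≤ q ^ d * ε`, the choice of `δ₀` ensures `160 κ ε ≤ 1`. In the constants, `4 = 2 * 2`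
  -- accounts for the error bound and the relative entropy, and the exponent `p + 2` makes `C 0`
  -- large enough for the bound of order `ε ^ 2`.
  refine ⟨1 / (160 * κ), by positivity, fun p => 4 * (80 * κ) ^ (p + 2), ?_⟩
  intro q L V β h hq hL hβ hV hV1 hδ
  refine ⟨fun p => (2 * p + 2) * Kadanoff.cellRange d L q, fun m hm => ?_⟩
  have : NeZero m := ⟨hm.ne'⟩
  have : NeZero q := ⟨hq.ne'⟩
  have hε := Kadanoff.smallEps_nonneg (V := V) hL hβ q
  set ε := Kadanoff.smallEps L V β q
  have hρ : 160 * (κ * ε) ≤ 1 := by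
    have h1 : ε ≤ (q : ℝ) ^ d * ε :=
      le_mul_of_one_le_left hε (one_le_pow₀ (by exact_mod_cast hq))
    have h2 := h1.trans hδ.le
    rw [le_div_iff₀ (by positivity)] at h2
    linarith
  have hC : ∀ p : ℕ, 2 * (2 * (80 * (κ * ε)) ^ (p + 1)) ≤ 4 * (80 * κ) ^ (p + 2) * ε ^ (p + 1) := by
    intro p
    have h1 : (80 * κ) ^ (p + 1) ≤ (80 * κ) ^ (p + 2) :=
      pow_le_pow_right₀ (by linarith) (Nat.le_succ _)
    rw [← mul_assoc 80 κ ε, mul_pow]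
    have h2 := mul_le_mul_of_nonneg_right h1 (pow_nonneg hε (p + 1))
    linarith
  refine ⟨Kadanoff.expansionPotential L V β h,
    Kadanoff.isFiniteRangePotential_expansionPotential hL hV1 β h,
    Kadanoff.potentialH_zero β h, Kadanoff.potentialH_one β h, Kadanoff.potentialH_two β h,
    fun η => Kadanoff.hasSum_potentialH hL hV hV1 hβ h η hρ, fun p η => ?_, ?_, fun p => ?_⟩
  · refine (Kadanoff.abs_error_le hL hV hV1 hβ h η hρ p).trans ?_
    have : 0 ≤ (80 * (κ * ε)) ^ (p + 1) := by positivity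
    linarith [hC p]
  · refine (Kadanoff.klDiv_coarseGibbs_le hβ h (c := (80 * (κ * ε)) ^ 2) fun η => ?_).trans
      (ENNReal.ofReal_le_ofReal ?_)
    · rw [Kadanoff.potentialH_zero]
      exact Kadanoff.abs_error_zero_le hL hV hV1 hβ h η hρ
    · have : 0 ≤ (80 * κ) ^ 2 * ε ^ 2 := by positivity
      rw [← mul_assoc 80 κ ε, mul_pow]
      simp only [zero_add]
      linarith
  · exact (Kadanoff.klDiv_coarseGibbs_le hβ h fun η =>
      Kadanoff.abs_error_le hL hV hV1 hβ h η hρ p).trans (ENNReal.ofReal_le_ofReal (hC p))
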